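/- Let $0<\beta<1/2$, $0\le\theta\le 1$, and let $K$ be a measurable function on $(0,1)$ with $0<K_m\le K(x)\le K_M<\infty$ for a.e. $x$. For $w$ on $(0,1)$ put $${}^l I^{\beta}_x w=\frac1{\Gamma(\beta)}\int_0^x\frac{w(s)}{(x-s)^{1-\beta}}\,ds,\qquad {}^r I^{\beta}_x w=\frac1{\Gamma(\beta)}\int_x^1\frac{w(s)}{(s-x)^{1-\beta}}\,ds,\qquad I^\beta_\theta w=\theta\,{}^l I^{\beta}_x w+(1-\theta)\,{}^r I^{\beta}_x w .$$ For $\mu>0$ let $H^\mu_0(0,1)$ be the completion of $C_0^\infty(0,1)$ in the norm of $H^\mu(\mathbb R)$ (realised as a space of functions in $L^2(0,1)$), and let $H^{-1}(0,1)$ be the dual of $H^1_0(0,1)$. For $f\in H^{-1}(0,1)$, a weak solution of the Petrov–Galerkin formulation is a function $u\in H^{1-\beta}_0(0,1)$ such that $I^\beta_\theta u\in H^1(0,1)$ and $$\bigl(K\,D I^\beta_\theta u,\,Dv\bigr)_{L^2(0,1)}=\langle f,v\rangle\qquad\text{for all } v\in H^1_0(0,1).$$ Let $w_l\in H^1(0,1)$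 be the weak solution of $-D(K\,Dw_l)=0$, $w_l(0)=1$, $w_l(1)=0$. There is a unique $u_l\in H^{1-\beta}_0(0,1)$ such that, on $[0,1]$, $$I^\beta_\theta u_l-(1-\theta)\,({}^r I^{\beta}_x u_l)|_{x=0}\,(1-x)-\theta\,({}^l I^{\beta}_x u_l)|_{x=1}\,x=w_l(x)-(1-x).$$ Consider the condition $$1+\theta\,({}^l I^{\beta}_x u_l)|_{x=1}-(1-\theta)\,({}^r I^{\beta}_x u_l)|_{x=0}\neq 0.\tag{V}$$ Then, for every $f\in H^{-1}(0,1)$: if (V) holds, the Petrov–Galerkin formulation has at least one weak solution; and it has exactly one weak solution if and only if (V) holds. -/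

import Mathlib

open MeasureTheory Set
open scoped ENNReal NNReal ContDiff FourierTransform

noncomputable section

namespace FracDiffusion

/-- Lebesgue measure on the interval `(0,1)`. -/
abbrev vol01 : Measure ℝ := volume.restrict (Ioo (0 : ℝ) 1)

/-- The space `L²(0,1)` of real functions. -/
abbrev L2I : Type := Lp ℝ 2 vol01

/-- Extension by zero of (a representative of) `u ∈ L²(0,1)` to the real line. -/
def zext (u : L2I) : ℝ → ℝ := (Ioo (0 : ℝ) 1).indicator u

/-- `φ ∈ C₀^∞(0,1)`. -/
def IsTest (φ : ℝ → ℝ) : Prop :=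
  ContDiff ℝ ∞ φ ∧ HasCompactSupport φ ∧ tsupport φ ⊆ Ioo (0 : ℝ) 1

/-- The seminorm `‖ |ω|^μ ŵ ‖_{L²(ℝ)}`. Mathlib's Fourier transform uses the frequency `ξ` with
`ω = 2πξ`, and is unitary in `ξ`. -/
def hSeminorm (μ : ℝ) (w : ℝ → ℝ) : ℝ≥0∞ :=
  eLpNorm (fun ξ : ℝ => ((|2 * Real.pi * ξ| ^ μ : ℝ) : ℂ) * 𝓕 (fun x : ℝ => (w x : ℂ)) ξ) 2 volume

/-- The norm `(‖w‖²_{L²(ℝ)} + |w|²_{H^μ(ℝ)})^{1/2}`, with value `∞` allowed. -/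
def hNorm (μ : ℝ) (w : ℝ → ℝ) : ℝ≥0∞ :=
  (eLpNorm w 2 volume ^ 2 + hSeminorm μ w ^ 2) ^ (1 / 2 : ℝ)

lemma zext_memLp (u : L2I) : MemLp (zext u) 2 volume :=
  (memLp_indicator_iff_restrict measurableSet_Ioo).2 (Lp.memLp u)

lemma zext_integrable (u : L2I) : Integrable (zext u) :=
  (integrable_indicator_iff measurableSet_Ioo).2 ((Lp.memLp u).integrable (by norm_num))

lemma zext_add (u v : L2I) : zext (u + v) =ᵐ[volume] fun x => zext u x + zext v x := by
  have h := (ae_restrict_iff' measurableSet_Ioo).1 (Lp.coeFn_add u v)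
  filter_upwards [h] with x hx
  by_cases hm : x ∈ Ioo (0 : ℝ) 1
  · simp only [zext, hm, indicator_of_mem]; exact hx hm
  · simp [zext, hm]

lemma zext_smul (c : ℝ) (u : L2I) : zext (c • u) =ᵐ[volume] fun x => c * zext u x := by
  have h := (ae_restrict_iff' measurableSet_Ioo).1 (Lp.coeFn_smul c u)
  filter_upwards [h] with x hx
  by_cases hm : x ∈ Ioo (0 : ℝ) 1
  · simp [zext, hm, hx hm]
  · simp [zext, hm]

lemma zext_zero : zext 0 =ᵐ[volume] fun _ => 0 := by
  have h := (ae_restrict_iff' measurableSet_Ioo).1 (Lp.coeFn_zero ℝ 2 vol01)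
  filter_upwards [h] with x hx
  by_cases hm : x ∈ Ioo (0 : ℝ) 1
  · simp only [zext, hm, indicator_of_mem]; exact hx hm
  · simp [zext, hm]

lemma hNorm_congr (μ : ℝ) {w w' : ℝ → ℝ} (h : w =ᵐ[volume] w') : hNorm μ w = hNorm μ w' := by
  have hF : 𝓕 (fun x : ℝ => (w x : ℂ)) = 𝓕 (fun x : ℝ => (w' x : ℂ)) := by
    ext ξ
    rw [Real.fourier_eq, Real.fourier_eq]
    apply integral_congr_ae
    filter_upwards [h] with x hx
    rw [hx]
  rw [hNorm, hNorm, hSeminorm, hSeminorm, hF, eLpNorm_congr_ae h]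

lemma hSeminorm_add_le (μ : ℝ) (hμ : 0 ≤ μ) {w w' : ℝ → ℝ} (h : Integrable w)
    (h' : Integrable w') :
    hSeminorm μ (fun x => w x + w' x) ≤ hSeminorm μ w + hSeminorm μ w' := by
  have hm : ∀ {g : ℝ → ℝ}, Integrable g → AEStronglyMeasurable
      (fun ξ : ℝ => ((|2 * Real.pi * ξ| ^ μ : ℝ) : ℂ) * 𝓕 (fun x : ℝ => (g x : ℂ)) ξ) volume := by
    intro g hg
    have hc : Continuous (𝓕 (fun x : ℝ => (g x : ℂ))) :=
      VectorFourier.fourierIntegral_continuous Real.continuous_fourierChar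
        (by exact continuous_inner) hg.ofReal
    have hp : Continuous (fun ξ : ℝ => ((|2 * Real.pi * ξ| ^ μ : ℝ) : ℂ)) := by
      refine Complex.continuous_ofReal.comp ?_
      exact Continuous.rpow_const (by fun_prop) (fun _ => Or.inr hμ)
    exact (hp.mul hc).aestronglyMeasurable
  have hF : ∀ ξ, 𝓕 (fun x : ℝ => ((w x + w' x : ℝ) : ℂ)) ξ
      = 𝓕 (fun x : ℝ => (w x : ℂ)) ξ + 𝓕 (fun x : ℝ => (w' x : ℂ)) ξ := by
    intro ξ
    simp only [Real.fourier_eq, Complex.ofReal_add, smul_add]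
    exact integral_add ((Real.fourierIntegral_convergent_iff ξ).2 h.ofReal)
      ((Real.fourierIntegral_convergent_iff ξ).2 h'.ofReal)
  refine le_trans (le_of_eq ?_) (eLpNorm_add_le (hm h) (hm h') (by norm_num))
  rw [hSeminorm]
  congr 1
  ext ξ
  simp only [hF, Pi.add_apply]
  ring

lemma hNorm_add_le (μ : ℝ) (hμ : 0 ≤ μ) {w w' : ℝ → ℝ} (h : Integrable w) (h' : Integrable w') :
    hNorm μ (fun x => w x + w' x) ≤ hNorm μ w + hNorm μ w' := by
  have h1 : eLpNorm (fun x => w x + w' x) 2 volume ≤ eLpNorm w 2 volume + eLpNorm w' 2 volume :=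
    eLpNorm_add_le h.1 h'.1 (by norm_num)
  have h2 := hSeminorm_add_le μ hμ h h'
  have key := ENNReal.Lp_add_le (Finset.univ : Finset (Fin 2))
    ![eLpNorm w 2 volume, hSeminorm μ w] ![eLpNorm w' 2 volume, hSeminorm μ w']
    (p := 2) (by norm_num)
  simp only [Fin.sum_univ_two, Matrix.cons_val_zero, Matrix.cons_val_one,
    ENNReal.rpow_two] at key
  refine le_trans ?_ key
  rw [hNorm]
  gcongr

lemma hNorm_smul (μ c : ℝ) (w : ℝ → ℝ) :
    hNorm μ (fun x => c * w x) = ‖c‖ₑ * hNorm μ w := by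
  have h1 : eLpNorm (fun x => c * w x) 2 volume = ‖c‖ₑ * eLpNorm w 2 volume :=
    eLpNorm_const_smul c w 2 volume
  have hF : ∀ ξ, 𝓕 (fun x : ℝ => ((c * w x : ℝ) : ℂ)) ξ
      = (c : ℂ) * 𝓕 (fun x : ℝ => (w x : ℂ)) ξ := by
    intro ξ
    simp only [Real.fourier_eq, Complex.ofReal_mul]
    rw [← integral_const_mul]
    congr 1
    ext x
    rw [← smul_eq_mul (c : ℂ), ← smul_eq_mul (c : ℂ), smul_comm]
  have h2 : hSeminorm μ (fun x => c * w x) = ‖c‖ₑ * hSeminorm μ w := by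
    have h3 := eLpNorm_const_smul (c : ℂ)
      (fun ξ : ℝ => ((|2 * Real.pi * ξ| ^ μ : ℝ) : ℂ) * 𝓕 (fun x : ℝ => (w x : ℂ)) ξ) 2 volume
    have hc : ‖(c : ℂ)‖ₑ = ‖c‖ₑ := by simp [enorm, nnnorm]
    rw [hc] at h3
    rw [hSeminorm, hSeminorm, ← h3]
    congr 1
    ext ξ
    simp only [hF, Pi.smul_apply, smul_eq_mul]
    ring
  rw [hNorm, hNorm, h1, h2, mul_pow, mul_pow, ← mul_add,
    ENNReal.mul_rpow_of_nonneg _ _ (by norm_num), ← ENNReal.rpow_two, ← ENNReal.rpow_mul]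
  norm_num

lemma IsTest.integrable {φ : ℝ → ℝ} (h : IsTest φ) : Integrable φ :=
  h.1.continuous.integrable_of_hasCompactSupport h.2.1

lemma isTest_zero : IsTest (fun _ => 0) :=
  ⟨contDiff_const, HasCompactSupport.zero, by
    have : (fun _ : ℝ => (0 : ℝ)) = 0 := rfl
    simp [this, tsupport]⟩

lemma IsTest.add {φ ψ : ℝ → ℝ} (h : IsTest φ) (h' : IsTest ψ) :
    IsTest (fun x => φ x + ψ x) :=
  ⟨h.1.add h'.1, h.2.1.add h'.2.1, (tsupport_add φ ψ).trans (union_subset h.2.2 h'.2.2)⟩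

lemma IsTest.const_mul {φ : ℝ → ℝ} (h : IsTest φ) (c : ℝ) : IsTest (fun x => c * φ x) :=
  ⟨contDiff_const.mul h.1, h.2.1.mul_left,
    (closure_mono (Function.support_mul_subset_right _ _)).trans h.2.2⟩

/-- The space `H^μ_0(0,1)`, `μ ≥ 0`: the closure of `C₀^∞(0,1)` in the norm of `H^μ(ℝ)`,
a subspace of `L²(0,1)`; functions are extended by zero outside `(0,1)`. -/
def H0 (μ : ℝ≥0) : Submodule ℝ L2I where
  carrier := {u | ∀ ε : ℝ≥0∞, 0 < ε → ∃ φ, IsTest φ ∧ hNorm μ (fun x => zext u x - φ x) < ε}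
  zero_mem' := by
    intro ε hε
    refine ⟨fun _ => 0, isTest_zero, ?_⟩
    have h : (fun x => zext 0 x - 0) =ᵐ[volume] fun _ => (0 : ℝ) * 0 := by
      filter_upwards [zext_zero] with x hx
      simp [hx]
    rw [hNorm_congr _ h, hNorm_smul (μ : ℝ) 0 (fun _ => 0)]
    simpa using hε
  add_mem' := by
    intro u v hu hv ε hε
    obtain ⟨φ, hφ, h1⟩ := hu (ε / 2) (ENNReal.half_pos hε.ne')
    obtain ⟨ψ, hψ, h2⟩ := hv (ε / 2) (ENNReal.half_pos hε.ne')
    refine ⟨fun x => φ x + ψ x, hφ.add hψ, ?_⟩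
    have h : (fun x => zext (u + v) x - (φ x + ψ x)) =ᵐ[volume]
        fun x => (zext u x - φ x) + (zext v x - ψ x) := by
      filter_upwards [zext_add u v] with x hx
      rw [hx]; ring
    rw [hNorm_congr _ h]
    refine (hNorm_add_le μ μ.2 ((zext_integrable u).sub hφ.integrable)
      ((zext_integrable v).sub hψ.integrable)).trans_lt ?_
    exact (ENNReal.add_lt_add h1 h2).trans_le (ENNReal.add_halves ε).le
  smul_mem' := by
    intro c u hu ε hε
    by_cases hc : ‖c‖ₑ = 0
    · refine ⟨fun x => c * 0, isTest_zero.const_mul c, ?_⟩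
      have h : (fun x => zext (c • u) x - c * 0) =ᵐ[volume] fun x => c * zext u x := by
        filter_upwards [zext_smul c u] with x hx
        rw [hx]; ring
      rw [hNorm_congr _ h, hNorm_smul, hc, zero_mul]
      exact hε
    · obtain ⟨φ, hφ, h1⟩ := hu (ε / ‖c‖ₑ) (ENNReal.div_pos hε.ne' enorm_ne_top)
      refine ⟨fun x => c * φ x, hφ.const_mul c, ?_⟩
      have h : (fun x => zext (c • u) x - c * φ x) =ᵐ[volume]
          fun x => c * (zext u x - φ x) := by
        filter_upwards [zext_smul c u] with x hx
        rw [hx]; ring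
      rw [hNorm_congr _ h, hNorm_smul, mul_comm]
      exact (ENNReal.lt_div_iff_mul_lt (Or.inl hc) (Or.inl enorm_ne_top)).1 h1

/-- The space `H¹_0(0,1)`. -/
abbrev H01 : Type := H0 1

/-- `f ∈ H^{-1}(0,1)`, the dual of `H¹_0(0,1)`: a linear functional on `H¹_0(0,1)` that is bounded
for the `H¹` norm (the topology that `H01` inherits from `L²(0,1)` plays no role). -/
def IsHNegOne (f : H01 →ₗ[ℝ] ℝ) : Prop :=
  ∃ C : ℝ≥0, ∀ v : H01, ‖f v‖ₑ ≤ C * hNorm 1 (zext v)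

/-- `F ∈ H¹(0,1)` with weak derivative `DF = G ∈ L²(0,1)`. -/
def HasWeakDeriv (F : ℝ → ℝ) (G : L2I) : Prop :=
  MemLp F 2 vol01 ∧ ∀ φ, IsTest φ →
    ∫ x in Ioo (0 : ℝ) 1, F x * deriv φ x = - ∫ x in Ioo (0 : ℝ) 1, G x * φ x

/-- The left fractional integral of order `σ` over `(0,x)`. -/
def leftInt (σ : ℝ) (w : ℝ → ℝ) (x : ℝ) : ℝ :=
  1 / Real.Gamma σ * ∫ s in (0 : ℝ)..x, w s / (x - s) ^ (1 - σ)

/-- The right fractional integral of order `σ` over `(x,1)`. -/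
def rightInt (σ : ℝ) (w : ℝ → ℝ) (x : ℝ) : ℝ :=
  1 / Real.Gamma σ * ∫ s in x..(1 : ℝ), w s / (s - x) ^ (1 - σ)

/-- The two-sided fractional integral `I^β_θ`. -/
def twoSidedInt (β θ : ℝ) (w : ℝ → ℝ) (x : ℝ) : ℝ :=
  θ * leftInt β w x + (1 - θ) * rightInt β w x

/-- `F ∈ H¹(0,1)` and `(K DF, Dv)_{L²(0,1)} = ⟨f, v⟩` for all `v ∈ H¹_0(0,1)`. -/
def IsWeakDiffusion (K : ℝ → ℝ) (F : ℝ → ℝ) (f : H01 →ₗ[ℝ] ℝ) : Prop :=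
  ∃ G : L2I, HasWeakDeriv F G ∧ ∀ v : H01, ∃ dv : L2I, HasWeakDeriv (v : L2I) dv ∧
    ∫ x in Ioo (0 : ℝ) 1, K x * G x * dv x = f v

/-- `u ∈ H^{1-β}_0(0,1)` is a weak solution of the Petrov-Galerkin formulation
`(K D I^β_θ u, Dv)_{L²(0,1)} = ⟨f, v⟩` for all `v ∈ H¹_0(0,1)`. -/
def IsPGSolution (K : ℝ → ℝ) (β θ : ℝ) (f : H01 →ₗ[ℝ] ℝ) (u : L2I) : Prop :=
  u ∈ H0 (1 - β).toNNReal ∧ IsWeakDiffusion K (twoSidedInt β θ u) f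

/-- `w = w_l`, the (continuous) weak solution of `-D(K Dw) = 0`, `w(0) = 1`, `w(1) = 0`. -/
def IsLeftProfile (K : ℝ → ℝ) (w : ℝ → ℝ) : Prop :=
  ContinuousOn w (Icc 0 1) ∧ w 0 = 1 ∧ w 1 = 0 ∧ IsWeakDiffusion K w 0

/-- `u = u_l`: the function in `H^{1-β}_0(0,1)` with
`I^β_θ u - (1-θ) (rightInt β u 0) (1-x) - θ (leftInt β u 1) x = w_l - (1-x)` on `[0,1]`. -/
def IsAuxiliary (K : ℝ → ℝ) (β θ : ℝ) (u : L2I) : Prop :=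
  u ∈ H0 (1 - β).toNNReal ∧ ∃ w : ℝ → ℝ, IsLeftProfile K w ∧ ∀ x ∈ Icc (0 : ℝ) 1,
    twoSidedInt β θ u x - (1 - θ) * rightInt β u 0 * (1 - x) - θ * leftInt β u 1 * x
      = w x - (1 - x)

/-- The solvability condition, for `u = u_l`. -/
def SolvCondition (β θ : ℝ) (u : L2I) : Prop :=
  1 + θ * leftInt β u 1 - (1 - θ) * rightInt β u 0 ≠ 0

end FracDiffusion

end

open FracDiffusion

/-! Let A_θ u be the derivative of I^β_θ u with its mean removed, as an operator from H^{1-β}_0(0,1)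
to the mean-zero functions in L²(0,1). The analytic core is that A_θ is bijective
(`fracDeriv_bijective`); the rest is linear algebra with one scalar unknown.

Surjectivity follows once the adjoint is bounded below, uniformly in θ
(`exists_adjoint_fracDeriv_lower_bound`, `exists_preimage_norm_le`). By density it suffices to test
the adjoint on v' with v smooth and compactly supported, where ⟨A_θ u, v'⟩ is a Fourier form with
symbol ω²(θ(iω)^{-β} + (1-θ)(-iω)^{-β}). Two choices of u are combined. The choice u = v gives a
multiple of |v|² in H^{1-β/2}, hence controls ‖v‖². To control ‖v'‖², split v = χv + (1-χ)v and
apply a truncated left fractional derivative of order β to the left piece and a truncated right one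
to the right piece. The truncation and the cutoff keep u supported in (0,1), and change the symbol
only by O(1). The principal part is then weighted by θ + (1-θ)cos πβ and 1-θ + θcos πβ, both at
least cos πβ > 0 because β < 1/2. The remaining skew term is a commutator of sgn(ξ) with the smooth
cutoff, which is of lower order (`abs_im_commutator_le`). All errors are absorbed at the price of a
multiple of ‖v‖², giving `exists_test_fracForm_lower_bound`.

Injectivity at θ = 1 is Abel inversion: A_1 u = 0 forces I^β u to be linear, so u = c x^{1-β}, which
cannot be a uniform limit of functions vanishing near 1 unless c = 0. Uniform limits are available
because 1-β > 1/2. Since A_θ is affine in θ and the right inverses are uniformly bounded,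
injectivity propagates from θ = 1 to all θ in steps of fixed length (`bijective_of_segment`).

For the conclusion, let R invert A_θ and let κ(q) be the value of I^β_θ R q at 1 minus its value at
0, so that (I^β_θ R q)' = q + κ(q). The diffusion equation for F means F' = h + c k with k = 1/K, h
determined by f, and c free (`exists_isWeakDiffusion_iff`). Mean-free parts give q = h₀ + t p with p
= 1 - k/∫k, and means give t(1 + κ(p)) = ∫h - κ(h₀). The auxiliary function is R p, so 1 + κ(p) is
exactly the number in (V). If it vanishes then p ≠ 0, and any solution can be shifted by R p. -/

noncomputable section

namespace FracDiffusion

/-! ### Smooth compactly supported functions on the line and their Fourier transforms. -/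

section TestFunctions
open Filter Topology SchwartzMap

/-- Smooth compactly supported functions on the line. -/
structure IsCS (φ : ℝ → ℝ) : Prop where
  smooth : ContDiff ℝ ∞ φ
  compact : HasCompactSupport φ

lemma IsTest.isCS {φ : ℝ → ℝ} (h : IsTest φ) : IsCS φ := ⟨h.1, h.2.1⟩

namespace IsCS
variable {φ ψ : ℝ → ℝ}

lemma continuous (h : IsCS φ) : Continuous φ := h.smooth.continuous

lemma differentiable (h : IsCS φ) : Differentiable ℝ φ := h.smooth.differentiable (by simp)

lemma deriv (h : IsCS φ) : IsCS (deriv φ) :=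
  ⟨(contDiff_infty_iff_deriv.1 h.smooth).2, h.compact.deriv⟩

lemma integrable (h : IsCS φ) : Integrable φ :=
  h.continuous.integrable_of_hasCompactSupport h.compact

lemma memLp (h : IsCS φ) (p : ℝ≥0∞) : MemLp φ p := h.continuous.memLp_of_hasCompactSupport h.compact

lemma add (h : IsCS φ) (h' : IsCS ψ) : IsCS (fun x => φ x + ψ x) :=
  ⟨h.smooth.add h'.smooth, h.compact.add h'.compact⟩

lemma const_mul (h : IsCS φ) (c : ℝ) : IsCS (fun x => c * φ x) :=
  ⟨contDiff_const.mul h.smooth, h.compact.mul_left⟩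

lemma sub (h : IsCS φ) (h' : IsCS ψ) : IsCS (fun x => φ x - ψ x) := by
  simpa [sub_eq_add_neg] using h.add (h'.const_mul (-1))

lemma mul (h : IsCS φ) (h' : IsCS ψ) : IsCS (fun x => φ x * ψ x) :=
  ⟨h.smooth.mul h'.smooth, h.compact.mul_right⟩

lemma comp_sub (h : IsCS φ) (t : ℝ) : IsCS (fun x => φ (x - t)) :=
  ⟨h.smooth.comp (contDiff_id.sub contDiff_const),
    h.compact.comp_homeomorph (Homeomorph.subRight t)⟩

/-- The complexification of a smooth compactly supported function, as a Schwartz function. -/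
def sch (h : IsCS φ) : 𝓢(ℝ, ℂ) :=
  HasCompactSupport.toSchwartzMap (f := fun x => (φ x : ℂ))
    (h.compact.comp_left Complex.ofReal_zero) (Complex.ofRealCLM.contDiff.comp h.smooth)

lemma bounded (h : IsCS φ) : ∃ C, 0 ≤ C ∧ ∀ x, |φ x| ≤ C := by
  obtain ⟨C, hC⟩ := h.continuous.bounded_above_of_compact_support h.compact
  exact ⟨max C 0, le_max_right _ _, fun x => (hC x).trans (le_max_left _ _)⟩

@[simp] lemma sch_apply (h : IsCS φ) (x : ℝ) : h.sch x = (φ x : ℂ) := rfl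

end IsCS

/-- The Fourier transform of a real function. -/
def hat (φ : ℝ → ℝ) (ξ : ℝ) : ℂ := 𝓕 (fun x : ℝ => (φ x : ℂ)) ξ

variable {φ ψ : ℝ → ℝ}

lemma hat_eq_fourier_sch (h : IsCS φ) (ξ : ℝ) : hat φ ξ = (𝓕 h.sch) ξ := by
  rw [SchwartzMap.fourier_coe]; rfl

lemma hat_eq_integral (φ : ℝ → ℝ) (ξ : ℝ) :
    hat φ ξ = ∫ x, Complex.exp (-(2 * Real.pi * ξ * x : ℝ) * Complex.I) * (φ x : ℂ) := by
  rw [hat, Real.fourier_eq']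
  refine integral_congr_ae (.of_forall fun x => ?_)
  simp only [smul_eq_mul, RCLike.inner_apply, conj_trivial]
  congr 2
  push_cast
  ring

lemma hat_congr (h : φ =ᵐ[volume] ψ) : hat φ = hat ψ := by
  ext ξ
  rw [hat_eq_integral, hat_eq_integral]
  exact integral_congr_ae (by filter_upwards [h] with x hx; rw [hx])

lemma norm_hat_le (φ : ℝ → ℝ) (ξ : ℝ) : ‖hat φ ξ‖ ≤ ∫ x, |φ x| := by
  rw [hat_eq_integral]
  refine (norm_integral_le_integral_norm _).trans (le_of_eq (integral_congr_ae (.of_forall fun x => ?_)))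
  simp only [norm_mul, Complex.norm_real, Real.norm_eq_abs]
  rw [show (-((2 * Real.pi * ξ * x : ℝ) : ℂ) * Complex.I) = ((-(2 * Real.pi * ξ * x) : ℝ) : ℂ) * Complex.I by push_cast; ring,
    Complex.norm_exp_ofReal_mul_I, one_mul]

lemma integrable_exp_mul (h : Integrable φ) (ξ : ℝ) :
    Integrable fun x => Complex.exp (-(2 * Real.pi * ξ * x : ℝ) * Complex.I) * (φ x : ℂ) := by
  refine h.ofReal.bdd_mul (c := 1) (Continuous.aestronglyMeasurable (by fun_prop)) (.of_forall fun x => ?_)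
  rw [show (-((2 * Real.pi * ξ * x : ℝ) : ℂ) * Complex.I) = ((-(2 * Real.pi * ξ * x) : ℝ) : ℂ) * Complex.I by push_cast; ring,
    Complex.norm_exp_ofReal_mul_I]

lemma hat_add (h : Integrable φ) (h' : Integrable ψ) (ξ : ℝ) :
    hat (fun x => φ x + ψ x) ξ = hat φ ξ + hat ψ ξ := by
  simp only [hat_eq_integral]
  rw [← integral_add (integrable_exp_mul h ξ) (integrable_exp_mul h' ξ)]
  refine integral_congr_ae (.of_forall fun x => ?_)
  simp only [Complex.ofReal_add]; ring

lemma hat_const_mul (c : ℝ) (φ : ℝ → ℝ) (ξ : ℝ) : hat (fun x => c * φ x) ξ = c * hat φ ξ := by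
  simp only [hat_eq_integral]
  rw [← integral_const_mul]
  refine integral_congr_ae (.of_forall fun x => ?_)
  simp only [Complex.ofReal_mul]; ring

lemma hat_sub (h : Integrable φ) (h' : Integrable ψ) (ξ : ℝ) :
    hat (fun x => φ x - ψ x) ξ = hat φ ξ - hat ψ ξ := by
  have := hat_add h (h'.const_mul (-1)) ξ
  rw [hat_const_mul] at this
  simpa [sub_eq_add_neg] using this

lemma continuous_hat (h : Integrable φ) : Continuous (hat φ) :=
  VectorFourier.fourierIntegral_continuous Real.continuous_fourierChar
    (by exact continuous_inner) h.ofReal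

lemma hat_deriv (h : IsCS φ) (ξ : ℝ) : hat (deriv φ) ξ = 2 * Real.pi * Complex.I * ξ * hat φ ξ := by
  have hd : deriv (fun x => (φ x : ℂ)) = fun x => ((deriv φ x : ℝ) : ℂ) := by
    ext x
    exact (h.differentiable x).hasDerivAt.ofReal_comp.deriv
  have := Real.fourier_deriv (f := fun x => (φ x : ℂ)) h.integrable.ofReal
    (fun x => (h.differentiable x).hasDerivAt.ofReal_comp.differentiableAt)
    (by rw [hd]; exact h.deriv.integrable.ofReal)
  rw [hd] at this
  simpa [hat] using congrFun this ξ

lemma hat_comp_sub (φ : ℝ → ℝ) (t ξ : ℝ) :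
    hat (fun x => φ (x - t)) ξ = Complex.exp (-(2 * Real.pi * ξ * t : ℝ) * Complex.I) * hat φ ξ := by
  simp only [hat_eq_integral]
  rw [← integral_sub_right_eq_self (fun x => Complex.exp (-(2 * Real.pi * ξ * x : ℝ) * Complex.I) * (φ x : ℂ)) t,
    ← integral_const_mul]
  refine integral_congr_ae (.of_forall fun x => ?_)
  dsimp only
  rw [← mul_assoc, ← Complex.exp_add]
  congr 2
  push_cast
  ring

lemma hat_decay (h : IsCS φ) (k : ℕ) : ∃ C, 0 < C ∧ ∀ ξ, |ξ| ^ k * ‖hat φ ξ‖ ≤ C := by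
  obtain ⟨C, hC, h1⟩ := (𝓕 h.sch).decay k 0
  refine ⟨C, hC, fun ξ => ?_⟩
  simpa [hat_eq_fourier_sch h] using h1 ξ

lemma hat_bounded (h : IsCS φ) : ∃ C, 0 < C ∧ ∀ ξ, ‖hat φ ξ‖ ≤ C := by
  simpa using hat_decay h 0

lemma integrableOn_abs_rpow {a : ℝ} (ha : -1 < a) :
    IntegrableOn (fun ξ : ℝ => |ξ| ^ a) (Icc (-1) 1) := by
  have h1 : IntervalIntegrable (fun ξ : ℝ => |ξ| ^ a) volume 0 1 := by
    refine (intervalIntegral.intervalIntegrable_rpow' ha).congr ?_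
    intro x hx
    rw [uIoc_of_le zero_le_one] at hx
    simp [abs_of_pos hx.1]
  have h2 : IntervalIntegrable (fun ξ : ℝ => |ξ| ^ a) volume (-1) 0 := by
    have := (h1.comp_sub_left 0).symm
    simpa using this
  have := h2.trans h1
  rwa [intervalIntegrable_iff_integrableOn_Icc_of_le (by norm_num)] at this

/-- The singularity at the origin is integrable because a > -1, and at infinity the transform decays
rapidly; the two regimes are separated at |ξ| = 1. -/
lemma integrable_rpow_mul_hat (h : IsCS φ) {a : ℝ} (ha : -1 < a) :
    Integrable fun ξ : ℝ => |ξ| ^ a * ‖hat φ ξ‖ := by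
  obtain ⟨n, hn⟩ := exists_nat_ge a
  obtain ⟨C, hC, hb⟩ := hat_bounded h
  have hi : Integrable fun ξ : ℝ => |ξ| ^ n * ‖hat φ ξ‖ := by
    have := SchwartzMap.integrable_pow_mul (volume : Measure ℝ) (𝓕 h.sch) n
    simpa [hat_eq_fourier_sch h] using this
  have hj : Integrable ((Icc (-1 : ℝ) 1).indicator fun ξ : ℝ => C * |ξ| ^ a) :=
    (integrable_indicator_iff measurableSet_Icc).2 ((integrableOn_abs_rpow ha).const_mul C)
  refine (hj.add hi).mono' ?_ (.of_forall fun ξ => ?_)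
  · have hm : Measurable fun ξ : ℝ => |ξ| ^ a := by fun_prop
    exact hm.aestronglyMeasurable.mul (continuous_hat h.integrable).norm.aestronglyMeasurable
  · have h0 : 0 ≤ |ξ| ^ a := by positivity
    rw [Real.norm_of_nonneg (by positivity), Pi.add_apply]
    by_cases hx : ξ ∈ Icc (-1 : ℝ) 1
    · rw [indicator_of_mem hx]
      have := mul_le_mul_of_nonneg_left (hb ξ) h0
      have h2 : 0 ≤ |ξ| ^ n * ‖hat φ ξ‖ := by positivity
      linarith
    · rw [indicator_of_notMem hx, zero_add]
      have h1 : 1 ≤ |ξ| := by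
        by_contra hlt
        exact hx (abs_le.1 (not_le.1 hlt).le)
      gcongr
      rw [← Real.rpow_natCast]
      exact Real.rpow_le_rpow_of_exponent_le h1 hn

lemma integrable_rpow_mul_hat_mul_hat (h : IsCS φ) (h' : IsCS ψ) {a : ℝ} (ha : -1 < a) :
    Integrable fun ξ : ℝ => |ξ| ^ a * (‖hat φ ξ‖ * ‖hat ψ ξ‖) := by
  obtain ⟨C, hC, hb⟩ := hat_bounded h'
  have := (integrable_rpow_mul_hat h ha).mul_bdd (c := C)
    (continuous_hat h'.integrable).norm.aestronglyMeasurable (.of_forall fun ξ => by simpa using hb ξ)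
  simpa [mul_assoc] using this

lemma integral_hat_mul_conj (h : IsCS φ) (h' : IsCS ψ) :
    ∫ ξ, hat φ ξ * (starRingEnd ℂ) (hat ψ ξ) = ((∫ x, φ x * ψ x : ℝ) : ℂ) := by
  have := SchwartzMap.integral_inner_fourier_fourier h'.sch h.sch
  simp only [RCLike.inner_apply, ← hat_eq_fourier_sch, IsCS.sch_apply, Complex.conj_ofReal] at this
  rw [this, ← integral_complex_ofReal]
  simp

lemma integral_norm_hat_sq (h : IsCS φ) : ∫ ξ, ‖hat φ ξ‖ ^ 2 = ∫ x, φ x ^ 2 := by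
  have := SchwartzMap.integral_norm_sq_fourier h.sch
  simpa [← hat_eq_fourier_sch] using this

end TestFunctions

/-! ### The Gamma integral at complex arguments with positive real part. -/

section GammaIntegral
open Filter Topology

lemma integrableOn_rpow_mul_exp {a r : ℝ} (ha : 0 < a) (hr : 0 < r) :
    IntegrableOn (fun t : ℝ => t ^ (a - 1) * Real.exp (-(r * t))) (Ioi 0) := by
  have := integrableOn_rpow_mul_exp_neg_mul_rpow (s := a - 1) (p := 1) (b := r) (by linarith) one_pos hr
  simpa using this

/-- The Laplace transform of a power, at complex arguments. -/
lemma integral_rpow_mul_cexp {a : ℝ} (ha : 0 < a) {z : ℂ} (hz : 0 < z.re) :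
    ∫ t in Ioi (0 : ℝ), ((t ^ (a - 1) : ℝ) : ℂ) * Complex.exp (-(z * t))
      = Real.Gamma a * z ^ (-(a : ℂ)) := by
  -- With the weight put into a measure, the integral is a complex moment generating function, whose
  -- analyticity inside the integrability strip is known. The formula for real arguments then
  -- extends by the identity theorem.
  let ν : Measure ℝ := (volume.restrict (Ioi (0 : ℝ))).withDensity
    fun t => ENNReal.ofReal (t ^ (a - 1))
  have hmeas : Measurable fun t : ℝ => ENNReal.ofReal (t ^ (a - 1)) := by fun_prop
  have htop : ∀ᵐ t ∂(volume.restrict (Ioi (0 : ℝ))), ENNReal.ofReal (t ^ (a - 1)) < ⊤ :=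
    .of_forall fun t => ENNReal.ofReal_lt_top
  have hint : ∀ w : ℂ, ProbabilityTheory.complexMGF id ν w
      = ∫ t in Ioi (0 : ℝ), ((t ^ (a - 1) : ℝ) : ℂ) * Complex.exp (w * t) := by
    intro w
    rw [ProbabilityTheory.complexMGF, integral_withDensity_eq_integral_toReal_smul hmeas htop]
    refine setIntegral_congr_fun measurableSet_Ioi fun t ht => ?_
    have h0 : 0 ≤ t ^ (a - 1) := Real.rpow_nonneg (le_of_lt ht) _
    simp only [ENNReal.toReal_ofReal h0, id, Complex.real_smul]
  have hset : Iio (0 : ℝ) ⊆ ProbabilityTheory.integrableExpSet id ν := by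
    intro s hs
    rw [ProbabilityTheory.integrableExpSet, mem_ofPred_eq,
      integrable_withDensity_iff_integrable_smul' hmeas htop]
    refine (integrableOn_rpow_mul_exp ha (neg_pos.2 hs)).congr_fun (fun t ht => ?_) measurableSet_Ioi
    have h0 : 0 ≤ t ^ (a - 1) := Real.rpow_nonneg (le_of_lt ht) _
    simp [ENNReal.toReal_ofReal h0]
  have hint2 : Iio (0 : ℝ) ⊆ interior (ProbabilityTheory.integrableExpSet id ν) :=
    interior_maximal hset isOpen_Iio
  have hopen : IsOpen {w : ℂ | 0 < w.re} := isOpen_lt continuous_const Complex.continuous_re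
  have hA : AnalyticOnNhd ℂ (fun w => ProbabilityTheory.complexMGF id ν (-w)) {w : ℂ | 0 < w.re} := by
    refine DifferentiableOn.analyticOnNhd (fun w hw => ?_) hopen
    have h1 := (ProbabilityTheory.differentiableOn_complexMGF (X := id) (μ := ν)).differentiableAt
      (x := -w) ((isOpen_interior.preimage Complex.continuous_re).mem_nhds
        (hint2 (by simpa using hw)))
    exact (h1.comp w differentiableAt_id.neg).differentiableWithinAt
  have hB : AnalyticOnNhd ℂ (fun w : ℂ => (Real.Gamma a : ℂ) * w ^ (-(a : ℂ))) {w : ℂ | 0 < w.re} := by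
    refine DifferentiableOn.analyticOnNhd (fun w hw => ?_) hopen
    have h1 : DifferentiableAt ℂ (fun w : ℂ => w ^ (-(a : ℂ))) w :=
      differentiableAt_id.cpow_const (Or.inl hw)
    exact (h1.const_mul _).differentiableWithinAt
  have hconn : IsPreconnected {w : ℂ | 0 < w.re} :=
    (convex_halfSpace_re_gt 0).isPreconnected
  have hreal : ∀ r : ℝ, 0 < r → ProbabilityTheory.complexMGF id ν (-(r : ℂ))
      = (Real.Gamma a : ℂ) * (r : ℂ) ^ (-(a : ℂ)) := by
    intro r hr
    have h1 := Real.integral_rpow_mul_exp_neg_mul_Ioi ha hr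
    rw [hint]
    have h2 : ∀ t : ℝ, ((t ^ (a - 1) : ℝ) : ℂ) * Complex.exp (-(r : ℂ) * t)
        = ((t ^ (a - 1) * Real.exp (-(r * t)) : ℝ) : ℂ) := by
      intro t; push_cast; ring_nf
    simp_rw [h2]
    rw [integral_complex_ofReal, h1]
    rw [one_div, Real.inv_rpow hr.le, ← Real.rpow_neg hr.le, Complex.ofReal_mul,
      Complex.ofReal_cpow hr.le]
    push_cast
    ring
  -- The identity theorem needs agreement at points accumulating at an interior point; real points
  -- decreasing to 1 serve.
  have hfreq : ∃ᶠ w in 𝓝[≠] (1 : ℂ), ProbabilityTheory.complexMGF id ν (-w)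
      = (Real.Gamma a : ℂ) * w ^ (-(a : ℂ)) := by
    have ht : Tendsto (fun n : ℕ => ((1 + 1 / ((n : ℝ) + 1) : ℝ) : ℂ)) atTop (𝓝[≠] (1 : ℂ)) := by
      refine tendsto_nhdsWithin_iff.2 ⟨?_, .of_forall fun n => ?_⟩
      · have := (tendsto_one_div_add_atTop_nhds_zero_nat (𝕜 := ℝ)).const_add 1
        rw [add_zero] at this
        simpa [Function.comp_def] using (Complex.continuous_ofReal.tendsto _).comp this
      · rw [mem_compl_singleton_iff, ← Complex.ofReal_one, Ne, Complex.ofReal_inj]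
        have : (0 : ℝ) < 1 / ((n : ℝ) + 1) := by positivity
        linarith
    exact ht.frequently (Frequently.of_forall fun n => hreal _ (by positivity))
  have := hA.eqOn_of_preconnected_of_frequently_eq hB hconn (z₀ := 1) (by simp) hfreq hz
  simp only [hint] at this
  rw [← this]
  simp

end GammaIntegral
-- The symbols (iω)^{∓β}, ω = 2πξ, and their damped versions (ε + iω)^{∓β}.
section Symbol
open Filter Topology ComplexConjugate

/-- The unimodular factor `e^{iπβ sgn(ξ)/2}`. -/
def phase (β ξ : ℝ) : ℂ := Complex.exp ((Real.pi * β / 2 * Real.sign ξ : ℝ) * Complex.I)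

/-- The Fourier symbol `(iω)^{-β}`, `ω = 2πξ`, of the left fractional integral. -/
def fracSymbol (β ξ : ℝ) : ℂ := ((|2 * Real.pi * ξ| ^ (-β) : ℝ) : ℂ) * conj (phase β ξ)

@[simp] lemma norm_phase (β ξ : ℝ) : ‖phase β ξ‖ = 1 := Complex.norm_exp_ofReal_mul_I _

lemma conj_phase (β ξ : ℝ) : conj (phase β ξ) = phase (-β) ξ := by
  rw [phase, phase, ← Complex.exp_conj, map_mul, Complex.conj_ofReal, Complex.conj_I]
  congr 1
  push_cast
  ring

lemma phase_mul_conj (β ξ : ℝ) : phase β ξ * conj (phase β ξ) = 1 := by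
  rw [Complex.mul_conj, Complex.normSq_eq_norm_sq]; simp

lemma measurable_sign : Measurable Real.sign := by
  unfold Real.sign
  exact Measurable.ite measurableSet_Iio measurable_const
    (Measurable.ite measurableSet_Ioi measurable_const measurable_const)

lemma measurable_phase (β : ℝ) : Measurable (phase β) := by
  unfold phase
  exact Complex.measurable_exp.comp
    ((Complex.measurable_ofReal.comp (measurable_sign.const_mul _)).mul_const _)

lemma measurable_fracSymbol (β : ℝ) : Measurable (fracSymbol β) := by
  refine (Complex.measurable_ofReal.comp (by fun_prop)).mul ?_
  exact Complex.continuous_conj.measurable.comp (measurable_phase β)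

lemma norm_fracSymbol (β ξ : ℝ) : ‖fracSymbol β ξ‖ = |2 * Real.pi * ξ| ^ (-β) := by
  rw [fracSymbol, norm_mul, RCLike.norm_conj, norm_phase, mul_one, Complex.norm_real,
    Real.norm_of_nonneg (by positivity)]

/-- On the principal branch log(±i) = ±iπ/2, which is where the sign of ξ enters the phase. -/
lemma cpow_mul_I {ξ : ℝ} (hξ : ξ ≠ 0) (a : ℝ) :
    ((2 * Real.pi * ξ : ℝ) * Complex.I) ^ (a : ℂ) = ((|2 * Real.pi * ξ| ^ a : ℝ) : ℂ) * phase a ξ := by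
  have hne : ((2 * Real.pi * ξ : ℝ) : ℂ) * Complex.I ≠ 0 := by
    simp [hξ, Real.pi_ne_zero]
  rw [Complex.cpow_def_of_ne_zero hne, phase]
  rcases lt_or_gt_of_ne hξ with h | h
  · have hpos : 0 < -(2 * Real.pi * ξ) := by nlinarith [Real.pi_pos]
    have h1 : ((2 * Real.pi * ξ : ℝ) : ℂ) * Complex.I
        = ((-(2 * Real.pi * ξ) : ℝ) : ℂ) * (-Complex.I) := by push_cast; ring
    rw [h1, Complex.log_ofReal_mul hpos (by simp), Complex.log_neg_I, abs_of_neg (by linarith),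
      Real.sign_of_neg h, Real.rpow_def_of_pos hpos, Complex.ofReal_exp, ← Complex.exp_add]
    congr 1
    push_cast
    ring
  · have hpos : 0 < 2 * Real.pi * ξ := by positivity
    rw [Complex.log_ofReal_mul hpos (by simp), Complex.log_I, abs_of_pos hpos,
      Real.sign_of_pos h, Real.rpow_def_of_pos hpos, Complex.ofReal_exp, ← Complex.exp_add]
    congr 1
    push_cast
    ring

lemma fracSymbol_eq_cpow {ξ : ℝ} (hξ : ξ ≠ 0) (β : ℝ) :
    fracSymbol β ξ = ((2 * Real.pi * ξ : ℝ) * Complex.I) ^ (-(β : ℂ)) := by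
  rw [fracSymbol, conj_phase, ← Complex.ofReal_neg, cpow_mul_I hξ]

/-- A nonzero imaginary number stays away from the branch cut, so the power is continuous there. -/
lemma tendsto_damped_cpow {ξ : ℝ} (hξ : ξ ≠ 0) (a : ℂ) :
    Tendsto (fun ε : ℝ => ((ε : ℂ) + (2 * Real.pi * ξ : ℝ) * Complex.I) ^ a) (𝓝 0)
      (𝓝 (((2 * Real.pi * ξ : ℝ) * Complex.I) ^ a)) := by
  have hslit : ((2 * Real.pi * ξ : ℝ) : ℂ) * Complex.I ∈ Complex.slitPlane := by
    refine Or.inr ?_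
    simp [hξ, Real.pi_ne_zero]
  have h1 : Tendsto (fun ε : ℝ => (ε : ℂ) + (2 * Real.pi * ξ : ℝ) * Complex.I) (𝓝 0)
      (𝓝 ((2 * Real.pi * ξ : ℝ) * Complex.I)) := by
    have : Continuous fun ε : ℝ => (ε : ℂ) + (2 * Real.pi * ξ : ℝ) * Complex.I := by fun_prop
    simpa using this.tendsto 0
  exact (continuousAt_cpow_const hslit).tendsto.comp h1

/-- The modulus of a complex number is at least that of its imaginary part, and the exponent is
negative. The bound does not depend on ε, so it serves as a dominating function for ε → 0. -/
lemma norm_damped_cpow_le {ξ β : ℝ} (hξ : ξ ≠ 0) (ε : ℝ) (hβ : 0 < β) :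
    ‖((ε : ℂ) + (2 * Real.pi * ξ : ℝ) * Complex.I) ^ (-(β : ℂ))‖ ≤ |2 * Real.pi * ξ| ^ (-β) := by
  have hne : (2 * Real.pi * ξ) ≠ 0 := by simp [hξ, Real.pi_ne_zero]
  have him : ((ε : ℂ) + (2 * Real.pi * ξ : ℝ) * Complex.I).im = 2 * Real.pi * ξ := by simp
  have hz : ((ε : ℂ) + (2 * Real.pi * ξ : ℝ) * Complex.I) ≠ 0 := by
    intro h0
    rw [h0] at him
    exact hne (by simpa using him.symm)
  rw [← Complex.ofReal_neg, Complex.norm_cpow_of_ne_zero hz]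
  simp only [Complex.ofReal_re, Complex.ofReal_im, mul_zero, Real.exp_zero, div_one]
  refine Real.rpow_le_rpow_of_nonpos (abs_pos.2 hne) ?_ (by linarith)
  calc |2 * Real.pi * ξ| = |((ε : ℂ) + (2 * Real.pi * ξ : ℝ) * Complex.I).im| := by rw [him]
    _ ≤ _ := Complex.abs_im_le_norm _

end Symbol

/-! ### Fourier representation of the pairing with a left fractional integral. -/

section Pairing
open Filter Topology ComplexConjugate

/-- The correlation `t ↦ ∫ f(x - t) g(x) dx`. -/
def corr (f g : ℝ → ℝ) (t : ℝ) : ℝ := ∫ x, f (x - t) * g x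

variable {f g : ℝ → ℝ}

/-- This is Parseval, with translation turned into modulation. -/
lemma corr_eq_fourier (hf : IsCS f) (hg : IsCS g) (t : ℝ) :
    (corr f g t : ℂ) = ∫ ξ, Complex.exp (-(2 * Real.pi * ξ * t : ℝ) * Complex.I)
      * (hat f ξ * conj (hat g ξ)) := by
  rw [corr, ← integral_hat_mul_conj (hf.comp_sub t) hg]
  simp only [hat_comp_sub, mul_assoc]

lemma corr_bounded (hf : IsCS f) (hg : IsCS g) : ∃ C, 0 ≤ C ∧ ∀ t, |corr f g t| ≤ C := by
  obtain ⟨C, hC, h⟩ := hf.bounded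
  refine ⟨C * ∫ x, |g x|, by positivity, fun t => ?_⟩
  rw [← Real.norm_eq_abs, ← integral_const_mul]
  refine norm_integral_le_of_norm_le (hg.integrable.abs.const_mul C) (.of_forall fun x => ?_)
  rw [norm_mul]
  exact mul_le_mul_of_nonneg_right (h _) (norm_nonneg _)

lemma IsCS.exists_support_bound (hf : IsCS f) : ∃ R, 0 < R ∧ ∀ x, R < |x| → f x = 0 := by
  obtain ⟨R, hR⟩ := hf.compact.isCompact.isBounded.subset_closedBall 0
  refine ⟨max R 1, by positivity, fun x hx => ?_⟩
  by_contra h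
  have := hR (subset_tsupport f h)
  rw [mem_closedBall_zero_iff, Real.norm_eq_abs] at this
  exact absurd (this.trans (le_max_left R 1)) (not_le.2 hx)

lemma corr_support (hf : IsCS f) (hg : IsCS g) : ∃ T, 0 < T ∧ ∀ t, T < |t| → corr f g t = 0 := by
  obtain ⟨R, hR, h⟩ := hf.exists_support_bound
  obtain ⟨S, hS, h'⟩ := hg.exists_support_bound
  refine ⟨R + S, by positivity, fun t ht => ?_⟩
  rw [corr, integral_eq_zero_of_ae]
  refine .of_forall fun x => ?_
  by_cases hx : S < |x|
  · simp [h' x hx]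
  · have : R < |x - t| := by
      have := abs_sub_abs_le_abs_sub t x
      rw [abs_sub_comm] at this
      linarith
    simp [h _ this]

lemma continuous_corr (hf : IsCS f) (hg : IsCS g) : Continuous (corr f g) := by
  obtain ⟨C, hC, h⟩ := hf.bounded
  refine continuous_of_dominated (bound := fun x => C * |g x|) (fun t => ?_) (fun t => ?_)
    (hg.integrable.abs.const_mul C) (.of_forall fun x => ?_)
  · exact ((hf.comp_sub t).continuous.mul hg.continuous).aestronglyMeasurable
  · refine .of_forall fun x => ?_
    rw [norm_mul]
    exact mul_le_mul_of_nonneg_right (h _) (norm_nonneg _)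
  · have := hf.continuous
    fun_prop

lemma integrableOn_rpow_mul_of_bounded {a : ℝ} (ha : -1 < a) {h : ℝ → ℝ} (hc : Continuous h) {T C : ℝ}
    (hb : ∀ t, |h t| ≤ C) (hs : ∀ t, T < |t| → h t = 0) :
    IntegrableOn (fun t : ℝ => t ^ a * h t) (Ioi 0) := by
  have h1 : IntegrableOn (fun t : ℝ => t ^ a * h t) (Ioc 0 (max T 1)) := by
    have h2 : IntegrableOn (fun t : ℝ => t ^ a) (Ioc 0 (max T 1)) :=
      (intervalIntegrable_iff_integrableOn_Ioc_of_le (by positivity)).1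
        (intervalIntegral.intervalIntegrable_rpow' ha)
    exact h2.mul_bdd (c := C) hc.aestronglyMeasurable (.of_forall fun t => hb t)
  refine h1.of_forall_sdiff_eq_zero measurableSet_Ioi ?_
  intro t ht
  have h3 : T < |t| := by
    rw [abs_of_pos ht.1]
    by_contra hlt
    exact ht.2 ⟨ht.1, (not_lt.1 hlt).trans (le_max_left _ _)⟩
  simp [hs t h3]

/-- The pairing of the (unnormalised) left fractional integral of `f` with `g`, on the Fourier
side. -/
lemma integral_rpow_mul_corr {β : ℝ} (hβ : 0 < β) (hβ1 : β < 1) (hf : IsCS f) (hg : IsCS g) :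
    ((∫ t in Ioi (0 : ℝ), t ^ (β - 1) * corr f g t : ℝ) : ℂ)
      = Real.Gamma β * ∫ ξ, fracSymbol β ξ * (hat f ξ * conj (hat g ξ)) := by
  obtain ⟨C, hC, hCb⟩ := corr_bounded hf hg
  obtain ⟨T, hT, hTs⟩ := corr_support hf hg
  set H : ℝ → ℂ := fun ξ => hat f ξ * conj (hat g ξ) with hH
  have hHc : Continuous H :=
    (continuous_hat hf.integrable).mul (Complex.continuous_conj.comp (continuous_hat hg.integrable))
  have hHw : ∀ {a : ℝ}, -1 < a → Integrable fun ξ : ℝ => |ξ| ^ a * ‖H ξ‖ := by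
    intro a ha
    have := integrable_rpow_mul_hat_mul_hat hf hg ha
    simpa [hH] using this
  have hHi : Integrable H := by
    rw [← integrable_norm_iff hHc.aestronglyMeasurable]
    simpa using hHw (a := 0) (by norm_num)
  have hint := integrableOn_rpow_mul_of_bounded (a := β - 1) (by linarith) (continuous_corr hf hg) hCb hTs
  -- Without damping the double integral in t and ξ does not converge absolutely, because t^(β-1) is
  -- not integrable at infinity. The factor e^{-εt} permits Fubini, and ε → 0 is taken by dominated
  -- convergence on both sides.
  let ε : ℕ → ℝ := fun n => 1 / ((n : ℝ) + 1)
  have hεpos : ∀ n, 0 < ε n := fun n => by positivity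
  have hε0 : Tendsto ε atTop (𝓝 0) := tendsto_one_div_add_atTop_nhds_zero_nat
  have key : ∀ n, ∫ t in Ioi (0 : ℝ), ((t ^ (β - 1) * Real.exp (-(ε n * t)) * corr f g t : ℝ) : ℂ)
      = Real.Gamma β * ∫ ξ, ((ε n : ℂ) + (2 * Real.pi * ξ : ℝ) * Complex.I) ^ (-(β : ℂ)) * H ξ := by
    intro n
    have hprod : Integrable (Function.uncurry fun (t ξ : ℝ) =>
        ((t ^ (β - 1) : ℝ) : ℂ) * Complex.exp (-(((ε n : ℂ) + (2 * Real.pi * ξ : ℝ) * Complex.I) * t)) * H ξ)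
        ((volume.restrict (Ioi (0 : ℝ))).prod volume) := by
      have h1 := ((integrableOn_rpow_mul_exp hβ (hεpos n)).ofReal (𝕜 := ℂ)).mul_prod hHi
      have hm : Measurable fun p : ℝ × ℝ => Complex.exp (-((2 * Real.pi * p.2 * p.1 : ℝ)) * Complex.I) := by
        fun_prop
      have h2 := h1.bdd_mul (c := 1) hm.aestronglyMeasurable (.of_forall fun p => ?_)
      · refine h2.congr (.of_forall fun p => ?_)
        simp only [Function.uncurry, RCLike.ofReal_mul, Complex.coe_algebraMap, Complex.ofReal_exp]
        rw [show -(((ε n : ℂ) + (2 * Real.pi * p.2 : ℝ) * Complex.I) * p.1)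
          = (-((2 * Real.pi * p.2 * p.1 : ℝ)) * Complex.I) + ((-(ε n * p.1) : ℝ) : ℂ) by push_cast; ring,
          Complex.exp_add]
        push_cast
        ring
      · rw [show (-((2 * Real.pi * p.2 * p.1 : ℝ) : ℂ) * Complex.I)
          = ((-(2 * Real.pi * p.2 * p.1) : ℝ) : ℂ) * Complex.I by push_cast; ring,
          Complex.norm_exp_ofReal_mul_I]
    have h1 : ∀ t : ℝ, ((t ^ (β - 1) * Real.exp (-(ε n * t)) * corr f g t : ℝ) : ℂ)
        = ∫ ξ, ((t ^ (β - 1) : ℝ) : ℂ) * Complex.exp (-(((ε n : ℂ) + (2 * Real.pi * ξ : ℝ) * Complex.I) * t)) * H ξ := by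
      intro t
      rw [Complex.ofReal_mul, corr_eq_fourier hf hg, ← integral_const_mul]
      refine integral_congr_ae (.of_forall fun ξ => ?_)
      dsimp only
      rw [show -(((ε n : ℂ) + (2 * Real.pi * ξ : ℝ) * Complex.I) * t)
          = (-((2 * Real.pi * ξ * t : ℝ)) * Complex.I) + ((-(ε n * t) : ℝ) : ℂ) by push_cast; ring,
          Complex.exp_add]
      push_cast
      ring
    simp_rw [h1]
    rw [integral_integral_swap hprod, ← integral_const_mul]
    refine integral_congr_ae (.of_forall fun ξ => ?_)
    dsimp only
    -- The inner integral in t is the Gamma integral at z = ε + 2πiξ, whose real part is positive.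
    rw [integral_mul_const, integral_rpow_mul_cexp hβ (by simpa using hεpos n)]
    ring
  have hlim1 : Tendsto (fun n => ∫ t in Ioi (0 : ℝ), ((t ^ (β - 1) * Real.exp (-(ε n * t)) * corr f g t : ℝ) : ℂ))
      atTop (𝓝 (∫ t in Ioi (0 : ℝ), ((t ^ (β - 1) * corr f g t : ℝ) : ℂ))) := by
    refine tendsto_integral_of_dominated_convergence (fun t => |t ^ (β - 1) * corr f g t|) (fun n => ?_) hint.abs
      (fun n => ?_) ?_
    · have hm : Measurable fun t : ℝ => t ^ (β - 1) * Real.exp (-(ε n * t)) * corr f g t :=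
        (by fun_prop : Measurable fun t : ℝ => t ^ (β - 1) * Real.exp (-(ε n * t))).mul
          (continuous_corr hf hg).measurable
      exact (Complex.measurable_ofReal.comp hm).aestronglyMeasurable
    · refine (ae_restrict_iff' measurableSet_Ioi).2 (.of_forall fun t ht => ?_)
      rw [Complex.norm_real, Real.norm_eq_abs, mul_right_comm, abs_mul _ (Real.exp _)]
      refine mul_le_of_le_one_right (abs_nonneg _) ?_
      rw [abs_of_pos (Real.exp_pos _), Real.exp_le_one_iff]
      have := mul_pos (hεpos n) ht
      linarith
    · refine (ae_restrict_iff' measurableSet_Ioi).2 (.of_forall fun t ht => ?_)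
      refine (Complex.continuous_ofReal.tendsto _).comp ?_
      have h2 : Tendsto (fun n => Real.exp (-(ε n * t))) atTop (𝓝 1) := by
        have := ((hε0.mul_const t).neg)
        rw [zero_mul, neg_zero] at this
        simpa [Function.comp_def] using (Real.continuous_exp.tendsto 0).comp this
      simpa using (h2.const_mul (t ^ (β - 1))).mul_const (corr f g t)
  have hae : ∀ᵐ ξ : ℝ, ξ ≠ 0 := by simp [ae_iff]
  have hlim2 : Tendsto (fun n => ∫ ξ, ((ε n : ℂ) + (2 * Real.pi * ξ : ℝ) * Complex.I) ^ (-(β : ℂ)) * H ξ)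
      atTop (𝓝 (∫ ξ, fracSymbol β ξ * H ξ)) := by
    refine tendsto_integral_of_dominated_convergence
      (fun ξ => |2 * Real.pi| ^ (-β) * (|ξ| ^ (-β) * ‖H ξ‖)) (fun n => ?_) ((hHw (by linarith)).const_mul _)
      (fun n => ?_) ?_
    · have hm : Measurable fun ξ : ℝ => ((ε n : ℂ) + (2 * Real.pi * ξ : ℝ) * Complex.I) ^ (-(β : ℂ)) := by
        fun_prop
      exact (hm.mul hHc.measurable).aestronglyMeasurable
    · filter_upwards [hae] with ξ hξ
      rw [norm_mul, ← mul_assoc, ← Real.mul_rpow (abs_nonneg _) (abs_nonneg _), ← abs_mul]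
      exact mul_le_mul_of_nonneg_right (norm_damped_cpow_le hξ (ε n) hβ) (norm_nonneg _)
    · filter_upwards [hae] with ξ hξ
      rw [fracSymbol_eq_cpow hξ]
      exact ((tendsto_damped_cpow hξ _).comp hε0).mul_const _
  have := tendsto_nhds_unique hlim1 ((hlim2.const_mul (Real.Gamma β : ℂ)).congr fun n => (key n).symm)
  rw [← this, ← integral_complex_ofReal]

end Pairing

/-! ### The truncated fractional kernel and its symbol, up to a bounded error. -/

section TruncatedKernel
open Filter Topology ComplexConjugate

/-- The kernel of the left fractional integral of order `1 - β`, truncated at `h`. -/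
def truncKernel (β h t : ℝ) : ℝ := (Ioc 0 h).indicator (fun t => t ^ (-β) / Real.Gamma (1 - β)) t

variable {β h : ℝ}

lemma integrable_truncKernel (hβ1 : β < 1) (hh : 0 < h) : Integrable (truncKernel β h) := by
  refine (integrable_indicator_iff measurableSet_Ioc).2 (Integrable.div_const ?_ _)
  exact (intervalIntegrable_iff_integrableOn_Ioc_of_le hh.le).1
    (intervalIntegral.intervalIntegrable_rpow' (by linarith))

lemma norm_cexp_neg_mul_le {z : ℂ} (hz : 0 ≤ z.re) {t : ℝ} (ht : 0 ≤ t) :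
    ‖Complex.exp (-(z * t))‖ ≤ 1 := by
  rw [Complex.norm_exp, Real.exp_le_one_iff]
  simp only [Complex.neg_re, Complex.mul_re, Complex.ofReal_re, Complex.ofReal_im, mul_zero, sub_zero]
  nlinarith

/-- Integrating by parts turns z e^{-zt} into a boundary term and an integral of t^{-β-1}, which
converges on (h, ∞). Hence the bound is uniform in z in spite of the factor z. -/
lemma norm_mul_tail_le (hβ : 0 < β) (hβ1 : β < 1) (hh : 0 < h) {z : ℂ} (hz : 0 < z.re) :
    ‖z * ∫ t in Ioi h, ((t ^ (-β) : ℝ) : ℂ) * Complex.exp (-(z * t))‖ ≤ 2 * h ^ (-β) := by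
  have hsub : Ioi h ⊆ Ioi (0 : ℝ) := Ioi_subset_Ioi hh.le
  have hexp : ∀ t : ℝ, 0 < t → ‖Complex.exp (-(z * t))‖ ≤ 1 := fun t ht =>
    norm_cexp_neg_mul_le hz.le ht.le
  have hcont : Continuous fun t : ℝ => Complex.exp (-(z * t)) := by fun_prop
  have hi2 : IntegrableOn (fun t : ℝ => ((t ^ (-β - 1) : ℝ) : ℂ) * Complex.exp (-(z * t))) (Ioi h) := by
    have h1 : IntegrableOn (fun t : ℝ => ((t ^ (-β - 1) : ℝ) : ℂ)) (Ioi h) :=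
      (integrableOn_Ioi_rpow_of_lt (by linarith) hh).ofReal
    refine h1.mul_bdd (c := 1) hcont.aestronglyMeasurable ?_
    exact (ae_restrict_iff' measurableSet_Ioi).2 (.of_forall fun t ht => hexp t (hsub ht))
  have hi1 : IntegrableOn (fun t : ℝ => ((t ^ (-β) : ℝ) : ℂ) * Complex.exp (-(z * t))) (Ioi h) := by
    have h1 := (integrableOn_rpow_mul_exp (a := 1 - β) (by linarith) hz).mono_set hsub
    refine Integrable.mono' h1 ?_ ?_
    · have hm : Measurable fun t : ℝ => ((t ^ (-β) : ℝ) : ℂ) := Complex.measurable_ofReal.comp (by fun_prop)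
      exact (hm.mul hcont.measurable).aestronglyMeasurable
    · refine (ae_restrict_iff' measurableSet_Ioi).2 (.of_forall fun t ht => ?_)
      rw [norm_mul, Complex.norm_real, Real.norm_of_nonneg (Real.rpow_nonneg (hsub ht).le _), Complex.norm_exp]
      simp
  have hd : ∀ t ∈ Ioi h, HasDerivAt (fun t : ℝ => ((t ^ (-β) : ℝ) : ℂ) * Complex.exp (-(z * t)))
      (-β * (((t ^ (-β - 1) : ℝ) : ℂ) * Complex.exp (-(z * t)))
        - z * (((t ^ (-β) : ℝ) : ℂ) * Complex.exp (-(z * t)))) t := by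
    intro t ht
    have h1 : HasDerivAt (fun t : ℝ => ((t ^ (-β) : ℝ) : ℂ)) ((-β * t ^ (-β - 1) : ℝ) : ℂ) t :=
      (Real.hasDerivAt_rpow_const (Or.inl (hsub ht).ne')).ofReal_comp
    have h2 : HasDerivAt (fun t : ℝ => Complex.exp (-(z * t))) (Complex.exp (-(z * t)) * (-(z * 1))) t :=
      (((hasDerivAt_id t).ofReal_comp.const_mul z).neg).cexp
    convert! h1.mul h2 using 1
    push_cast
    ring
  have hcont0 : ContinuousWithinAt (fun t : ℝ => ((t ^ (-β) : ℝ) : ℂ) * Complex.exp (-(z * t))) (Ici h) h := by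
    have h1 : ContinuousAt (fun t : ℝ => ((t ^ (-β) : ℝ) : ℂ)) h :=
      (Complex.continuous_ofReal.continuousAt).comp (Real.continuousAt_rpow_const _ _ (Or.inl hh.ne'))
    exact (h1.mul hcont.continuousAt).continuousWithinAt
  have hlim : Tendsto (fun t : ℝ => ((t ^ (-β) : ℝ) : ℂ) * Complex.exp (-(z * t))) atTop (𝓝 0) := by
    refine squeeze_zero_norm' ?_ (tendsto_rpow_neg_atTop hβ)
    filter_upwards [eventually_gt_atTop 0] with t ht
    rw [norm_mul, Complex.norm_real, Real.norm_of_nonneg (Real.rpow_nonneg ht.le _)]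
    exact mul_le_of_le_one_right (Real.rpow_nonneg ht.le _) (hexp t ht)
  -- The derivative of t^{-β} e^{-zt} is integrated over (h, ∞); its second term is the quantity to
  -- be estimated.
  have hFTC := integral_Ioi_of_hasDerivAt_of_tendsto hcont0 hd ((hi2.const_mul _).sub (hi1.const_mul _)) hlim
  rw [integral_sub (hi2.const_mul _) (hi1.const_mul _), integral_const_mul, integral_const_mul] at hFTC
  have heq : z * ∫ t in Ioi h, ((t ^ (-β) : ℝ) : ℂ) * Complex.exp (-(z * t))
      = ((h ^ (-β) : ℝ) : ℂ) * Complex.exp (-(z * h))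
        - β * ∫ t in Ioi h, ((t ^ (-β - 1) : ℝ) : ℂ) * Complex.exp (-(z * t)) := by
    linear_combination -hFTC
  have hb : ‖∫ t in Ioi h, ((t ^ (-β - 1) : ℝ) : ℂ) * Complex.exp (-(z * t))‖ ≤ h ^ (-β) / β := by
    have h1 : ∫ t in Ioi h, t ^ (-β - 1) = h ^ (-β) / β := by
      rw [integral_Ioi_rpow_of_lt (by linarith) hh, sub_add_cancel, neg_div_neg_eq]
    rw [← h1]
    refine norm_integral_le_of_norm_le (integrableOn_Ioi_rpow_of_lt (by linarith) hh) ?_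
    refine (ae_restrict_iff' measurableSet_Ioi).2 (.of_forall fun t ht => ?_)
    have h0 := Real.rpow_nonneg (le_of_lt (hsub ht)) (-β - 1)
    rw [norm_mul, Complex.norm_real, Real.norm_of_nonneg h0]
    exact mul_le_of_le_one_right h0 (hexp t (hsub ht))
  rw [heq]
  have h0 := Real.rpow_nonneg hh.le (-β)
  calc _ ≤ ‖((h ^ (-β) : ℝ) : ℂ) * Complex.exp (-(z * h))‖
        + ‖(β : ℂ) * ∫ t in Ioi h, ((t ^ (-β - 1) : ℝ) : ℂ) * Complex.exp (-(z * t))‖ := norm_sub_le _ _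
    _ ≤ h ^ (-β) * 1 + β * (h ^ (-β) / β) := by
        rw [norm_mul, norm_mul, Complex.norm_real, Complex.norm_real, Real.norm_of_nonneg h0,
          Real.norm_of_nonneg hβ.le]
        gcongr
        exact hexp h hh
    _ = 2 * h ^ (-β) := by field_simp; ring

/-- The integral over all of (0, ∞) is Γ(1-β) z^{β-1}, so the difference is exactly z times the
tail. -/
lemma norm_mul_truncated_sub_le (hβ : 0 < β) (hβ1 : β < 1) (hh : 0 < h) {z : ℂ} (hz : 0 < z.re) :
    ‖z * (∫ t in Ioc 0 h, ((t ^ (-β) : ℝ) : ℂ) * Complex.exp (-(z * t)))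
      - Real.Gamma (1 - β) * z ^ (β : ℂ)‖ ≤ 2 * h ^ (-β) := by
  have h1 := integral_rpow_mul_cexp (a := 1 - β) (by linarith) hz
  simp only [sub_sub_cancel_left] at h1
  have hcont : Continuous fun t : ℝ => Complex.exp (-(z * t)) := by fun_prop
  have hi : IntegrableOn (fun t : ℝ => ((t ^ (-β) : ℝ) : ℂ) * Complex.exp (-(z * t))) (Ioi 0) := by
    have h1 := (integrableOn_rpow_mul_exp (a := 1 - β) (by linarith) hz)
    refine Integrable.mono' h1 ?_ ?_
    · have hm : Measurable fun t : ℝ => ((t ^ (-β) : ℝ) : ℂ) := Complex.measurable_ofReal.comp (by fun_prop)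
      exact (hm.mul hcont.measurable).aestronglyMeasurable
    · refine (ae_restrict_iff' measurableSet_Ioi).2 (.of_forall fun t ht => ?_)
      rw [norm_mul, Complex.norm_real, Real.norm_of_nonneg (Real.rpow_nonneg (le_of_lt ht) _), Complex.norm_exp]
      simp
  have hz0 : z ≠ 0 := by rintro rfl; simp at hz
  rw [← Ioc_union_Ioi_eq_Ioi hh.le, setIntegral_union (Ioc_disjoint_Ioi le_rfl) measurableSet_Ioi
    (hi.mono_set Ioc_subset_Ioi_self) (hi.mono_set (Ioi_subset_Ioi hh.le))] at h1
  have h2 : z * z ^ (-((1 - β : ℝ) : ℂ)) = z ^ (β : ℂ) := by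
    nth_rewrite 1 [← Complex.cpow_one z]
    rw [← Complex.cpow_add _ _ hz0]
    congr 1
    push_cast
    ring
  have h3 : z * (∫ t in Ioc 0 h, ((t ^ (-β) : ℝ) : ℂ) * Complex.exp (-(z * t)))
      - Real.Gamma (1 - β) * z ^ (β : ℂ)
      = -(z * ∫ t in Ioi h, ((t ^ (-β) : ℝ) : ℂ) * Complex.exp (-(z * t))) := by
    rw [← h2]
    linear_combination z * h1
  rw [h3, norm_neg]
  exact norm_mul_tail_le hβ hβ1 hh hz

lemma hat_truncKernel (ξ : ℝ) :
    hat (truncKernel β h) ξ = (Real.Gamma (1 - β) : ℂ)⁻¹ * ∫ t in Ioc 0 h, ((t ^ (-β) : ℝ) : ℂ)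
      * Complex.exp (-(((2 * Real.pi * ξ : ℝ) * Complex.I) * t)) := by
  rw [hat_eq_integral, ← integral_const_mul, ← integral_indicator measurableSet_Ioc]
  refine integral_congr_ae (.of_forall fun t => ?_)
  dsimp only
  rw [truncKernel]
  by_cases ht : t ∈ Ioc 0 h
  · rw [indicator_of_mem ht, indicator_of_mem ht]
    push_cast
    rw [show -(2 * (Real.pi : ℂ) * ξ * t) * Complex.I = -(2 * Real.pi * ξ * Complex.I * t) by ring]
    ring
  · simp [indicator_of_notMem ht]

/-- Differentiating and then convolving with the truncated kernel has symbol (iω)^β + O(1), with a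
bound uniform in ξ. It is the limit Re z → 0+ of the preceding estimate, which is only available for
Re z > 0. -/
lemma norm_hat_truncKernel_sub_le (hβ : 0 < β) (hβ1 : β < 1) (hh : 0 < h) {ξ : ℝ} (hξ : ξ ≠ 0) :
    ‖2 * Real.pi * Complex.I * ξ * hat (truncKernel β h) ξ
      - ((|2 * Real.pi * ξ| ^ β : ℝ) : ℂ) * phase β ξ‖ ≤ 2 * h ^ (-β) / Real.Gamma (1 - β) := by
  have hG : 0 < Real.Gamma (1 - β) := Real.Gamma_pos_of_pos (by linarith)
  let z : ℝ → ℂ := fun ε => (ε : ℂ) + (2 * Real.pi * ξ : ℝ) * Complex.I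
  have hzc : Continuous z := by fun_prop
  have hI : Tendsto (fun ε : ℝ => ∫ t in Ioc 0 h, ((t ^ (-β) : ℝ) : ℂ) * Complex.exp (-(z ε * t)))
      (𝓝[>] 0) (𝓝 (∫ t in Ioc 0 h, ((t ^ (-β) : ℝ) : ℂ) * Complex.exp (-(z 0 * t)))) := by
    have hint : IntegrableOn (fun t : ℝ => t ^ (-β)) (Ioc 0 h) :=
      (intervalIntegrable_iff_integrableOn_Ioc_of_le hh.le).1
        (intervalIntegral.intervalIntegrable_rpow' (by linarith))
    refine tendsto_integral_filter_of_dominated_convergence (fun t => t ^ (-β)) (.of_forall fun ε => ?_)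
      ?_ hint (.of_forall fun t => ?_)
    · have hm : Measurable fun t : ℝ => ((t ^ (-β) : ℝ) : ℂ) := Complex.measurable_ofReal.comp (by fun_prop)
      exact (hm.mul (by fun_prop)).aestronglyMeasurable
    · filter_upwards [self_mem_nhdsWithin] with ε hε
      refine (ae_restrict_iff' measurableSet_Ioc).2 (.of_forall fun t ht => ?_)
      have h0 := Real.rpow_nonneg ht.1.le (-β)
      rw [norm_mul, Complex.norm_real, Real.norm_of_nonneg h0]
      refine mul_le_of_le_one_right h0 (norm_cexp_neg_mul_le ?_ ht.1.le)
      simpa [z] using le_of_lt hε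
    · have : Continuous fun ε : ℝ => ((t ^ (-β) : ℝ) : ℂ) * Complex.exp (-(z ε * t)) := by fun_prop
      exact (this.tendsto 0).mono_left nhdsWithin_le_nhds
  have hL := (((hzc.tendsto 0).mono_left nhdsWithin_le_nhds).mul hI).sub
    (((tendsto_damped_cpow hξ (β : ℂ)).mono_left (nhdsWithin_le_nhds (s := Ioi 0))).const_mul
      (Real.Gamma (1 - β) : ℂ))
  have hle := le_of_tendsto hL.norm (b := 2 * h ^ (-β)) (by
    filter_upwards [self_mem_nhdsWithin] with ε hε
    exact norm_mul_truncated_sub_le hβ hβ1 hh (z := z ε) (by simpa [z] using hε))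
  have hz0 : z 0 = (2 * Real.pi * ξ : ℝ) * Complex.I := by simp [z]
  rw [hz0, cpow_mul_I hξ] at hle
  rw [le_div_iff₀ hG, hat_truncKernel]
  have hGc : (Real.Gamma (1 - β) : ℂ) ≠ 0 := by exact_mod_cast hG.ne'
  have hn : Real.Gamma (1 - β) = ‖(Real.Gamma (1 - β) : ℂ)‖ := by
    rw [Complex.norm_real, Real.norm_of_nonneg hG.le]
  nth_rewrite 2 [hn]
  rw [← norm_mul]
  refine (le_of_eq (congrArg norm ?_)).trans hle
  rw [sub_mul]
  field_simp
  push_cast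
  ring

end TruncatedKernel

/-! ### Convolutions, reflections and products under the Fourier transform. -/

section Convolution
open Filter Topology ComplexConjugate
open scoped Convolution

variable {κ f χ v : ℝ → ℝ}

/-- Convolution of real functions on the line. -/
def conv (κ f : ℝ → ℝ) (x : ℝ) : ℝ := ∫ t, κ t * f (x - t)

lemma conv_eq_convolution (κ f : ℝ → ℝ) : conv κ f = κ ⋆[ContinuousLinearMap.mul ℝ ℝ] f := rfl

lemma IsCS.conv (hκ : Integrable κ) (hκc : HasCompactSupport κ) (hf : IsCS f) : IsCS (conv κ f) := by
  rw [conv_eq_convolution]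
  exact ⟨hf.compact.contDiff_convolution_right _ hκ.locallyIntegrable hf.smooth,
    hκc.convolution _ hf.compact⟩

lemma hat_conv (hκ : Integrable κ) (hf : Integrable f) (ξ : ℝ) :
    hat (conv κ f) ξ = hat κ ξ * hat f ξ := by
  have := Real.fourier_mul_convolution_eq hκ.ofReal (hf.ofReal (𝕜 := ℂ)) ξ
  refine Eq.trans (congrArg (fun F : ℝ → ℂ => 𝓕 F ξ) (funext fun x => ?_)) this
  rw [FracDiffusion.conv, convolution]
  simp only [ContinuousLinearMap.mul_apply', RCLike.ofReal_eq_complex_ofReal]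
  rw [← integral_complex_ofReal]
  simp

lemma conv_eq_zero {a b a' b' : ℝ} (hκ : ∀ t, t ∉ Icc a b → κ t = 0) (hf : ∀ t, t ∉ Icc a' b' → f t = 0)
    {x : ℝ} (hx : x ∉ Icc (a + a') (b + b')) : conv κ f x = 0 := by
  refine integral_eq_zero_of_ae (.of_forall fun t => ?_)
  by_cases ht : t ∈ Icc a b
  · have : x - t ∉ Icc a' b' := fun h => hx ⟨by linarith [ht.1, h.1], by linarith [ht.2, h.2]⟩
    simp [hf _ this]
  · simp [hκ t ht]

lemma hat_neg_arg (κ : ℝ → ℝ) (ξ : ℝ) : hat κ (-ξ) = conj (hat κ ξ) := by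
  rw [hat_eq_integral, hat_eq_integral, ← integral_conj]
  refine integral_congr_ae (.of_forall fun t => ?_)
  simp only [map_mul, Complex.conj_ofReal, ← Complex.exp_conj, map_neg, Complex.conj_I]
  congr 2
  push_cast
  ring

lemma hat_comp_neg (κ : ℝ → ℝ) (ξ : ℝ) : hat (fun t => κ (-t)) ξ = conj (hat κ ξ) := by
  rw [← hat_neg_arg, hat_eq_integral, hat_eq_integral,
    ← integral_neg_eq_self (fun t => Complex.exp (-((2 * Real.pi * -ξ * t : ℝ) : ℂ) * Complex.I) * (κ t : ℂ))]
  refine integral_congr_ae (.of_forall fun t => ?_)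
  dsimp only
  congr 2
  push_cast
  ring

/-- The convolution theorem is applied to the inverse transforms of the two factors; inverse
transforms are reflected transforms, and changes of variables undo the reflections. -/
lemma hat_mul (hχ : IsCS χ) (hv : IsCS v) (ξ : ℝ) :
    hat (fun x => χ x * v x) ξ = ∫ ζ, hat χ (ξ - ζ) * hat v ζ := by
  have h1 := SchwartzMap.convolution_apply (ContinuousLinearMap.mul ℂ ℂ) (𝓕⁻ hχ.sch) (𝓕⁻ hv.sch) (-ξ)
  have h2 : SchwartzMap.convolution (ContinuousLinearMap.mul ℂ ℂ) (𝓕⁻ hχ.sch) (𝓕⁻ hv.sch)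
      = 𝓕⁻ (hχ.mul hv).sch := by
    have h3 : 𝓕⁻ (𝓕 (SchwartzMap.convolution (ContinuousLinearMap.mul ℂ ℂ) (𝓕⁻ hχ.sch) (𝓕⁻ hv.sch)))
        = SchwartzMap.convolution (ContinuousLinearMap.mul ℂ ℂ) (𝓕⁻ hχ.sch) (𝓕⁻ hv.sch) :=
      FourierTransform.fourierInv_fourier_eq (F := SchwartzMap ℝ ℂ) _
    rw [← h3, SchwartzMap.fourier_convolution]
    congr 1
    ext x
    simp
  have hinv : ∀ {g : ℝ → ℝ} (hg : IsCS g) (x : ℝ), (𝓕⁻ hg.sch) x = hat g (-x) := by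
    intro g hg x
    rw [SchwartzMap.fourierInv_apply_eq, hat_eq_fourier_sch hg]
    simp
  rw [h2, hinv, neg_neg] at h1
  rw [h1, convolution]
  simp only [ContinuousLinearMap.mul_apply', hinv]
  rw [← integral_sub_left_eq_self _ _ (-ξ)]
  rw [← integral_neg_eq_self]
  refine integral_congr_ae (.of_forall fun ζ => ?_)
  dsimp only
  congr 2 <;> ring

end Convolution

/-! ### The commutator estimate for sgn(ξ) and a smooth cutoff. -/

section Commutator
open Filter Topology ComplexConjugate
open scoped Convolution

variable {χ v : ℝ → ℝ}

lemma integral_prod_sub_mul {a g : ℝ → ℝ} (ha : Integrable a) (hg : Integrable g) :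
    Integrable (fun p : ℝ × ℝ => a (p.1 - p.2) * g p.2) (volume.prod volume) ∧
      ∫ p : ℝ × ℝ, a (p.1 - p.2) * g p.2 ∂(volume.prod volume) = (∫ x, a x) * ∫ x, g x := by
  have h1 := hg.convolution_integrand (ContinuousLinearMap.mul ℝ ℝ) ha
  have h2 : Integrable (fun p : ℝ × ℝ => a (p.1 - p.2) * g p.2) (volume.prod volume) := by
    simpa [mul_comm] using h1
  refine ⟨h2, ?_⟩
  have h3 := integral_convolution (ContinuousLinearMap.mul ℝ ℝ) hg ha (μ := volume) (ν := volume)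
  rw [integral_prod _ h2]
  simp only [convolution, ContinuousLinearMap.mul_apply'] at h3
  rw [mul_comm, ← h3]
  simp only [mul_comm]

/-- The function ξ|ξ| has derivative 2|ξ|. The factor |ξ - ζ| falls on the transform of the cutoff,
and only one power of frequency is left for the two copies of v. -/
lemma abs_mul_abs_sub_le (ξ ζ : ℝ) : |ξ * |ξ| - ζ * (|ζ|)| ≤ |ξ - ζ| * (|ξ| + |ζ|) := by
  rcases le_total 0 ξ with h | h <;> rcases le_total 0 ζ with h' | h' <;>
    simp only [abs_of_nonneg, abs_of_nonpos, h, h']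
  · rw [show ξ * ξ - ζ * ζ = (ξ - ζ) * (ξ + ζ) by ring, abs_mul, abs_of_nonneg (add_nonneg h h')]
  · rw [abs_of_nonneg (by nlinarith : 0 ≤ ξ - ζ), abs_of_nonneg (by nlinarith)]
    nlinarith
  · rw [abs_of_nonpos (by nlinarith : ξ - ζ ≤ 0), abs_of_nonpos (by nlinarith)]
    nlinarith
  · rw [show ξ * -ξ - ζ * -ζ = (ξ - ζ) * (-ξ + -ζ) by ring, abs_mul,
      abs_of_nonneg (a := -ξ + -ζ) (by linarith)]

lemma integrable_sq_mul_norm_hat_sq (hv : IsCS v) : Integrable fun ξ : ℝ => ξ ^ 2 * ‖hat v ξ‖ ^ 2 := by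
  have := integrable_rpow_mul_hat_mul_hat hv hv (a := 2) (by norm_num)
  simpa [sq] using this

lemma integrable_norm_hat_sq (hv : IsCS v) : Integrable fun ξ : ℝ => ‖hat v ξ‖ ^ 2 := by
  have := integrable_rpow_mul_hat_mul_hat hv hv (a := 0) (by norm_num)
  simpa [sq] using this

/-- The commutator of the Hilbert transform with a smooth multiplier is smoothing. -/
lemma abs_im_commutator_le (hχ : IsCS χ) {s : ℝ} (hs : 0 < s) (hv : IsCS v) :
    |(∫ ξ, ((ξ * |ξ| : ℝ) : ℂ) * (hat (fun x => χ x * v x) ξ * conj (hat v ξ))).im|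
      ≤ (∫ ξ, |ξ| * ‖hat χ ξ‖) * (s * (∫ ξ, ξ ^ 2 * ‖hat v ξ‖ ^ 2) + (∫ ξ, ‖hat v ξ‖ ^ 2) / (4 * s)) := by
  set X := hat χ
  set V := hat v
  have hXc : Continuous X := continuous_hat hχ.integrable
  have hVc : Continuous V := continuous_hat hv.integrable
  let F : ℝ × ℝ → ℂ := fun p => X (p.1 - p.2) * V p.2 * conj (V p.1)
  have hFc : Continuous F := by
    have := Complex.continuous_conj
    fun_prop
  -- Since χ is real, the kernel is Hermitian under exchange of the variables. Conjugating J
  -- therefore replaces the weight ξ|ξ| by ζ|ζ|, and the imaginary part sees only the difference of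
  -- the two.
  have hFconj : ∀ p, conj (F p) = F p.swap := by
    intro p
    simp only [F, map_mul, Complex.conj_conj, Prod.fst_swap, Prod.snd_swap]
    rw [← neg_sub p.1 p.2, show X (-(p.1 - p.2)) = conj (X (p.1 - p.2)) from hat_neg_arg _ _]
    ring
  have hVn : ∀ k : ℝ, 0 ≤ k → Integrable fun ξ => |ξ| ^ k * ‖V ξ‖ := fun k hk =>
    integrable_rpow_mul_hat hv (by linarith)
  obtain ⟨B, hB, hBX⟩ := hat_bounded hχ
  have hI1 : Integrable (fun p : ℝ × ℝ => ((p.1 * |p.1| : ℝ) : ℂ) * F p) (volume.prod volume) := by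
    have h1 := (hVn 2 (by norm_num)).mul_prod (hVn 0 le_rfl)
    refine (h1.const_mul B).mono' (by fun_prop) (.of_forall fun p => ?_)
    simp only [F, norm_mul, RCLike.norm_conj, Complex.norm_real, Real.norm_eq_abs, abs_abs, Real.rpow_zero, one_mul,
      Real.rpow_two]
    calc _ = (|p.1| ^ 2 * ‖V p.1‖ * ‖V p.2‖) * ‖X (p.1 - p.2)‖ := by ring
      _ ≤ (|p.1| ^ 2 * ‖V p.1‖ * ‖V p.2‖) * B := by gcongr; exact hBX _
      _ = _ := by ring
  have hI2 : Integrable (fun p : ℝ × ℝ => ((p.2 * |p.2| : ℝ) : ℂ) * F p) (volume.prod volume) := by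
    have h1 := (hVn 0 le_rfl).mul_prod (hVn 2 (by norm_num))
    refine (h1.const_mul B).mono' (by fun_prop) (.of_forall fun p => ?_)
    simp only [F, norm_mul, RCLike.norm_conj, Complex.norm_real, Real.norm_eq_abs, abs_abs, Real.rpow_zero, one_mul,
      Real.rpow_two]
    calc _ = (‖V p.1‖ * (|p.2| ^ 2 * ‖V p.2‖)) * ‖X (p.1 - p.2)‖ := by ring
      _ ≤ (‖V p.1‖ * (|p.2| ^ 2 * ‖V p.2‖)) * B := by gcongr; exact hBX _
      _ = _ := by ring
  set J : ℂ := ∫ ξ, ((ξ * |ξ| : ℝ) : ℂ) * (hat (fun x => χ x * v x) ξ * conj (V ξ)) with hJ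
  have hJ1 : J = ∫ p : ℝ × ℝ, ((p.1 * |p.1| : ℝ) : ℂ) * F p ∂(volume.prod volume) := by
    rw [integral_prod _ hI1, hJ]
    refine integral_congr_ae (.of_forall fun ξ => ?_)
    dsimp only
    rw [hat_mul hχ hv, integral_const_mul, ← integral_mul_const]
  have hJ2 : conj J = ∫ p : ℝ × ℝ, ((p.2 * |p.2| : ℝ) : ℂ) * F p ∂(volume.prod volume) := by
    rw [hJ1, ← integral_conj, ← integral_prod_swap]
    refine integral_congr_ae (.of_forall fun p => ?_)
    simp only [map_mul, Complex.conj_ofReal, hFconj, Prod.swap_swap, Prod.fst_swap]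
  have him : 2 * |J.im| = ‖J - conj J‖ := by
    rw [Complex.sub_conj]
    simp
  have hdiff : J - conj J = ∫ p : ℝ × ℝ, ((p.1 * |p.1| - p.2 * |p.2| : ℝ) : ℂ) * F p ∂(volume.prod volume) := by
    rw [hJ2, hJ1, ← integral_sub hI1 hI2]
    refine integral_congr_ae (.of_forall fun p => ?_)
    simp only [Complex.ofReal_sub]
    ring
  let a : ℝ → ℝ := fun η => |η| * ‖X η‖
  have ha : Integrable a := by simpa using integrable_rpow_mul_hat hχ (a := 1) (by norm_num)
  have haeven : ∀ η, a (-η) = a η := fun η => by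
    simp only [a, abs_neg]
    rw [show X (-η) = conj (X η) from hat_neg_arg _ _, RCLike.norm_conj]
  let g : ℝ → ℝ := fun ζ => s * (ζ ^ 2 * ‖V ζ‖ ^ 2) + ‖V ζ‖ ^ 2 / (4 * s)
  have hg1 := (integrable_sq_mul_norm_hat_sq hv).const_mul s
  have hg2 := (integrable_norm_hat_sq hv).div_const (4 * s)
  have hg : Integrable g := hg1.add hg2
  have hgint : ∫ x, g x = s * (∫ ξ, ξ ^ 2 * ‖V ξ‖ ^ 2) + (∫ ξ, ‖V ξ‖ ^ 2) / (4 * s) := by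
    rw [integral_add hg1 hg2, integral_const_mul, integral_div]
  obtain ⟨hp1, hp2⟩ := integral_prod_sub_mul ha hg
  have hswap : (fun p : ℝ × ℝ => a (p.1 - p.2) * g p.1) = (fun p : ℝ × ℝ => a (p.1 - p.2) * g p.2) ∘ Prod.swap := by
    ext p
    simp only [Function.comp, Prod.fst_swap, Prod.snd_swap]
    rw [← haeven, neg_sub]
  have hp1' : Integrable (fun p : ℝ × ℝ => a (p.1 - p.2) * g p.1) (volume.prod volume) := by
    rw [hswap]; exact hp1.swap
  have hp2' : ∫ p : ℝ × ℝ, a (p.1 - p.2) * g p.1 ∂(volume.prod volume) = (∫ x, a x) * ∫ x, g x := by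
    rw [← hp2, hswap]
    exact integral_prod_swap (fun p : ℝ × ℝ => a (p.1 - p.2) * g p.2)
  have hbound : ‖J - conj J‖ ≤ ∫ p : ℝ × ℝ, (a (p.1 - p.2) * g p.1 + a (p.1 - p.2) * g p.2) ∂(volume.prod volume) := by
    rw [hdiff]
    refine norm_integral_le_of_norm_le (hp1'.add hp1) (.of_forall fun p => ?_)
    simp only [F, g, a, norm_mul, RCLike.norm_conj, Complex.norm_real, Real.norm_eq_abs]
    -- Young's inequality with parameter s: the derivative term gets the small weight s and the
    -- zero-order term the weight 1/(4s).
    have key : ∀ ξ x y : ℝ, ξ * x * y ≤ s * (ξ ^ 2 * x ^ 2) + y ^ 2 / (4 * s) := by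
      intro ξ x y
      have h0 : s * (ξ ^ 2 * x ^ 2) + y ^ 2 / (4 * s) - ξ * x * y = (2 * s * (ξ * x) - y) ^ 2 / (4 * s) := by
        field_simp
        ring
      have : 0 ≤ (2 * s * (ξ * x) - y) ^ 2 / (4 * s) := by positivity
      linarith
    have k1 := key |p.1| ‖V p.1‖ ‖V p.2‖
    have k2 := key |p.2| ‖V p.2‖ ‖V p.1‖
    simp only [sq_abs] at k1 k2
    calc _ ≤ (|p.1 - p.2| * (|p.1| + |p.2|)) * (‖X (p.1 - p.2)‖ * ‖V p.2‖ * ‖V p.1‖) := by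
          gcongr; exact abs_mul_abs_sub_le _ _
      _ = (|p.1 - p.2| * ‖X (p.1 - p.2)‖) * (|p.1| * ‖V p.1‖ * ‖V p.2‖ + |p.2| * ‖V p.2‖ * ‖V p.1‖) := by ring
      _ ≤ (|p.1 - p.2| * ‖X (p.1 - p.2)‖) * ((s * (p.1 ^ 2 * ‖V p.1‖ ^ 2) + ‖V p.2‖ ^ 2 / (4 * s))
          + (s * (p.2 ^ 2 * ‖V p.2‖ ^ 2) + ‖V p.1‖ ^ 2 / (4 * s))) := by gcongr
      _ = _ := by ring
  rw [integral_add hp1' hp1, hp2', hp2, ← him, hgint] at hbound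
  linarith

end Commutator

/-! ### The bilinear form on the Fourier side and a pointwise lower bound for its symbol. -/

section Coercivity
open Filter Topology ComplexConjugate

variable {β θ : ℝ} {u v χ : ℝ → ℝ}

lemma IsTest.of_eq_zero (hu : IsCS u) {a b : ℝ} (ha : 0 < a) (hb : b < 1)
    (h : ∀ x, x ∉ Icc a b → u x = 0) : IsTest u := by
  refine ⟨hu.smooth, hu.compact, ?_⟩
  have h1 : tsupport u ⊆ Icc a b :=
    closure_minimal (fun x hx => by_contra fun hn => hx (h x hn)) isClosed_Icc
  exact h1.trans fun x hx => ⟨ha.trans_le hx.1, hx.2.trans_lt hb⟩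

lemma IsTest.exists_margin (hv : IsTest v) :
    ∃ δ, 0 < δ ∧ ∀ x, x ∉ Icc δ (1 - δ) → v x = 0 := by
  obtain ⟨δ, hδ, h⟩ := hv.2.1.isCompact.exists_thickening_subset_open isOpen_Ioo hv.2.2
  refine ⟨δ / 2, by positivity, fun x hx => by_contra fun hn => hx ?_⟩
  have hx' : x ∈ tsupport v := subset_tsupport v hn
  have h1 : x - δ / 2 ∈ Ioo (0 : ℝ) 1 := h (Metric.mem_thickening_iff.2 ⟨x, hx', by
    rw [Real.dist_eq, abs_of_neg] <;> linarith⟩)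
  have h2 : x + δ / 2 ∈ Ioo (0 : ℝ) 1 := h (Metric.mem_thickening_iff.2 ⟨x, hx', by
    rw [Real.dist_eq, abs_of_pos] <;> linarith⟩)
  exact ⟨by linarith [h1.1], by linarith [h2.2]⟩

lemma deriv_eq_zero_of_notMem_Icc {a b : ℝ} (h : ∀ x, x ∉ Icc a b → u x = 0) {x : ℝ}
    (hx : x ∉ Icc a b) : deriv u x = 0 := by
  have : u =ᶠ[𝓝 x] fun _ => 0 := by
    filter_upwards [isClosed_Icc.isOpen_compl.mem_nhds hx] with y hy using h y hy
  rw [this.deriv_eq]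
  simp

/-- For large t the factor t^{p-2} is below δ since p < 2; for small t the power is bounded. This is
what absorbs terms of intermediate order. -/
lemma exists_rpow_le_mul_sq_add {p : ℝ} (hp : 0 ≤ p) (hp2 : p < 2) {δ : ℝ} (hδ : 0 < δ) :
    ∃ C, 0 ≤ C ∧ ∀ t, 0 ≤ t → t ^ p ≤ δ * t ^ 2 + C := by
  have hlim := tendsto_rpow_neg_atTop (y := 2 - p) (by linarith)
  obtain ⟨T, hT1, hT⟩ := ((hlim.eventually (gt_mem_nhds hδ)).and (eventually_gt_atTop 0)).exists
  refine ⟨T ^ p, by positivity, fun t ht => ?_⟩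
  rcases le_total t T with h | h
  · have := Real.rpow_le_rpow ht h hp
    nlinarith [sq_nonneg t]
  · have ht0 : 0 < t := hT.trans_le h
    have h1 : t ^ p = t ^ (-(2 - p)) * t ^ 2 := by
      rw [← Real.rpow_natCast, ← Real.rpow_add ht0]
      norm_num
    have h2 : t ^ (-(2 - p)) ≤ T ^ (-(2 - p)) := Real.rpow_le_rpow_of_nonpos hT h (by linarith)
    have h3 : 0 ≤ T ^ p := by positivity
    rw [h1]
    nlinarith [sq_nonneg t, mul_le_mul_of_nonneg_right (h2.trans hT1.le) (sq_nonneg t)]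

/-- The symbol `θ (iω)^{-β} + (1-θ) (-iω)^{-β}` of the two-sided fractional integral. -/
def twoSidedSymbol (β θ ξ : ℝ) : ℂ := θ * fracSymbol β ξ + (1 - θ) * conj (fracSymbol β ξ)

/-- The bilinear form `(D I^β_θ u, D v)` on the Fourier side. -/
def fracForm (β θ : ℝ) (u v : ℝ → ℝ) : ℝ :=
  (∫ ξ, (((2 * Real.pi * ξ) ^ 2 : ℝ) : ℂ) * (twoSidedSymbol β θ ξ * (hat u ξ * conj (hat v ξ)))).re

lemma norm_twoSidedSymbol_le (hθ : 0 ≤ θ) (hθ' : θ ≤ 1) (ξ : ℝ) :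
    ‖twoSidedSymbol β θ ξ‖ ≤ |2 * Real.pi * ξ| ^ (-β) := by
  rw [twoSidedSymbol]
  refine (norm_add_le _ _).trans (le_of_eq ?_)
  rw [norm_mul, norm_mul, RCLike.norm_conj, norm_fracSymbol, Complex.norm_real, Real.norm_of_nonneg hθ,
    ← Complex.ofReal_one, ← Complex.ofReal_sub, Complex.norm_real, Real.norm_of_nonneg (by linarith)]
  ring

lemma measurable_twoSidedSymbol (β θ : ℝ) : Measurable (twoSidedSymbol β θ) :=
  ((measurable_fracSymbol β).const_mul _).add
    ((Complex.continuous_conj.measurable.comp (measurable_fracSymbol β)).const_mul _)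

lemma sq_mul_abs_rpow_neg {w : ℝ} (hw : w ≠ 0) (β : ℝ) : w ^ 2 * |w| ^ (-β) = |w| ^ (2 - β) := by
  rw [← sq_abs, ← Real.rpow_natCast, ← Real.rpow_add (abs_pos.2 hw)]
  norm_num [sub_eq_add_neg]

lemma ae_ne_zero : ∀ᵐ ξ : ℝ, ξ ≠ 0 := by simp [ae_iff]

lemma two_pi_mul_ne_zero {ξ : ℝ} (hξ : ξ ≠ 0) : 2 * Real.pi * ξ ≠ 0 := by
  simp [hξ, Real.pi_ne_zero]

lemma integrable_abs_rpow_mul_hat_mul_hat (hu : IsCS u) (hv : IsCS v) {a : ℝ} (ha : -1 < a) :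
    Integrable fun ξ : ℝ => |2 * Real.pi * ξ| ^ a * (‖hat u ξ‖ * ‖hat v ξ‖) := by
  refine ((integrable_rpow_mul_hat_mul_hat hu hv ha).const_mul (|2 * Real.pi| ^ a)).congr
    (.of_forall fun ξ => ?_)
  dsimp only
  rw [← mul_assoc, ← Real.mul_rpow (abs_nonneg _) (abs_nonneg _), ← abs_mul]

lemma integrable_fracForm (hβ1 : β < 1) (hθ : 0 ≤ θ) (hθ' : θ ≤ 1) (hu : IsCS u) (hv : IsCS v) :
    Integrable fun ξ => (((2 * Real.pi * ξ) ^ 2 : ℝ) : ℂ)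
      * (twoSidedSymbol β θ ξ * (hat u ξ * conj (hat v ξ))) := by
  refine (integrable_abs_rpow_mul_hat_mul_hat hu hv (a := 2 - β) (by linarith)).mono' ?_ ?_
  · refine (Measurable.mul ?_ ((measurable_twoSidedSymbol β θ).mul ?_)).aestronglyMeasurable
    · exact Complex.measurable_ofReal.comp (by fun_prop)
    · exact (continuous_hat hu.integrable).measurable.mul
        (Complex.continuous_conj.measurable.comp (continuous_hat hv.integrable).measurable)
  · filter_upwards [ae_ne_zero] with ξ hξ
    rw [norm_mul, norm_mul, norm_mul, RCLike.norm_conj, Complex.norm_real, Real.norm_of_nonneg (sq_nonneg _),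
      ← sq_mul_abs_rpow_neg (two_pi_mul_ne_zero hξ), mul_assoc (_ ^ 2)]
    exact mul_le_mul_of_nonneg_left (mul_le_mul_of_nonneg_right (norm_twoSidedSymbol_le hθ hθ' ξ)
      (by positivity)) (sq_nonneg _)

lemma integral_sq_mul_hat_mul_conj (hu : IsCS u) (hv : IsCS v) :
    ∫ ξ, (((2 * Real.pi * ξ) ^ 2 : ℝ) : ℂ) * (hat u ξ * conj (hat v ξ))
      = ((∫ x, deriv u x * deriv v x : ℝ) : ℂ) := by
  rw [← integral_hat_mul_conj hu.deriv hv.deriv]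
  refine integral_congr_ae (.of_forall fun ξ => ?_)
  simp only [hat_deriv hu, hat_deriv hv, map_mul, Complex.conj_ofReal, Complex.conj_I, map_ofNat]
  push_cast
  linear_combination ((4 * Real.pi ^ 2 * ξ ^ 2 * hat u ξ * conj (hat v ξ))) * Complex.I_sq

lemma integral_sq_mul_norm_hat_sq (hu : IsCS u) :
    ∫ ξ, (2 * Real.pi * ξ) ^ 2 * ‖hat u ξ‖ ^ 2 = ∫ x, deriv u x ^ 2 := by
  rw [← integral_norm_hat_sq hu.deriv]
  refine integral_congr_ae (.of_forall fun ξ => ?_)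
  simp only [hat_deriv hu, norm_mul, Complex.norm_real, Complex.norm_I, Real.norm_eq_abs, mul_pow, sq_abs]
  norm_num

lemma phase_sq {ξ : ℝ} (hξ : ξ ≠ 0) (β : ℝ) :
    phase β ξ ^ 2 = Real.cos (Real.pi * β) + Real.sign ξ * Real.sin (Real.pi * β) * Complex.I := by
  rw [phase, ← Complex.exp_nat_mul]
  rcases lt_or_gt_of_ne hξ with h | h
  · rw [Real.sign_of_neg h, show ((2 : ℕ) : ℂ) * (((Real.pi * β / 2 * -1 : ℝ) : ℂ) * Complex.I)
      = ((-(Real.pi * β) : ℝ) : ℂ) * Complex.I by push_cast; ring, Complex.exp_mul_I, ← Complex.ofReal_cos,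
      ← Complex.ofReal_sin, Real.cos_neg, Real.sin_neg]
    push_cast
    ring
  · rw [Real.sign_of_pos h, show ((2 : ℕ) : ℂ) * (((Real.pi * β / 2 * 1 : ℝ) : ℂ) * Complex.I)
      = ((Real.pi * β : ℝ) : ℂ) * Complex.I by push_cast; ring, Complex.exp_mul_I, ← Complex.ofReal_cos,
      ← Complex.ofReal_sin]
    push_cast
    ring

/-- Pointwise lower bound for the symbol calculus in the proof of the localized coercivity. -/
lemma re_symbol_lower_bound {ξ : ℝ} (hξ : ξ ≠ 0) (hθ : 0 ≤ θ) (hθ' : θ ≤ 1) {m W₁ W₂ : ℂ} {R : ℝ}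
    (hm : ‖m - ((|2 * Real.pi * ξ| ^ β : ℝ) : ℂ) * phase β ξ‖ ≤ R) :
    (θ + (1 - θ) * Real.cos (Real.pi * β)) * (W₁ * conj (W₁ + W₂)).re
      + (1 - θ + θ * Real.cos (Real.pi * β)) * (W₂ * conj (W₁ + W₂)).re
      - Real.sin (Real.pi * β) * (Real.sign ξ * (W₁ * conj (W₁ + W₂)).im)
      - R * (|2 * Real.pi * ξ| ^ (-β) * ((‖W₁‖ + ‖W₂‖) * ‖W₁ + W₂‖))
    ≤ (twoSidedSymbol β θ ξ * ((m * W₁ + conj m * W₂) * conj (W₁ + W₂))).re := by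
  set V := W₁ + W₂ with hV
  set r : ℝ := |2 * Real.pi * ξ| ^ β with hr
  have hrpos : 0 < r := Real.rpow_pos_of_pos (abs_pos.2 (two_pi_mul_ne_zero hξ)) _
  have hrc : (r : ℂ) ≠ 0 := by exact_mod_cast hrpos.ne'
  set ρ := m - (r : ℂ) * phase β ξ with hρ
  have hmρ : m = r * phase β ξ + ρ := by rw [hρ]; ring
  set ph := phase β ξ
  have hph1 : ph * conj ph = 1 := phase_mul_conj β ξ
  have hrinv : |2 * Real.pi * ξ| ^ (-β) = r⁻¹ := by rw [hr, Real.rpow_neg (abs_nonneg _)]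
  have hP : fracSymbol β ξ = (r : ℂ)⁻¹ * conj ph := by
    rw [fracSymbol, hrinv]; push_cast; rfl
  have hPc : conj (fracSymbol β ξ) = (r : ℂ)⁻¹ * ph := by
    rw [hP]; simp
  -- Write m = (iω)^β + ρ. For the exact powers the products with the two-sided symbol are θ +
  -- (1-θ)e^{iπβ sgn ξ} and 1-θ + θe^{-iπβ sgn ξ}; everything involving ρ is error.
  have hsplit : twoSidedSymbol β θ ξ * ((m * W₁ + conj m * W₂) * conj V)
      = ((θ + (1 - θ) * ph ^ 2) * W₁ + ((1 - θ) + θ * conj (ph ^ 2)) * W₂) * conj V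
        + twoSidedSymbol β θ ξ * ((ρ * W₁ + conj ρ * W₂) * conj V) := by
    have h1 : twoSidedSymbol β θ ξ * (r * ph) = θ + (1 - θ) * ph ^ 2 := by
      rw [twoSidedSymbol, hPc, hP]
      field_simp
      linear_combination (θ : ℂ) * hph1
    have h2 : twoSidedSymbol β θ ξ * (r * conj ph) = (1 - θ) + θ * conj (ph ^ 2) := by
      rw [twoSidedSymbol, hPc, hP, map_pow]
      field_simp
      linear_combination (1 - θ : ℂ) * hph1
    rw [hmρ, map_add, map_mul, Complex.conj_ofReal]
    linear_combination (W₁ * conj V) * h1 + (W₂ * conj V) * h2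
  have herr : |(twoSidedSymbol β θ ξ * ((ρ * W₁ + conj ρ * W₂) * conj V)).re|
      ≤ R * (r⁻¹ * ((‖W₁‖ + ‖W₂‖) * ‖V‖)) := by
    refine (Complex.abs_re_le_norm _).trans ?_
    rw [norm_mul, norm_mul, RCLike.norm_conj]
    have h1 : ‖ρ * W₁ + conj ρ * W₂‖ ≤ R * (‖W₁‖ + ‖W₂‖) := by
      refine (norm_add_le _ _).trans ?_
      rw [norm_mul, norm_mul, RCLike.norm_conj, ← mul_add]
      gcongr
    have h2 : ‖twoSidedSymbol β θ ξ‖ ≤ r⁻¹ := hrinv ▸ norm_twoSidedSymbol_le hθ hθ' ξ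
    calc _ ≤ r⁻¹ * ((R * (‖W₁‖ + ‖W₂‖)) * ‖V‖) := by gcongr
      _ = _ := by ring
  -- Since (W₁ + W₂) conj V = |V|² is real, the imaginary parts of W₁ conj V and W₂ conj V are
  -- opposite. The two skew contributions, weighted 1-θ and θ, thus add up to a single one with
  -- weight 1.
  have hmain : (((θ + (1 - θ) * ph ^ 2) * W₁ + ((1 - θ) + θ * conj (ph ^ 2)) * W₂) * conj V).re
      = (θ + (1 - θ) * Real.cos (Real.pi * β)) * (W₁ * conj V).re
        + (1 - θ + θ * Real.cos (Real.pi * β)) * (W₂ * conj V).re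
        - Real.sin (Real.pi * β) * (Real.sign ξ * (W₁ * conj V).im) := by
    have hph2 : ph ^ 2 = Real.cos (Real.pi * β) + Real.sign ξ * Real.sin (Real.pi * β) * Complex.I :=
      phase_sq hξ β
    rw [hph2, hV]
    simp only [Complex.add_re, Complex.mul_re, Complex.add_im, Complex.mul_im, Complex.conj_re, Complex.conj_im,
      Complex.ofReal_re, Complex.ofReal_im, Complex.I_re, Complex.I_im, Complex.sub_re, Complex.sub_im,
      Complex.one_re, Complex.one_im]
    ring
  rw [hrinv, hsplit, Complex.add_re, hmain]
  linarith [(abs_le.1 herr).1]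

end Coercivity

/-! ### The localized inverse as a test function, and its pairing with v. -/

section LocalizedCoercivity
open Filter Topology ComplexConjugate

variable {β θ : ℝ} {u v χ : ℝ → ℝ}

lemma truncKernel_eq_zero {h : ℝ} {t : ℝ} (ht : t ∉ Icc 0 h) : truncKernel β h t = 0 :=
  indicator_of_notMem (fun hn => ht (Ioc_subset_Icc_self hn)) _

lemma hasCompactSupport_truncKernel (β h : ℝ) : HasCompactSupport (truncKernel β h) :=
  HasCompactSupport.intro isCompact_Icc fun _ ht => truncKernel_eq_zero ht

/-- The test function `κ * v₁' - κ(-·) * v₂'` behaves like `D^β v₁` on the left and like the right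
sided derivative of `v₂` on the right. -/
def localInverse (β : ℝ) (v₁ v₂ : ℝ → ℝ) (x : ℝ) : ℝ :=
  conv (truncKernel β (1 / 4)) (deriv v₁) x - conv (fun t => truncKernel β (1 / 4) (-t)) (deriv v₂) x

/-- The left piece is smeared only to the right and the right piece only to the left, each by at
most 1/4, so neither reaches the far endpoint. -/
lemma isTest_localInverse (hβ1 : β < 1) {v₁ v₂ : ℝ → ℝ} (h₁ : IsCS v₁) (h₂ : IsCS v₂) {δ : ℝ}
    (hδ : 0 < δ) (hz₁ : ∀ x, x ∉ Icc δ (2 / 3) → v₁ x = 0)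
    (hz₂ : ∀ x, x ∉ Icc (1 / 3) (1 - δ) → v₂ x = 0) : IsTest (localInverse β v₁ v₂) := by
  have hκ := integrable_truncKernel (β := β) (h := 1 / 4) hβ1 (by norm_num)
  have hκc := hasCompactSupport_truncKernel β (1 / 4)
  have hκ' : Integrable fun t => truncKernel β (1 / 4) (-t) := hκ.comp_neg
  have hκc' : HasCompactSupport fun t => truncKernel β (1 / 4) (-t) :=
    hκc.comp_homeomorph (Homeomorph.neg ℝ)
  have hz : ∀ t : ℝ, t ∉ Icc (-(1 / 4) : ℝ) 0 → truncKernel β (1 / 4) (-t) = 0 := fun t ht =>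
    truncKernel_eq_zero fun hn => ht ⟨by linarith [hn.2], by linarith [hn.1]⟩
  -- Here 11/12 = 2/3 + 1/4 and 1/12 = 1/3 - 1/4 are the furthest points the smeared pieces can
  -- reach.
  refine IsTest.of_eq_zero (a := min δ (1 / 12)) (b := max (1 - δ) (11 / 12))
    ((h₁.deriv.conv hκ hκc).sub (h₂.deriv.conv hκ' hκc')) (by positivity)
    (max_lt (by linarith) (by norm_num)) fun x hx => ?_
  have hd₁ := conv_eq_zero (fun t ht => truncKernel_eq_zero (β := β) (h := 1 / 4) ht)
    (fun t ht => deriv_eq_zero_of_notMem_Icc hz₁ ht) (x := x) (fun hn => hx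
      ⟨(min_le_left _ _).trans (by linarith [hn.1]), le_trans (by linarith [hn.2]) (le_max_right _ _)⟩)
  have hd₂ := conv_eq_zero hz (fun t ht => deriv_eq_zero_of_notMem_Icc hz₂ ht) (x := x) (fun hn => hx
      ⟨(min_le_right _ _).trans (by linarith [hn.1]), le_trans (by linarith [hn.2]) (le_max_left _ _)⟩)
  rw [localInverse, hd₁, hd₂, sub_zero]

/-- Reflecting the kernel conjugates its transform while iω changes sign under conjugation; the
minus sign in the definition makes the second multiplier exactly the conjugate of the first. -/
lemma hat_localInverse (hβ1 : β < 1) {v₁ v₂ : ℝ → ℝ} (h₁ : IsCS v₁) (h₂ : IsCS v₂) (ξ : ℝ) :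
    hat (localInverse β v₁ v₂) ξ
      = 2 * Real.pi * Complex.I * ξ * hat (truncKernel β (1 / 4)) ξ * hat v₁ ξ
        + conj (2 * Real.pi * Complex.I * ξ * hat (truncKernel β (1 / 4)) ξ) * hat v₂ ξ := by
  have hκ := integrable_truncKernel (β := β) (h := 1 / 4) hβ1 (by norm_num)
  have hκc := hasCompactSupport_truncKernel β (1 / 4)
  have hκ' : Integrable fun t => truncKernel β (1 / 4) (-t) := hκ.comp_neg
  have hκc' : HasCompactSupport fun t => truncKernel β (1 / 4) (-t) :=
    hκc.comp_homeomorph (Homeomorph.neg ℝ)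
  have h := hat_sub (h₁.deriv.conv hκ hκc).integrable (h₂.deriv.conv hκ' hκc').integrable ξ
  rw [show localInverse β v₁ v₂ = fun x => conv (truncKernel β (1 / 4)) (deriv v₁) x
    - conv (fun t => truncKernel β (1 / 4) (-t)) (deriv v₂) x from rfl, h,
    hat_conv hκ h₁.deriv.integrable, hat_conv hκ' h₂.deriv.integrable, hat_comp_neg, hat_deriv h₁,
    hat_deriv h₂]
  simp only [map_mul, Complex.conj_ofReal, Complex.conj_I, map_ofNat]
  ring

lemma integrable_two_pi_sq_mul_norm_hat_sq (hv : IsCS v) :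
    Integrable fun ξ : ℝ => (2 * Real.pi * ξ) ^ 2 * ‖hat v ξ‖ ^ 2 := by
  refine ((integrable_sq_mul_norm_hat_sq hv).const_mul ((2 * Real.pi) ^ 2)).congr (.of_forall fun ξ => ?_)
  dsimp only
  ring

lemma sign_mul_sq (ξ : ℝ) : Real.sign ξ * ξ ^ 2 = ξ * |ξ| := by
  rcases lt_trichotomy ξ 0 with h | h | h
  · rw [Real.sign_of_neg h, abs_of_neg h]; ring
  · simp [h]
  · rw [Real.sign_of_pos h, abs_of_pos h]; ring

/-- The instance needed has t = |w|^{1-β}: the error term of order 2-β is split as |w| times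
|w|^{1-β}, and the square of the second factor is of order below 2. -/
lemma mul_mul_le_young {η δ C R w x y t : ℝ} (hη : 0 < η) (hR : 0 ≤ R)
    (ht : t ^ 2 ≤ δ * w ^ 2 + C) :
    R * (|w| * t * x * y) ≤ R * (η * (w ^ 2 * y ^ 2) + (δ * (w ^ 2 * x ^ 2) + C * x ^ 2) / (4 * η)) := by
  refine mul_le_mul_of_nonneg_left ?_ hR
  have h0 : η * (w ^ 2 * y ^ 2) + t ^ 2 * x ^ 2 / (4 * η) - |w| * t * x * y
      = (2 * η * (|w| * y) - t * x) ^ 2 / (4 * η) := by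
    rw [← sq_abs w]
    field_simp
    ring
  have h1 : 0 ≤ (2 * η * (|w| * y) - t * x) ^ 2 / (4 * η) := by positivity
  have h2 : t ^ 2 * x ^ 2 / (4 * η) ≤ (δ * (w ^ 2 * x ^ 2) + C * x ^ 2) / (4 * η) := by
    gcongr
    nlinarith [sq_nonneg x]
  linarith

/-- Pairing with the localized inverse, bounded below up to lower order terms. -/
lemma fracForm_localInverse_lower_bound (hβ : 0 < β) (hβ1 : β < 1 / 2) (hθ : 0 ≤ θ) (hθ' : θ ≤ 1)
    (hχ : IsCS χ) {v₁ v₂ : ℝ → ℝ} (hv : IsCS v) (h₁ : IsCS v₁) (h₂ : IsCS v₂)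
    (e₁ : ∀ x, v₁ x = χ x * v x) (e₂ : ∀ x, v₂ x = v x - v₁ x)
    (hu : IsCS (localInverse β v₁ v₂)) {η δ Cδ s : ℝ} (hη : 0 < η) (hs : 0 < s)
    (hδ : ∀ t : ℝ, 0 ≤ t → t ^ (2 - 2 * β) ≤ δ * t ^ 2 + Cδ) :
    (θ + (1 - θ) * Real.cos (Real.pi * β)) * (∫ x, deriv v₁ x * deriv v x)
      + (1 - θ + θ * Real.cos (Real.pi * β)) * (∫ x, deriv v₂ x * deriv v x)
      - (2 * Real.pi) ^ 2 * ((∫ ξ, |ξ| * ‖hat χ ξ‖)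
        * (s * (∫ ξ, ξ ^ 2 * ‖hat v ξ‖ ^ 2) + (∫ x, v x ^ 2) / (4 * s)))
      - (2 * (1 / 4) ^ (-β) / Real.Gamma (1 - β)) * (2 * η * (∫ x, deriv v x ^ 2)
        + (δ * ((∫ x, deriv v₁ x ^ 2) + ∫ x, deriv v₂ x ^ 2)
          + Cδ * ((∫ x, v₁ x ^ 2) + ∫ x, v₂ x ^ 2)) / (4 * η))
    ≤ fracForm β θ (localInverse β v₁ v₂) v := by
  set R : ℝ := 2 * (1 / 4) ^ (-β) / Real.Gamma (1 - β) with hRdef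
  have hR0 : 0 ≤ R := by
    have : 0 < Real.Gamma (1 - β) := Real.Gamma_pos_of_pos (by linarith)
    positivity
  set a₁ := θ + (1 - θ) * Real.cos (Real.pi * β)
  set a₂ := 1 - θ + θ * Real.cos (Real.pi * β)
  set σ := Real.sin (Real.pi * β)
  have hVsum : ∀ ξ, hat v ξ = hat v₁ ξ + hat v₂ ξ := by
    intro ξ
    have : v₂ = fun x => v x - v₁ x := funext e₂
    rw [this, hat_sub hv.integrable h₁.integrable]
    ring
  have hC : ∀ {w : ℝ → ℝ}, IsCS w → Integrable fun ξ => (((2 * Real.pi * ξ) ^ 2 : ℝ) : ℂ) * (hat w ξ * conj (hat v ξ)) := by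
    intro w hw
    refine (integrable_abs_rpow_mul_hat_mul_hat hw hv (a := 2) (by norm_num)).mono' ?_ (.of_forall fun ξ => ?_)
    · refine (Measurable.mul (Complex.measurable_ofReal.comp (by fun_prop)) ?_).aestronglyMeasurable
      exact (continuous_hat hw.integrable).measurable.mul
        (Complex.continuous_conj.measurable.comp (continuous_hat hv.integrable).measurable)
    · rw [norm_mul, norm_mul, RCLike.norm_conj, Complex.norm_real, Real.norm_of_nonneg (sq_nonneg _),
        Real.rpow_two, sq_abs]
  have hre : ∀ {w : ℝ → ℝ} (hw : IsCS w), Integrable (fun ξ => (2 * Real.pi * ξ) ^ 2 * (hat w ξ * conj (hat v ξ)).re) ∧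
      ∫ ξ, (2 * Real.pi * ξ) ^ 2 * (hat w ξ * conj (hat v ξ)).re = ∫ x, deriv w x * deriv v x := by
    intro w hw
    have h1 := (hC hw).re
    have h2 : ∀ ξ : ℝ, RCLike.re ((((2 * Real.pi * ξ) ^ 2 : ℝ) : ℂ) * (hat w ξ * conj (hat v ξ)))
        = (2 * Real.pi * ξ) ^ 2 * (hat w ξ * conj (hat v ξ)).re := fun ξ => by
      rw [RCLike.re_eq_complex_re, Complex.re_ofReal_mul]
    refine ⟨h1.congr (.of_forall h2), ?_⟩
    have h3 := integral_re (hC hw)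
    rw [integral_sq_mul_hat_mul_conj hw hv] at h3
    rw [RCLike.re_eq_complex_re, Complex.ofReal_re] at h3
    rw [← h3]
    exact integral_congr_ae (.of_forall fun ξ => (h2 ξ).symm)
  -- Because sgn(ξ)ξ² = ξ|ξ|, the skew term is the commutator integral.
  have him : Integrable (fun ξ => (2 * Real.pi * ξ) ^ 2 * (Real.sign ξ * (hat v₁ ξ * conj (hat v ξ)).im)) ∧
      ∫ ξ, (2 * Real.pi * ξ) ^ 2 * (Real.sign ξ * (hat v₁ ξ * conj (hat v ξ)).im)
        = (2 * Real.pi) ^ 2 * (∫ ξ, ((ξ * |ξ| : ℝ) : ℂ) * (hat (fun x => χ x * v x) ξ * conj (hat v ξ))).im := by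
    have hI : Integrable fun ξ : ℝ => ((ξ * |ξ| : ℝ) : ℂ) * (hat v₁ ξ * conj (hat v ξ)) := by
      refine (integrable_rpow_mul_hat_mul_hat h₁ hv (a := 2) (by norm_num)).mono' ?_ (.of_forall fun ξ => ?_)
      · refine (Measurable.mul (Complex.measurable_ofReal.comp (by fun_prop)) ?_).aestronglyMeasurable
        exact (continuous_hat h₁.integrable).measurable.mul
          (Complex.continuous_conj.measurable.comp (continuous_hat hv.integrable).measurable)
      · rw [norm_mul, norm_mul, RCLike.norm_conj, Complex.norm_real, Real.rpow_two, norm_mul]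
        simp [sq]
    have h2 : ∀ ξ : ℝ, (2 * Real.pi) ^ 2 * RCLike.im (((ξ * |ξ| : ℝ) : ℂ) * (hat v₁ ξ * conj (hat v ξ)))
        = (2 * Real.pi * ξ) ^ 2 * (Real.sign ξ * (hat v₁ ξ * conj (hat v ξ)).im) := fun ξ => by
      rw [RCLike.im_eq_complex_im, Complex.im_ofReal_mul, ← sign_mul_sq]
      ring
    have hv₁ : v₁ = fun x => χ x * v x := funext e₁
    refine ⟨(hI.im.const_mul _).congr (.of_forall h2), ?_⟩
    have h3 := integral_im hI
    rw [← hv₁, ← RCLike.im_eq_complex_im, ← h3, ← integral_const_mul]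
    exact integral_congr_ae (.of_forall fun ξ => (h2 ξ).symm)
  have hcomm := abs_im_commutator_le hχ hs hv
  rw [integral_norm_hat_sq hv] at hcomm
  have hF := integrable_fracForm (β := β) (by linarith) hθ hθ' hu hv
  have hQ : ∀ {w : ℝ → ℝ} (_ : IsCS w), Integrable (fun ξ : ℝ => (2 * Real.pi * ξ) ^ 2 * ‖hat w ξ‖ ^ 2) :=
    fun hw => integrable_two_pi_sq_mul_norm_hat_sq hw
  have hN : ∀ {w : ℝ → ℝ} (_ : IsCS w), Integrable (fun ξ : ℝ => ‖hat w ξ‖ ^ 2) :=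
    fun hw => integrable_norm_hat_sq hw
  -- `E₀` integrates to the coercive term and `E₁` to the commutator term; `E₂`, `E₃` and `E₄` are
  -- the pieces of the Young bound for the symbol error.
  let E₀ : ℝ → ℝ := fun ξ => a₁ * ((2 * Real.pi * ξ) ^ 2 * (hat v₁ ξ * conj (hat v ξ)).re)
      + a₂ * ((2 * Real.pi * ξ) ^ 2 * (hat v₂ ξ * conj (hat v ξ)).re)
  let E₁ : ℝ → ℝ := fun ξ => σ * ((2 * Real.pi * ξ) ^ 2 * (Real.sign ξ * (hat v₁ ξ * conj (hat v ξ)).im))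
  let E₂ : ℝ → ℝ := fun ξ => δ * ((2 * Real.pi * ξ) ^ 2 * ‖hat v₁ ξ‖ ^ 2 + (2 * Real.pi * ξ) ^ 2 * ‖hat v₂ ξ‖ ^ 2)
  let E₃ : ℝ → ℝ := fun ξ => Cδ * (‖hat v₁ ξ‖ ^ 2 + ‖hat v₂ ξ‖ ^ 2)
  let E₄ : ℝ → ℝ := fun ξ => 2 * η * ((2 * Real.pi * ξ) ^ 2 * ‖hat v ξ‖ ^ 2)
  have i₀ : Integrable E₀ := ((hre h₁).1.const_mul _).add ((hre h₂).1.const_mul _)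
  have i₁ : Integrable E₁ := him.1.const_mul _
  have i₂ : Integrable E₂ := ((hQ h₁).add (hQ h₂)).const_mul _
  have i₃ : Integrable E₃ := ((hN h₁).add (hN h₂)).const_mul _
  have i₄ : Integrable E₄ := (hQ hv).const_mul _
  have i₅ : Integrable fun ξ => R * (E₄ ξ + (E₂ ξ + E₃ ξ) / (4 * η)) :=
    (i₄.add ((i₂.add i₃).div_const _)).const_mul _
  have hpt : ∀ᵐ ξ : ℝ, E₀ ξ - E₁ ξ - R * (E₄ ξ + (E₂ ξ + E₃ ξ) / (4 * η))
      ≤ RCLike.re ((((2 * Real.pi * ξ) ^ 2 : ℝ) : ℂ) * (twoSidedSymbol β θ ξ * (hat (localInverse β v₁ v₂) ξ * conj (hat v ξ)))) := by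
    filter_upwards [ae_ne_zero] with ξ hξ
    have hm := norm_hat_truncKernel_sub_le hβ (by linarith : β < 1) (h := 1 / 4) (by norm_num) hξ
    have hlow := re_symbol_lower_bound (β := β) hξ hθ hθ' (W₁ := hat v₁ ξ) (W₂ := hat v₂ ξ) hm
    rw [← hVsum, ← hat_localInverse (by linarith) h₁ h₂] at hlow
    rw [RCLike.re_eq_complex_re, Complex.re_ofReal_mul]
    refine le_trans ?_ (mul_le_mul_of_nonneg_left hlow (sq_nonneg (2 * Real.pi * ξ)))
    set w := 2 * Real.pi * ξ with hw
    have hw0 : w ≠ 0 := two_pi_mul_ne_zero hξ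
    have ht : (|w| ^ (1 - β)) ^ 2 ≤ δ * w ^ 2 + Cδ := by
      have := hδ |w| (abs_nonneg w)
      rw [sq_abs] at this
      rwa [← Real.rpow_natCast, ← Real.rpow_mul (abs_nonneg _), show (1 - β) * ((2 : ℕ) : ℝ) = 2 - 2 * β by push_cast; ring]
    have hpow : w ^ 2 * |w| ^ (-β) = |w| * |w| ^ (1 - β) := by
      rw [sq_mul_abs_rpow_neg hw0]
      nth_rewrite 2 [← Real.rpow_one |w|]
      rw [← Real.rpow_add (abs_pos.2 hw0)]
      congr 1
      ring
    have y₁ := mul_mul_le_young (x := ‖hat v₁ ξ‖) (y := ‖hat v ξ‖) hη hR0 ht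
    have y₂ := mul_mul_le_young (x := ‖hat v₂ ξ‖) (y := ‖hat v ξ‖) hη hR0 ht
    have hsplit : w ^ 2 * (R * (|w| ^ (-β) * ((‖hat v₁ ξ‖ + ‖hat v₂ ξ‖) * ‖hat v ξ‖)))
        = R * (|w| * |w| ^ (1 - β) * ‖hat v₁ ξ‖ * ‖hat v ξ‖) + R * (|w| * |w| ^ (1 - β) * ‖hat v₂ ξ‖ * ‖hat v ξ‖) := by
      rw [← hpow]; ring
    have hsum : R * (η * (w ^ 2 * ‖hat v ξ‖ ^ 2) + (δ * (w ^ 2 * ‖hat v₁ ξ‖ ^ 2) + Cδ * ‖hat v₁ ξ‖ ^ 2) / (4 * η))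
        + R * (η * (w ^ 2 * ‖hat v ξ‖ ^ 2) + (δ * (w ^ 2 * ‖hat v₂ ξ‖ ^ 2) + Cδ * ‖hat v₂ ξ‖ ^ 2) / (4 * η))
        = R * (E₄ ξ + (E₂ ξ + E₃ ξ) / (4 * η)) := by
      simp only [E₂, E₃, E₄, ← hw]; ring
    have h0 : E₀ ξ = w ^ 2 * (a₁ * (hat v₁ ξ * conj (hat v ξ)).re + a₂ * (hat v₂ ξ * conj (hat v ξ)).re) := by
      simp only [E₀, ← hw]; ring
    have h1 : E₁ ξ = w ^ 2 * (σ * (Real.sign ξ * (hat v₁ ξ * conj (hat v ξ)).im)) := by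
      simp only [E₁, ← hw]; ring
    rw [mul_sub, mul_sub, hsplit, ← h0, ← h1, ← hsum]
    linarith
  have hint := integral_mono_ae ((i₀.sub i₁).sub i₅) hF.re hpt
  have hFre : ∫ ξ, RCLike.re ((((2 * Real.pi * ξ) ^ 2 : ℝ) : ℂ) * (twoSidedSymbol β θ ξ * (hat (localInverse β v₁ v₂) ξ * conj (hat v ξ))))
      = fracForm β θ (localInverse β v₁ v₂) v := integral_re hF
  rw [hFre] at hint
  simp only [Pi.sub_apply] at hint
  refine le_trans ?_ hint
  have hE : ∫ ξ, (E₀ ξ - E₁ ξ - R * (E₄ ξ + (E₂ ξ + E₃ ξ) / (4 * η)))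
      = (∫ ξ, E₀ ξ) - (∫ ξ, E₁ ξ) - R * ((∫ ξ, E₄ ξ) + ((∫ ξ, E₂ ξ) + ∫ ξ, E₃ ξ) / (4 * η)) := by
    have i₀₁ : Integrable fun ξ => E₀ ξ - E₁ ξ := i₀.sub i₁
    have i₂₃ : Integrable fun ξ => (E₂ ξ + E₃ ξ) / (4 * η) := (i₂.add i₃).div_const _
    rw [integral_sub i₀₁ i₅, integral_sub i₀ i₁, integral_const_mul R, integral_add i₄ i₂₃, integral_div,
      integral_add i₂ i₃]
  have hE₀ : ∫ ξ, E₀ ξ = a₁ * (∫ x, deriv v₁ x * deriv v x) + a₂ * ∫ x, deriv v₂ x * deriv v x := by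
    simp only [E₀]
    rw [integral_add ((hre h₁).1.const_mul _) ((hre h₂).1.const_mul _), integral_const_mul, integral_const_mul,
      (hre h₁).2, (hre h₂).2]
  have hE₂ : ∫ ξ, E₂ ξ = δ * ((∫ x, deriv v₁ x ^ 2) + ∫ x, deriv v₂ x ^ 2) := by
    simp only [E₂]
    rw [integral_const_mul, integral_add (hQ h₁) (hQ h₂), integral_sq_mul_norm_hat_sq h₁, integral_sq_mul_norm_hat_sq h₂]
  have hE₃ : ∫ ξ, E₃ ξ = Cδ * ((∫ x, v₁ x ^ 2) + ∫ x, v₂ x ^ 2) := by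
    simp only [E₃]
    rw [integral_const_mul, integral_add (hN h₁) (hN h₂), integral_norm_hat_sq h₁, integral_norm_hat_sq h₂]
  have hE₄ : ∫ ξ, E₄ ξ = 2 * η * ∫ x, deriv v x ^ 2 := by
    simp only [E₄]
    rw [integral_const_mul, integral_sq_mul_norm_hat_sq hv]
  have hE₁ : ∫ ξ, E₁ ξ ≤ (2 * Real.pi) ^ 2 * ((∫ ξ, |ξ| * ‖hat χ ξ‖)
        * (s * (∫ ξ, ξ ^ 2 * ‖hat v ξ‖ ^ 2) + (∫ x, v x ^ 2) / (4 * s))) := by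
    simp only [E₁]
    rw [integral_const_mul, him.2]
    have hσ : |σ| ≤ 1 := Real.abs_sin_le_one _
    refine (le_abs_self _).trans ?_
    rw [abs_mul, abs_mul, abs_of_nonneg (sq_nonneg (2 * Real.pi))]
    calc _ ≤ 1 * ((2 * Real.pi) ^ 2 * |(∫ ξ, ((ξ * |ξ| : ℝ) : ℂ) * (hat (fun x => χ x * v x) ξ * conj (hat v ξ))).im|) := by
          gcongr
      _ ≤ _ := by rw [one_mul]; gcongr
  rw [hE, hE₀, hE₂, hE₃, hE₄]
  linarith

end LocalizedCoercivity

/-! ### The cutoff and the choice of constants in the localized coercivity estimate. -/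

section LocalizedCoercivity
open Filter Topology ComplexConjugate

variable {β θ : ℝ} {u v χ : ℝ → ℝ}

/-- A smooth cutoff, equal to `1` near the left endpoint and to `0` near the right one. -/
lemma exists_cutoff : ∃ χ : ℝ → ℝ, IsCS χ ∧ (∀ x, 0 ≤ χ x) ∧ (∀ x, χ x ≤ 1) ∧
    (∀ x ∈ Icc (0 : ℝ) (1 / 3), χ x = 1) ∧ ∀ x, 2 / 3 ≤ x → χ x = 0 := by
  let f : ContDiffBump (0 : ℝ) := ⟨1 / 3, 2 / 3, by norm_num, by norm_num⟩
  refine ⟨f, ⟨f.contDiff, f.hasCompactSupport⟩, fun x => f.nonneg, fun x => f.le_one, fun x hx => ?_,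
    fun x hx => ?_⟩
  · refine f.one_of_mem_closedBall ?_
    rw [mem_closedBall_zero_iff, Real.norm_of_nonneg hx.1]
    exact hx.2
  · refine f.zero_of_le_dist ?_
    rw [dist_zero_right, Real.norm_of_nonneg (by linarith)]
    exact hx

lemma mul_le_young {η : ℝ} (hη : 0 < η) (x y : ℝ) : |x * y| ≤ η * y ^ 2 + x ^ 2 / (4 * η) := by
  have h0 : η * y ^ 2 + x ^ 2 / (4 * η) - |x * y| = (2 * η * |y| - |x|) ^ 2 / (4 * η) := by
    rw [abs_mul, ← sq_abs x, ← sq_abs y]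
    field_simp
    ring
  have h1 : 0 ≤ (2 * η * |y| - |x|) ^ 2 / (4 * η) := by positivity
  linarith

lemma IsCS.integrable_mul (hu : IsCS u) (hv : IsCS v) : Integrable fun x => u x * v x :=
  (hu.mul hv).integrable

lemma IsCS.integrable_sq (hu : IsCS u) : Integrable fun x => u x ^ 2 := by
  simpa [sq] using hu.integrable_mul hu

/-- Localized coercivity, before fixing the constants. -/
lemma cutoff_pairing_lower_bound {a₁ a₂ c₀ M η : ℝ} (hχ : IsCS χ) (hχ0 : ∀ x, 0 ≤ χ x) (hχ1 : ∀ x, χ x ≤ 1)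
    (hM : ∀ x, |deriv χ x| ≤ M) (hv : IsCS v) (hη : 0 < η) (h₁ : c₀ ≤ a₁) (h₂ : c₀ ≤ a₂)
    (h₁₂ : |a₁ - a₂| ≤ 1) :
    c₀ * (∫ x, deriv v x ^ 2) - M * (η * (∫ x, deriv v x ^ 2) + (∫ x, v x ^ 2) / (4 * η))
      ≤ a₁ * (∫ x, deriv (fun x => χ x * v x) x * deriv v x)
        + a₂ * ∫ x, deriv (fun x => v x - χ x * v x) x * deriv v x := by
  have hM0 : 0 ≤ M := (abs_nonneg _).trans (hM 0)
  have d₁ : ∀ x, deriv (fun x => χ x * v x) x = deriv χ x * v x + χ x * deriv v x := fun x =>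
    ((hχ.differentiable x).hasDerivAt.mul (hv.differentiable x).hasDerivAt).deriv
  have d₂ : ∀ x, deriv (fun x => v x - χ x * v x) x = deriv v x - (deriv χ x * v x + χ x * deriv v x) := fun x =>
    ((hv.differentiable x).hasDerivAt.sub
      ((hχ.differentiable x).hasDerivAt.mul (hv.differentiable x).hasDerivAt)).deriv
  have iD := hv.deriv.integrable_sq
  have iN := hv.integrable_sq.div_const (4 * η)
  have i₁ := ((hχ.mul hv).deriv).integrable_mul hv.deriv
  have i₂ := ((hv.sub (hχ.mul hv)).deriv).integrable_mul hv.deriv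
  have iL : Integrable fun x => M * (η * deriv v x ^ 2 + v x ^ 2 / (4 * η)) := ((iD.const_mul η).add iN).const_mul M
  have key : ∫ x, (c₀ * deriv v x ^ 2 - M * (η * deriv v x ^ 2 + v x ^ 2 / (4 * η)))
      ≤ ∫ x, (a₁ * (deriv (fun x => χ x * v x) x * deriv v x)
        + a₂ * (deriv (fun x => v x - χ x * v x) x * deriv v x)) := by
    refine integral_mono ((iD.const_mul _).sub iL) ((i₁.const_mul _).add (i₂.const_mul _)) fun x => ?_
    dsimp only
    rw [d₁, d₂]
    -- The weights combine into a convex combination of a₁ and a₂, hence at least c₀; the derivative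
    -- of the cutoff leaves one cross term, which is of lower order.
    have e1 : a₁ * ((deriv χ x * v x + χ x * deriv v x) * deriv v x)
        + a₂ * ((deriv v x - (deriv χ x * v x + χ x * deriv v x)) * deriv v x)
        = (a₁ * χ x + a₂ * (1 - χ x)) * deriv v x ^ 2 + (a₁ - a₂) * deriv χ x * (v x * deriv v x) := by ring
    have e2 : c₀ ≤ a₁ * χ x + a₂ * (1 - χ x) := by
      nlinarith [mul_le_mul_of_nonneg_right h₁ (hχ0 x), mul_le_mul_of_nonneg_right h₂ (sub_nonneg.2 (hχ1 x))]
    have e3 : |(a₁ - a₂) * deriv χ x * (v x * deriv v x)| ≤ M * (η * deriv v x ^ 2 + v x ^ 2 / (4 * η)) := by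
      rw [abs_mul, abs_mul]
      calc _ ≤ (1 * M) * (η * deriv v x ^ 2 + v x ^ 2 / (4 * η)) := by
            gcongr
            · exact hM x
            · exact mul_le_young hη _ _
        _ = _ := by ring
    rw [e1]
    have := mul_le_mul_of_nonneg_right e2 (sq_nonneg (deriv v x))
    linarith [(abs_le.1 e3).1]
  rw [integral_sub (iD.const_mul _) iL, integral_add (i₁.const_mul _) (i₂.const_mul _), integral_const_mul,
    integral_const_mul, integral_const_mul, integral_const_mul, integral_add (iD.const_mul η) iN,
    integral_const_mul, integral_div] at key
  exact key

lemma integral_deriv_cutoff_sq_le {M : ℝ} (hχ : IsCS χ) (hχ0 : ∀ x, 0 ≤ χ x) (hχ1 : ∀ x, χ x ≤ 1)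
    (hM : ∀ x, |deriv χ x| ≤ M) (hv : IsCS v) :
    ((∫ x, deriv (fun x => χ x * v x) x ^ 2) + ∫ x, deriv (fun x => v x - χ x * v x) x ^ 2)
      ≤ 4 * (∫ x, deriv v x ^ 2) + 4 * M ^ 2 * ∫ x, v x ^ 2 := by
  have d₁ : ∀ x, deriv (fun x => χ x * v x) x = deriv χ x * v x + χ x * deriv v x := fun x =>
    ((hχ.differentiable x).hasDerivAt.mul (hv.differentiable x).hasDerivAt).deriv
  have d₂ : ∀ x, deriv (fun x => v x - χ x * v x) x = deriv v x - (deriv χ x * v x + χ x * deriv v x) := fun x =>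
    ((hv.differentiable x).hasDerivAt.sub
      ((hχ.differentiable x).hasDerivAt.mul (hv.differentiable x).hasDerivAt)).deriv
  have iD := hv.deriv.integrable_sq
  have iN := hv.integrable_sq
  have i₁ := ((hχ.mul hv).deriv).integrable_sq
  have i₂ := ((hv.sub (hχ.mul hv)).deriv).integrable_sq
  rw [← integral_add i₁ i₂, ← integral_const_mul, ← integral_const_mul, ← integral_add (iD.const_mul 4) (iN.const_mul _)]
  refine integral_mono (i₁.add i₂) ((iD.const_mul _).add (iN.const_mul _)) fun x => ?_
  dsimp only
  rw [d₁, d₂]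
  have hMx : deriv χ x ^ 2 ≤ M ^ 2 := sq_le_sq' (abs_le.1 (hM x)).1 (abs_le.1 (hM x)).2
  have hc : χ x ^ 2 ≤ 1 := pow_le_one₀ (hχ0 x) (hχ1 x)
  have hc' : (1 - χ x) ^ 2 ≤ 1 := pow_le_one₀ (by linarith [hχ1 x]) (by linarith [hχ0 x])
  have k1 := mul_le_mul_of_nonneg_right hMx (sq_nonneg (v x))
  have k2 := mul_le_mul_of_nonneg_right hc (sq_nonneg (deriv v x))
  have k3 := mul_le_mul_of_nonneg_right hc' (sq_nonneg (deriv v x))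
  nlinarith [sq_nonneg (deriv χ x * v x - χ x * deriv v x), sq_nonneg (deriv χ x * v x + (1 - χ x) * deriv v x)]

lemma integral_cutoff_sq_le (hχ : IsCS χ) (hχ0 : ∀ x, 0 ≤ χ x) (hχ1 : ∀ x, χ x ≤ 1) (hv : IsCS v) :
    ((∫ x, (χ x * v x) ^ 2) + ∫ x, (v x - χ x * v x) ^ 2) ≤ ∫ x, v x ^ 2 := by
  have i₁ := (hχ.mul hv).integrable_sq
  have i₂ := (hv.sub (hχ.mul hv)).integrable_sq
  rw [← integral_add i₁ i₂]
  refine integral_mono (i₁.add i₂) hv.integrable_sq fun x => ?_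
  dsimp only
  have : χ x * (1 - χ x) * v x ^ 2 ≥ 0 :=
    mul_nonneg (mul_nonneg (hχ0 x) (by linarith [hχ1 x])) (sq_nonneg _)
  nlinarith

/-- The multiplier has modulus at most |ω|^β + R, and |ω|^{2-2β}|ω|^{2β} = ω². So the H^{1-β}
seminorm of the localized inverse is controlled by the H¹ norms of the pieces. -/
lemma integral_rpow_mul_norm_hat_localInverse_le (hβ : 0 < β) (hβ1 : β < 1 / 2) {v₁ v₂ : ℝ → ℝ}
    (h₁ : IsCS v₁) (h₂ : IsCS v₂) (hu : IsCS (localInverse β v₁ v₂)) {δ Cδ R : ℝ}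
    (hδ : ∀ t : ℝ, 0 ≤ t → t ^ (2 - 2 * β) ≤ δ * t ^ 2 + Cδ)
    (hR : R = 2 * (1 / 4) ^ (-β) / Real.Gamma (1 - β)) :
    ∫ ξ, |2 * Real.pi * ξ| ^ (2 - 2 * β) * ‖hat (localInverse β v₁ v₂) ξ‖ ^ 2
      ≤ 4 * (1 + R ^ 2 * δ) * ((∫ x, deriv v₁ x ^ 2) + ∫ x, deriv v₂ x ^ 2)
        + 4 * R ^ 2 * Cδ * ((∫ x, v₁ x ^ 2) + ∫ x, v₂ x ^ 2) := by
  have q₁ := integrable_two_pi_sq_mul_norm_hat_sq h₁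
  have q₂ := integrable_two_pi_sq_mul_norm_hat_sq h₂
  have n₁ := integrable_norm_hat_sq h₁
  have n₂ := integrable_norm_hat_sq h₂
  have iq : Integrable fun ξ : ℝ => 4 * (1 + R ^ 2 * δ) * ((2 * Real.pi * ξ) ^ 2 * ‖hat v₁ ξ‖ ^ 2
      + (2 * Real.pi * ξ) ^ 2 * ‖hat v₂ ξ‖ ^ 2) := (q₁.add q₂).const_mul _
  have iN : Integrable fun ξ : ℝ => 4 * R ^ 2 * Cδ * (‖hat v₁ ξ‖ ^ 2 + ‖hat v₂ ξ‖ ^ 2) :=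
    (n₁.add n₂).const_mul _
  rw [← integral_sq_mul_norm_hat_sq h₁, ← integral_sq_mul_norm_hat_sq h₂, ← integral_norm_hat_sq h₁,
    ← integral_norm_hat_sq h₂, ← integral_add q₁ q₂, ← integral_add n₁ n₂, ← integral_const_mul,
    ← integral_const_mul, ← integral_add iq iN]
  have hi : Integrable fun ξ : ℝ => |2 * Real.pi * ξ| ^ (2 - 2 * β) * ‖hat (localInverse β v₁ v₂) ξ‖ ^ 2 := by
    simpa [sq] using integrable_abs_rpow_mul_hat_mul_hat hu hu (a := 2 - 2 * β) (by linarith)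
  refine integral_mono_ae hi (iq.add iN) ?_
  filter_upwards [ae_ne_zero] with ξ hξ
  have hm := norm_hat_truncKernel_sub_le hβ (by linarith : β < 1) (h := 1 / 4) (by norm_num) hξ
  rw [← hR] at hm
  rw [hat_localInverse (by linarith) h₁ h₂]
  set m : ℂ := 2 * Real.pi * Complex.I * ξ * hat (truncKernel β (1 / 4)) ξ
  set w := 2 * Real.pi * ξ with hw
  set r : ℝ := |w| ^ β with hr
  have hr0 : 0 ≤ r := by positivity
  have hwpos : 0 < |w| := abs_pos.2 (two_pi_mul_ne_zero hξ)
  have hmn : ‖m‖ ≤ r + R := by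
    calc ‖m‖ = ‖(r : ℂ) * phase β ξ + (m - r * phase β ξ)‖ := by congr 1; ring
      _ ≤ ‖(r : ℂ) * phase β ξ‖ + ‖m - r * phase β ξ‖ := norm_add_le _ _
      _ ≤ r + R := by
        rw [norm_mul, norm_phase, Complex.norm_real, Real.norm_of_nonneg hr0, mul_one]
        gcongr
  have hpw : |w| ^ (2 - 2 * β) * r ^ 2 = w ^ 2 := by
    rw [hr, ← Real.rpow_natCast (|w| ^ β), ← Real.rpow_mul hwpos.le, ← Real.rpow_add hwpos, ← sq_abs w,
      ← Real.rpow_natCast]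
    congr 1
    push_cast
    ring
  have hY := hδ |w| (abs_nonneg w)
  rw [sq_abs] at hY
  have h0 : 0 ≤ |w| ^ (2 - 2 * β) := by positivity
  have hU : ‖m * hat v₁ ξ + conj m * hat v₂ ξ‖ ≤ (r + R) * (‖hat v₁ ξ‖ + ‖hat v₂ ξ‖) := by
    refine (norm_add_le _ _).trans ?_
    rw [norm_mul m, norm_mul (conj m), RCLike.norm_conj, ← mul_add]
    gcongr
  have hU2 : ‖m * hat v₁ ξ + conj m * hat v₂ ξ‖ ^ 2 ≤ 4 * (r ^ 2 + R ^ 2) * (‖hat v₁ ξ‖ ^ 2 + ‖hat v₂ ξ‖ ^ 2) := by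
    calc _ ≤ ((r + R) * (‖hat v₁ ξ‖ + ‖hat v₂ ξ‖)) ^ 2 := by gcongr
      _ = (r + R) ^ 2 * (‖hat v₁ ξ‖ + ‖hat v₂ ξ‖) ^ 2 := by ring
      _ ≤ (2 * (r ^ 2 + R ^ 2)) * (2 * (‖hat v₁ ξ‖ ^ 2 + ‖hat v₂ ξ‖ ^ 2)) := by
        gcongr
        · exact add_sq_le
        · exact add_sq_le
      _ = _ := by ring
  set S := ‖hat v₁ ξ‖ ^ 2 + ‖hat v₂ ξ‖ ^ 2 with hS
  have hS0 : 0 ≤ S := by positivity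
  calc _ ≤ |w| ^ (2 - 2 * β) * (4 * (r ^ 2 + R ^ 2) * S) := by gcongr
    _ = 4 * (|w| ^ (2 - 2 * β) * r ^ 2) * S + (4 * R ^ 2 * S) * |w| ^ (2 - 2 * β) := by ring
    _ ≤ 4 * w ^ 2 * S + (4 * R ^ 2 * S) * (δ * w ^ 2 + Cδ) := by rw [hpw]; gcongr
    _ = _ := by rw [hS]; ring

set_option maxHeartbeats 800000 in
/-- Localized coercivity of the two-sided fractional form with shifted test functions. -/
theorem exists_test_fracForm_lower_bound (hβ : 0 < β) (hβ1 : β < 1 / 2) :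
    ∃ c C : ℝ, 0 < c ∧ 0 ≤ C ∧ ∀ θ, 0 ≤ θ → θ ≤ 1 → ∀ v, IsTest v → ∃ u, IsTest u ∧
      (∫ ξ, |2 * Real.pi * ξ| ^ (2 - 2 * β) * ‖hat u ξ‖ ^ 2)
        ≤ C * ((∫ x, deriv v x ^ 2) + ∫ x, v x ^ 2) ∧
      c * (∫ x, deriv v x ^ 2) - C * (∫ x, v x ^ 2) ≤ fracForm β θ u v := by
  obtain ⟨χ, hχ, hχ0, hχ1, hχl, hχr⟩ := exists_cutoff
  obtain ⟨M, hM0, hM⟩ := hχ.deriv.bounded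
  set c₀ := Real.cos (Real.pi * β) with hc₀
  have hc₀pos : 0 < c₀ := Real.cos_pos_of_mem_Ioo ⟨by nlinarith [Real.pi_pos], by nlinarith [Real.pi_pos]⟩
  have hc₀le : c₀ ≤ 1 := Real.cos_le_one _
  set R : ℝ := 2 * (1 / 4) ^ (-β) / Real.Gamma (1 - β) with hR
  have hR0 : 0 ≤ R := by
    have : 0 < Real.Gamma (1 - β) := Real.Gamma_pos_of_pos (by linarith)
    positivity
  set A : ℝ := ∫ ξ, |ξ| * ‖hat χ ξ‖ with hA
  have hA0 : 0 ≤ A := integral_nonneg fun ξ => by positivity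
  -- The constants η, s and δ are fixed so that the cutoff and Young terms, the commutator, and the
  -- interpolated symbol error each cost at most c₀/8 of ‖v'‖². At least c₀/2 survives; all other
  -- terms are multiples of ‖v‖² collected in `C₁`.
  set η := c₀ / (8 * (M + 2 * R + 1)) with hηdef
  have hη : 0 < η := by positivity
  set s := c₀ / (8 * (A + 1)) with hsdef
  have hs : 0 < s := by positivity
  set δ := c₀ * η / (8 * (R + 1)) with hδdef
  have hδ : 0 < δ := by positivity
  obtain ⟨Cδ, hCδ0, hCδ⟩ := exists_rpow_le_mul_sq_add (p := 2 - 2 * β) (by linarith) (by linarith) hδ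
  set C₁ := M / (4 * η) + (2 * Real.pi) ^ 2 * A / (4 * s) + R * (4 * δ * M ^ 2 + Cδ) / (4 * η)
  set C₂ := 16 * (1 + R ^ 2 * δ) * (1 + M ^ 2) + 4 * R ^ 2 * Cδ
  have hC₁ : 0 ≤ C₁ := by positivity
  have hC₂ : 0 ≤ C₂ := by positivity
  refine ⟨c₀ / 2, max C₁ C₂, by positivity, hC₁.trans (le_max_left _ _), fun θ hθ hθ' v hv => ?_⟩
  obtain ⟨μ, hμ, hvz⟩ := hv.exists_margin
  have hvc := hv.isCS
  have h₁ := hχ.mul hvc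
  have h₂ := hvc.sub h₁
  set v₁ : ℝ → ℝ := fun x => χ x * v x with hv₁
  set v₂ : ℝ → ℝ := fun x => v x - χ x * v x with hv₂
  have hz₁ : ∀ x, x ∉ Icc μ (2 / 3) → v₁ x = 0 := by
    intro x hx
    by_cases h : 2 / 3 ≤ x
    · simp [hv₁, hχr x h]
    · have : x ∉ Icc μ (1 - μ) := fun hn => hx ⟨hn.1, (not_le.1 h).le⟩
      simp [hv₁, hvz x this]
  have hz₂ : ∀ x, x ∉ Icc (1 / 3) (1 - μ) → v₂ x = 0 := by
    intro x hx
    by_cases h : x ∈ Icc μ (1 - μ)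
    · have : x ∈ Icc (0 : ℝ) (1 / 3) := ⟨hμ.le.trans h.1, by
        by_contra hn; exact hx ⟨(not_le.1 hn).le, h.2⟩⟩
      simp [hv₂, hχl x this]
    · simp [hv₂, hvz x h]
  have hu := isTest_localInverse (β := β) (by linarith) h₁ h₂ hμ hz₁ hz₂
  set D := ∫ x, deriv v x ^ 2 with hD
  set N := ∫ x, v x ^ 2 with hN
  have hD0 : 0 ≤ D := integral_nonneg fun x => sq_nonneg _
  have hN0 : 0 ≤ N := integral_nonneg fun x => sq_nonneg _
  have hDi := integral_deriv_cutoff_sq_le hχ hχ0 hχ1 hM hvc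
  have hNi := integral_cutoff_sq_le hχ hχ0 hχ1 hvc
  refine ⟨localInverse β v₁ v₂, hu, ?_, ?_⟩
  · refine (integral_rpow_mul_norm_hat_localInverse_le hβ hβ1 h₁ h₂ hu.isCS hCδ hR).trans ?_
    calc _ ≤ 4 * (1 + R ^ 2 * δ) * (4 * D + 4 * M ^ 2 * N) + 4 * R ^ 2 * Cδ * N := by gcongr
      _ ≤ C₂ * (D + N) := by
        have e1 : 0 ≤ (1 + R ^ 2 * δ) * (M ^ 2 * D) := by positivity
        have e2 : 0 ≤ (1 + R ^ 2 * δ) * N := by positivity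
        have e3 : 0 ≤ 4 * R ^ 2 * Cδ * D := by positivity
        simp only [C₂]
        nlinarith
      _ ≤ _ := by gcongr; exact le_max_right _ _
  · have hθc : θ * c₀ ≤ θ := mul_le_of_le_one_right hθ hc₀le
    have hθc' : (1 - θ) * c₀ ≤ 1 - θ := mul_le_of_le_one_right (by linarith) hc₀le
    have hcut := cutoff_pairing_lower_bound (a₁ := θ + (1 - θ) * c₀) (a₂ := 1 - θ + θ * c₀) (c₀ := c₀) hχ hχ0 hχ1 hM hvc hη
      (by linarith) (by linarith) (by rw [abs_le]; constructor <;> linarith)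
    have hmain := fracForm_localInverse_lower_bound hβ hβ1 hθ hθ' hχ hvc h₁ h₂ (fun _ => rfl) (fun _ => rfl)
      hu.isCS hη hs hCδ
    have hξ : ∫ ξ, ξ ^ 2 * ‖hat v ξ‖ ^ 2 = D / (2 * Real.pi) ^ 2 := by
      rw [hD, ← integral_sq_mul_norm_hat_sq hvc, eq_div_iff (by positivity), ← integral_mul_const]
      refine integral_congr_ae (.of_forall fun ξ => ?_)
      dsimp only
      ring
    rw [hξ, ← hc₀, ← hR, ← hA] at hmain
    refine le_trans ?_ hmain
    have e1 : (2 * Real.pi) ^ 2 * (A * (s * (D / (2 * Real.pi) ^ 2) + N / (4 * s)))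
        = A * s * D + (2 * Real.pi) ^ 2 * A / (4 * s) * N := by
      have := Real.pi_pos
      field_simp
    have e2 : R * (2 * η * D + (δ * ((∫ x, deriv v₁ x ^ 2) + ∫ x, deriv v₂ x ^ 2)
          + Cδ * ((∫ x, v₁ x ^ 2) + ∫ x, v₂ x ^ 2)) / (4 * η))
        ≤ R * (2 * η * D + (δ * (4 * D + 4 * M ^ 2 * N) + Cδ * N) / (4 * η)) := by gcongr
    have e3 : R * (2 * η * D + (δ * (4 * D + 4 * M ^ 2 * N) + Cδ * N) / (4 * η))
        = 2 * R * η * D + R * δ / η * D + R * (4 * δ * M ^ 2 + Cδ) / (4 * η) * N := by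
      field_simp
      ring
    have f1 : (M + 2 * R) * η ≤ c₀ / 8 := by
      rw [hηdef, mul_div_assoc', div_le_div_iff₀ (by positivity) (by norm_num)]
      linarith
    have f2 : A * s ≤ c₀ / 8 := by
      rw [hsdef, mul_div_assoc', div_le_div_iff₀ (by positivity) (by norm_num)]
      linarith
    have f3 : R * δ / η ≤ c₀ / 8 := by
      have h1 : R * δ / η = R * c₀ / (8 * (R + 1)) := by
        rw [hδdef]
        clear_value η
        field_simp
      rw [h1, div_le_div_iff₀ (by positivity) (by norm_num)]
      linarith
    have g1 := mul_le_mul_of_nonneg_right f1 hD0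
    have g2 := mul_le_mul_of_nonneg_right f2 hD0
    have g3 := mul_le_mul_of_nonneg_right f3 hD0
    have g4 : C₁ * N ≤ max C₁ C₂ * N := by gcongr; exact le_max_left _ _
    have g5 : C₁ * N = M / (4 * η) * N + (2 * Real.pi) ^ 2 * A / (4 * s) * N
      + R * (4 * δ * M ^ 2 + Cδ) / (4 * η) * N := by simp only [C₁]; ring
    have g6 : M * (η * D + N / (4 * η)) = M * η * D + M / (4 * η) * N := by ring
    have g7 : 0 ≤ c₀ * D := by positivity
    rw [g6] at hcut
    rw [e1]
    rw [e3] at e2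
    linarith

end LocalizedCoercivity

/-! ### Poincaré and Sobolev inequalities, and bounds for the form. -/

section Bounds
open Filter Topology ComplexConjugate

variable {β θ μ : ℝ} {u v φ : ℝ → ℝ}

/-- The Cauchy-Schwarz inequality for integrals of real functions. -/
lemma sq_integral_mul_le {α : Type*} [MeasurableSpace α] {m : Measure α} {f g : α → ℝ}
    (hf : Integrable (fun x => f x ^ 2) m) (hg : Integrable (fun x => g x ^ 2) m)
    (hfg : Integrable (fun x => f x * g x) m) :
    (∫ x, f x * g x ∂m) ^ 2 ≤ (∫ x, f x ^ 2 ∂m) * ∫ x, g x ^ 2 ∂m := by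
  have h : ∀ t : ℝ, 0 ≤ (∫ x, g x ^ 2 ∂m) * (t * t) + (2 * ∫ x, f x * g x ∂m) * t + ∫ x, f x ^ 2 ∂m := by
    intro t
    have i₁ : Integrable (fun x => (t * t) * g x ^ 2) m := hg.const_mul _
    have i₂ : Integrable (fun x => (2 * t) * (f x * g x)) m := hfg.const_mul _
    have h0 : 0 ≤ ∫ x, (f x + t * g x) ^ 2 ∂m := integral_nonneg fun x => sq_nonneg _
    have h1 : ∫ x, (f x + t * g x) ^ 2 ∂m
        = ∫ x, (((t * t) * g x ^ 2 + (2 * t) * (f x * g x)) + f x ^ 2) ∂m :=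
      integral_congr_ae (.of_forall fun x => by dsimp only; ring)
    have i₁₂ : Integrable (fun x => (t * t) * g x ^ 2 + (2 * t) * (f x * g x)) m := i₁.add i₂
    rw [h1, integral_add i₁₂ hf, integral_add i₁ i₂, integral_const_mul, integral_const_mul] at h0
    linarith
  have := discrim_le_zero h
  rw [discrim] at this
  nlinarith

/-- The squared `H^μ` seminorm of a test function. -/
def seminormSq (μ : ℝ) (φ : ℝ → ℝ) : ℝ := ∫ ξ, |2 * Real.pi * ξ| ^ (2 * μ) * ‖hat φ ξ‖ ^ 2

lemma integrable_seminormSq (hφ : IsCS φ) (hμ : 0 ≤ μ) :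
    Integrable fun ξ : ℝ => |2 * Real.pi * ξ| ^ (2 * μ) * ‖hat φ ξ‖ ^ 2 := by
  simpa [sq] using integrable_abs_rpow_mul_hat_mul_hat hφ hφ (a := 2 * μ) (by linarith)

lemma seminormSq_nonneg (μ : ℝ) (φ : ℝ → ℝ) : 0 ≤ seminormSq μ φ :=
  integral_nonneg fun ξ => by positivity

lemma seminormSq_one (hφ : IsCS φ) : seminormSq 1 φ = ∫ x, deriv φ x ^ 2 := by
  rw [← integral_sq_mul_norm_hat_sq hφ, seminormSq]
  refine integral_congr_ae (.of_forall fun ξ => ?_)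
  dsimp only
  rw [mul_one, Real.rpow_two, sq_abs]

lemma IsTest.eq_zero_of_notMem (hv : IsTest v) {x : ℝ} (hx : x ∉ Ioo (0 : ℝ) 1) : v x = 0 :=
  image_eq_zero_of_notMem_tsupport fun h => hx (hv.2.2 h)

lemma IsTest.deriv (hv : IsTest v) : IsTest (deriv v) :=
  ⟨hv.isCS.deriv.1, hv.isCS.deriv.2, (tsupport_deriv_subset).trans hv.2.2⟩

lemma IsTest.setIntegral_eq (hv : IsTest v) : ∫ x in Ioo (0 : ℝ) 1, v x = ∫ x, v x :=
  setIntegral_eq_integral_of_forall_compl_eq_zero fun _ hx => hv.eq_zero_of_notMem hx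

lemma IsTest.mul_setIntegral_eq (hv : IsTest v) (f : ℝ → ℝ) :
    ∫ x in Ioo (0 : ℝ) 1, f x * v x = ∫ x, f x * v x :=
  setIntegral_eq_integral_of_forall_compl_eq_zero fun _ hx => by rw [hv.eq_zero_of_notMem hx, mul_zero]

lemma IsTest.sq_setIntegral_eq (hv : IsTest v) :
    ∫ x in Ioo (0 : ℝ) 1, v x ^ 2 = ∫ x, v x ^ 2 :=
  setIntegral_eq_integral_of_forall_compl_eq_zero fun _ hx => by rw [hv.eq_zero_of_notMem hx]; norm_num

/-- The L¹ norm is at most the L² norm because the function lives on an interval of length one. -/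
lemma IsTest.norm_hat_sq_le (hv : IsTest v) (ξ : ℝ) : ‖hat v ξ‖ ^ 2 ≤ ∫ x, v x ^ 2 := by
  have h0 : (∫ x, |v x|) = ∫ x in Ioo (0 : ℝ) 1, |v x| * 1 := by
    simp only [mul_one]
    exact (setIntegral_eq_integral_of_forall_compl_eq_zero fun _ hx => by
      rw [hv.eq_zero_of_notMem hx, abs_zero]).symm
  have h1 := sq_integral_mul_le (m := vol01) (f := fun x => |v x|) (g := fun _ => (1 : ℝ))
    (by simp only [sq_abs]; exact hv.isCS.integrable_sq.integrableOn) (by simp)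
    (by simp only [mul_one]; exact hv.isCS.integrable.abs.integrableOn)
  have h2 := norm_hat_le v ξ
  calc ‖hat v ξ‖ ^ 2 ≤ (∫ x, |v x|) ^ 2 := by gcongr
    _ ≤ _ := by
      rw [h0]
      refine h1.trans ?_
      simp only [sq_abs, one_pow]
      rw [hv.sq_setIntegral_eq]
      simp

/-- A Poincaré inequality for fractional seminorms. -/
lemma exists_poincare (hμ : 0 < μ) :
    ∃ C, 0 < C ∧ ∀ v, IsTest v → (∫ x, v x ^ 2) ≤ C * seminormSq μ v := by
  -- For |ξ| ≥ 1/4 one has |2πξ| ≥ π/2, so the seminorm controls the high frequencies. The band |ξ|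
  -- ≤ 1/4 has length 1/2 and the transform is bounded there by the L² norm, so it contributes at
  -- most half of N and is absorbed.
  have hb : 0 < (Real.pi / 2) ^ (2 * μ) := by positivity
  refine ⟨2 / (Real.pi / 2) ^ (2 * μ), by positivity, fun v hv => ?_⟩
  set N := ∫ x, v x ^ 2 with hN
  have hN0 : 0 ≤ N := integral_nonneg fun x => sq_nonneg _
  have hi1 : Integrable ((Icc (-(1 / 4) : ℝ) (1 / 4)).indicator fun _ => N) :=
    (integrable_indicator_iff measurableSet_Icc).2 (by simp)
  have hi2 := (integrable_seminormSq hv.isCS hμ.le).div_const ((Real.pi / 2) ^ (2 * μ))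
  have key : ∫ ξ, ‖hat v ξ‖ ^ 2 ≤ ∫ ξ, ((Icc (-(1 / 4) : ℝ) (1 / 4)).indicator (fun _ => N) ξ
      + |2 * Real.pi * ξ| ^ (2 * μ) * ‖hat v ξ‖ ^ 2 / (Real.pi / 2) ^ (2 * μ)) := by
    refine integral_mono (integrable_norm_hat_sq hv.isCS) (hi1.add hi2) fun ξ => ?_
    dsimp only
    have h0 : 0 ≤ |2 * Real.pi * ξ| ^ (2 * μ) * ‖hat v ξ‖ ^ 2 / (Real.pi / 2) ^ (2 * μ) := by positivity
    by_cases hξ : ξ ∈ Icc (-(1 / 4) : ℝ) (1 / 4)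
    · rw [indicator_of_mem hξ]
      linarith [hv.norm_hat_sq_le ξ]
    · rw [indicator_of_notMem hξ, zero_add, le_div_iff₀ hb, mul_comm]
      have h1 : 1 / 4 ≤ |ξ| := by
        by_contra hlt
        exact hξ (abs_le.1 (not_le.1 hlt).le)
      gcongr
      rw [abs_mul, abs_of_pos (by positivity : 0 < 2 * Real.pi)]
      nlinarith [Real.pi_pos]
  rw [integral_norm_hat_sq hv.isCS, integral_add hi1 hi2, integral_div,
    integral_indicator measurableSet_Icc] at key
  have h3 : ∫ _ in Icc (-(1 / 4) : ℝ) (1 / 4), N = N / 2 := by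
    simp
    ring
  rw [h3] at key
  change N ≤ N / 2 + seminormSq μ v / _ at key
  have h4 : seminormSq μ v / (Real.pi / 2) ^ (2 * μ) * 2 = 2 / (Real.pi / 2) ^ (2 * μ) * seminormSq μ v := by ring
  linarith

/-- The left and right symbols are complex conjugates, so the real part of their convex combination
does not depend on θ. -/
lemma fracForm_self (hβ1 : β < 1) (hθ : 0 ≤ θ) (hθ' : θ ≤ 1) (hv : IsCS v) :
    fracForm β θ v v = Real.cos (Real.pi * β / 2) * seminormSq (1 - β / 2) v := by
  have h := integral_re (integrable_fracForm hβ1 hθ hθ' hv hv)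
  have h' : fracForm β θ v v = _ := h.symm
  rw [h', seminormSq, ← integral_const_mul]
  refine integral_congr_ae ?_
  filter_upwards [ae_ne_zero] with ξ hξ
  have hcos : Real.cos (Real.pi * β / 2 * Real.sign ξ) = Real.cos (Real.pi * β / 2) := by
    rcases lt_or_gt_of_ne hξ with h | h
    · rw [Real.sign_of_neg h, mul_neg_one, Real.cos_neg]
    · rw [Real.sign_of_pos h, mul_one]
  have hph : (phase β ξ).re = Real.cos (Real.pi * β / 2) := by
    rw [phase, Complex.exp_ofReal_mul_I_re, hcos]
  have hs : (twoSidedSymbol β θ ξ).re = |2 * Real.pi * ξ| ^ (-β) * Real.cos (Real.pi * β / 2) := by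
    rw [twoSidedSymbol, fracSymbol]
    simp only [map_mul, Complex.conj_conj, Complex.conj_ofReal]
    rw [← Complex.ofReal_one, ← Complex.ofReal_sub, Complex.add_re, Complex.re_ofReal_mul, Complex.re_ofReal_mul,
      Complex.re_ofReal_mul, Complex.re_ofReal_mul, Complex.conj_re, hph]
    ring
  rw [RCLike.re_eq_complex_re, Complex.re_ofReal_mul, Complex.mul_conj, Complex.normSq_eq_norm_sq,
    Complex.re_mul_ofReal, hs, show 2 * (1 - β / 2) = 2 - β by ring, ← sq_mul_abs_rpow_neg (two_pi_mul_ne_zero hξ)]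
  ring

lemma exists_fracForm_self_lower_bound (hβ : 0 < β) (hβ1 : β < 1) :
    ∃ c, 0 < c ∧ ∀ θ, 0 ≤ θ → θ ≤ 1 → ∀ v, IsTest v → c * (∫ x, v x ^ 2) ≤ fracForm β θ v v := by
  obtain ⟨C, hC, h⟩ := exists_poincare (μ := 1 - β / 2) (by linarith)
  have hcos : 0 < Real.cos (Real.pi * β / 2) :=
    Real.cos_pos_of_mem_Ioo ⟨by nlinarith [Real.pi_pos], by nlinarith [Real.pi_pos]⟩
  refine ⟨Real.cos (Real.pi * β / 2) / C, by positivity, fun θ hθ hθ' v hv => ?_⟩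
  rw [fracForm_self hβ1 hθ hθ' hv.isCS, div_mul_eq_mul_div, div_le_iff₀ hC, mul_assoc]
  exact mul_le_mul_of_nonneg_left (by rw [mul_comm]; exact h v hv) hcos.le

/-- Boundedness of the form on `H^{1-β} × H¹`. -/
lemma fracForm_sq_le (hβ : 0 < β) (hβ1 : β < 1) (hθ : 0 ≤ θ) (hθ' : θ ≤ 1) (hu : IsCS u) (hv : IsCS v) :
    fracForm β θ u v ^ 2 ≤ seminormSq (1 - β) u * ∫ x, deriv v x ^ 2 := by
  rw [← seminormSq_one hv]
  have e : ∀ (μ : ℝ) (f : ℝ → ℝ) (ξ : ℝ), (|2 * Real.pi * ξ| ^ μ * ‖hat f ξ‖) ^ 2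
      = |2 * Real.pi * ξ| ^ (2 * μ) * ‖hat f ξ‖ ^ 2 := by
    intro μ f ξ
    rw [mul_pow, ← Real.rpow_natCast (|_| ^ μ), ← Real.rpow_mul (abs_nonneg _), mul_comm μ]
    rfl
  have hf : Integrable fun ξ : ℝ => (|2 * Real.pi * ξ| ^ (1 - β) * ‖hat u ξ‖) ^ 2 := by
    simpa only [e] using integrable_seminormSq hu (by linarith : 0 ≤ 1 - β)
  have hg : Integrable fun ξ : ℝ => (|2 * Real.pi * ξ| ^ (1 : ℝ) * ‖hat v ξ‖) ^ 2 := by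
    simpa only [e] using integrable_seminormSq hv zero_le_one
  -- The weight |ω|^{2-β} is distributed as |ω|^{1-β} on u and |ω| on v before Cauchy-Schwarz.
  have e2 : ∀ᵐ ξ : ℝ, |2 * Real.pi * ξ| ^ (2 - β) * (‖hat u ξ‖ * ‖hat v ξ‖)
      = |2 * Real.pi * ξ| ^ (1 - β) * ‖hat u ξ‖ * (|2 * Real.pi * ξ| ^ (1 : ℝ) * ‖hat v ξ‖) := by
    filter_upwards [ae_ne_zero] with ξ hξ
    rw [show (2 - β) = (1 - β) + 1 by ring, Real.rpow_add (abs_pos.2 (two_pi_mul_ne_zero hξ))]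
    ring
  have hi := integrable_abs_rpow_mul_hat_mul_hat hu hv (a := 2 - β) (by linarith)
  have hcs := sq_integral_mul_le hf hg (hi.congr e2)
  simp only [e] at hcs
  rw [← integral_congr_ae e2] at hcs
  refine le_trans (sq_le_sq' ?_ ?_) hcs
  all_goals
    have habs : |fracForm β θ u v| ≤ ∫ ξ : ℝ, |2 * Real.pi * ξ| ^ (2 - β) * (‖hat u ξ‖ * ‖hat v ξ‖) := by
      refine (Complex.abs_re_le_norm _).trans (norm_integral_le_of_norm_le hi ?_)
      filter_upwards [ae_ne_zero] with ξ hξ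
      rw [norm_mul, norm_mul, norm_mul, RCLike.norm_conj, Complex.norm_real, Real.norm_of_nonneg (sq_nonneg _),
        ← sq_mul_abs_rpow_neg (two_pi_mul_ne_zero hξ), mul_assoc (_ ^ 2)]
      exact mul_le_mul_of_nonneg_left (mul_le_mul_of_nonneg_right (norm_twoSidedSymbol_le hθ hθ' ξ)
        (by positivity)) (sq_nonneg _)
    first
    | exact (abs_le.1 habs).1
    | exact (abs_le.1 habs).2

lemma abs_le_integral_norm_hat (hφ : IsCS φ) (x : ℝ) : |φ x| ≤ ∫ ξ, ‖hat φ ξ‖ := by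
  have h1 : (φ x : ℂ) = (𝓕⁻ (𝓕 hφ.sch)) x := by
    rw [FourierTransform.fourierInv_fourier_eq]; rfl
  have h2 : |φ x| = ‖(φ x : ℂ)‖ := by rw [Complex.norm_real, Real.norm_eq_abs]
  rw [h2, h1, SchwartzMap.fourierInv_coe, Real.fourierInv_eq']
  refine (norm_integral_le_integral_norm _).trans (le_of_eq (integral_congr_ae (.of_forall fun ξ => ?_)))
  simp only [norm_smul, ← hat_eq_fourier_sch hφ]
  rw [show ((2 * Real.pi * inner ℝ ξ x : ℝ) : ℂ) = ((2 * Real.pi * inner ℝ ξ x : ℝ) : ℂ) from rfl,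
    Complex.norm_exp_ofReal_mul_I, one_mul]

/-- The Sobolev embedding into bounded functions, for `μ > 1/2`. -/
lemma exists_sup_bound (hμ : 1 / 2 < μ) :
    ∃ C, 0 < C ∧ ∀ v, IsTest v → ∀ x, v x ^ 2 ≤ C * seminormSq μ v := by
  obtain ⟨P, hP, hpo⟩ := exists_poincare (μ := μ) (by linarith)
  -- Cauchy-Schwarz against the weight (1+|ξ|)^{-μ}, which is square integrable exactly because 2μ >
  -- 1; the sup norm is bounded by the L¹ norm of the transform.
  set K : ℝ := ∫ ξ : ℝ, ((1 + ‖ξ‖) ^ (-μ)) ^ 2 with hK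
  have hK0 : 0 ≤ K := integral_nonneg fun ξ => sq_nonneg _
  have hKi : Integrable fun ξ : ℝ => ((1 + ‖ξ‖) ^ (-μ)) ^ 2 := by
    have := integrable_one_add_norm (E := ℝ) (μ := volume) (r := 2 * μ) (by simp; linarith)
    refine this.congr (.of_forall fun ξ => ?_)
    dsimp only
    rw [← Real.rpow_natCast, ← Real.rpow_mul (by positivity)]
    congr 1
    push_cast
    ring
  have hM : 0 < (2 : ℝ) ^ (2 * μ) := by positivity
  refine ⟨(K + 1) * ((2 : ℝ) ^ (2 * μ) * (P + 1)), by positivity, fun v hv x => ?_⟩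
  have hcs := hv.isCS
  set S := seminormSq μ v with hS
  have hS0 : 0 ≤ S := seminormSq_nonneg _ _
  have hpt : ∀ ξ : ℝ, ((1 + ‖ξ‖) ^ μ * ‖hat v ξ‖) ^ 2
      ≤ 2 ^ (2 * μ) * (‖hat v ξ‖ ^ 2 + |2 * Real.pi * ξ| ^ (2 * μ) * ‖hat v ξ‖ ^ 2) := by
    intro ξ
    have h1 : (1 + ‖ξ‖) ^ (2 * μ) ≤ 2 ^ (2 * μ) * (1 + |2 * Real.pi * ξ| ^ (2 * μ)) := by
      have h2 : ‖ξ‖ ≤ |2 * Real.pi * ξ| := by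
        rw [abs_mul, abs_of_pos (by positivity : 0 < 2 * Real.pi), Real.norm_eq_abs]
        nlinarith [Real.pi_gt_three, abs_nonneg ξ]
      have h3 : 1 + ‖ξ‖ ≤ 2 * max 1 |2 * Real.pi * ξ| := by
        have := le_max_left 1 |2 * Real.pi * ξ|
        have := le_max_right 1 |2 * Real.pi * ξ|
        linarith
      calc (1 + ‖ξ‖) ^ (2 * μ) ≤ (2 * max 1 |2 * Real.pi * ξ|) ^ (2 * μ) :=
            Real.rpow_le_rpow (by positivity) h3 (by linarith)
        _ = 2 ^ (2 * μ) * (max 1 |2 * Real.pi * ξ|) ^ (2 * μ) := Real.mul_rpow (by norm_num) (by positivity)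
        _ ≤ _ := by
          gcongr
          rcases le_total 1 |2 * Real.pi * ξ| with h | h
          · rw [max_eq_right h]; linarith
          · rw [max_eq_left h, Real.one_rpow]
            have : 0 ≤ |2 * Real.pi * ξ| ^ (2 * μ) := by positivity
            linarith
    rw [mul_pow, ← Real.rpow_natCast ((1 + ‖ξ‖) ^ μ), ← Real.rpow_mul (by positivity),
      show μ * ((2 : ℕ) : ℝ) = 2 * μ by push_cast; ring]
    nlinarith [mul_le_mul_of_nonneg_right h1 (sq_nonneg ‖hat v ξ‖)]
  have hR : Integrable fun ξ : ℝ => 2 ^ (2 * μ) * (‖hat v ξ‖ ^ 2 + |2 * Real.pi * ξ| ^ (2 * μ) * ‖hat v ξ‖ ^ 2) :=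
    ((integrable_norm_hat_sq hcs).add (integrable_seminormSq hcs (by linarith))).const_mul _
  have hmeas : Measurable fun ξ : ℝ => (1 + ‖ξ‖) ^ μ * ‖hat v ξ‖ :=
    (by fun_prop : Measurable fun ξ : ℝ => (1 + ‖ξ‖) ^ μ).mul (continuous_hat hcs.integrable).norm.measurable
  have hQi : Integrable fun ξ : ℝ => ((1 + ‖ξ‖) ^ μ * ‖hat v ξ‖) ^ 2 := by
    refine hR.mono' (hmeas.pow_const 2).aestronglyMeasurable (.of_forall fun ξ => ?_)
    rw [Real.norm_of_nonneg (sq_nonneg _)]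
    exact hpt ξ
  have hprod : ∀ ξ : ℝ, (1 + ‖ξ‖) ^ (-μ) * ((1 + ‖ξ‖) ^ μ * ‖hat v ξ‖) = ‖hat v ξ‖ := by
    intro ξ
    rw [← mul_assoc, ← Real.rpow_add (by positivity)]
    simp
  have hV1 : Integrable fun ξ : ℝ => ‖hat v ξ‖ := by
    simpa using integrable_rpow_mul_hat hcs (a := 0) (by norm_num)
  have hCS := sq_integral_mul_le hKi hQi (by simpa only [hprod] using hV1)
  simp only [hprod] at hCS
  have hQ : ∫ ξ : ℝ, ((1 + ‖ξ‖) ^ μ * ‖hat v ξ‖) ^ 2 ≤ 2 ^ (2 * μ) * ((P + 1) * S) := by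
    refine (integral_mono hQi hR hpt).trans ?_
    rw [integral_const_mul, integral_add (integrable_norm_hat_sq hcs) (integrable_seminormSq hcs (by linarith)),
      integral_norm_hat_sq hcs]
    refine mul_le_mul_of_nonneg_left ?_ hM.le
    have := hpo v hv
    change _ + S ≤ _
    linarith
  calc v x ^ 2 = |v x| ^ 2 := (sq_abs _).symm
    _ ≤ (∫ ξ, ‖hat v ξ‖) ^ 2 := by gcongr; exact abs_le_integral_norm_hat hcs x
    _ ≤ K * (2 ^ (2 * μ) * ((P + 1) * S)) := hCS.trans (by gcongr)
    _ ≤ (K + 1) * (2 ^ (2 * μ) * ((P + 1) * S)) := by gcongr; linarith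
    _ = _ := by ring

end Bounds

/-! ### The convolution kernel of I^β_θ and its link with the Fourier form. -/

section Kernel
open Filter Topology ComplexConjugate

variable {β θ : ℝ} {u v w φ f g : ℝ → ℝ}

lemma locallyIntegrable_abs_rpow {a : ℝ} (ha : -1 < a) (ha' : a ≤ 0) :
    LocallyIntegrable fun t : ℝ => |t| ^ a := by
  have h1 : LocallyIntegrable fun t : ℝ => (Icc (-1 : ℝ) 1).indicator (fun t => |t| ^ a) t + 1 :=
    ((integrable_indicator_iff measurableSet_Icc).2 (integrableOn_abs_rpow ha)).locallyIntegrable.add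
      (locallyIntegrable_const 1)
  refine h1.mono (by fun_prop : Measurable fun t : ℝ => |t| ^ a).aestronglyMeasurable (.of_forall fun t => ?_)
  have h0 : 0 ≤ |t| ^ a := by positivity
  by_cases ht : t ∈ Icc (-1 : ℝ) 1
  · rw [indicator_of_mem ht, Real.norm_of_nonneg h0, Real.norm_of_nonneg (by positivity)]
    linarith
  · rw [indicator_of_notMem ht, zero_add, Real.norm_of_nonneg h0, norm_one]
    refine Real.rpow_le_one_of_one_le_of_nonpos ?_ ha'
    by_contra! h
    exact ht (abs_le.1 h.le)

/-- The convolution kernel of the two-sided fractional integral. -/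
def kernel (β θ t : ℝ) : ℝ := (if 0 < t then θ else 1 - θ) * |t| ^ (β - 1) / Real.Gamma β

lemma measurable_kernel (β θ : ℝ) : Measurable (kernel β θ) := by
  unfold kernel
  exact ((Measurable.ite measurableSet_Ioi measurable_const measurable_const).mul (by fun_prop)).div_const _

lemma abs_kernel_le (hβ : 0 < β) (hθ : 0 ≤ θ) (hθ' : θ ≤ 1) (t : ℝ) :
    |kernel β θ t| ≤ |t| ^ (β - 1) / Real.Gamma β := by
  have hΓ := Real.Gamma_pos_of_pos hβ
  have h0 : 0 ≤ |t| ^ (β - 1) := by positivity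
  rw [kernel, abs_div, abs_mul, abs_of_pos hΓ, abs_of_nonneg h0]
  gcongr
  refine mul_le_of_le_one_left h0 ?_
  split_ifs <;> rw [abs_le] <;> constructor <;> linarith

lemma locallyIntegrable_kernel (hβ : 0 < β) (hβ1 : β < 1) (hθ : 0 ≤ θ) (hθ' : θ ≤ 1) :
    LocallyIntegrable (kernel β θ) := by
  have h := (locallyIntegrable_abs_rpow (a := β - 1) (by linarith) (by linarith)).smul (1 / Real.Gamma β)
  refine h.mono (measurable_kernel β θ).aestronglyMeasurable (.of_forall fun t => ?_)
  refine (abs_kernel_le hβ hθ hθ' t).trans (le_trans (le_of_eq ?_) (le_abs_self _))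
  simp only [Pi.smul_apply, smul_eq_mul]
  ring

lemma hasDerivAt_conv (hκ : LocallyIntegrable f) (hφ : IsCS φ) (x : ℝ) :
    HasDerivAt (conv f φ) (conv f (deriv φ) x) x :=
  hφ.compact.hasDerivAt_convolution_right (ContinuousLinearMap.mul ℝ ℝ) hκ (hφ.smooth.of_le (by simp)) x

lemma continuous_conv (hκ : LocallyIntegrable f) (hφ : IsCS φ) : Continuous (conv f φ) :=
  hφ.compact.continuous_convolution_right (ContinuousLinearMap.mul ℝ ℝ) hκ hφ.continuous

lemma corr_neg (f g : ℝ → ℝ) (t : ℝ) : corr f g (-t) = corr g f t := by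
  rw [corr, corr, ← integral_sub_right_eq_self _ t]
  refine integral_congr_ae (.of_forall fun x => ?_)
  dsimp only
  rw [sub_neg_eq_add, sub_add_cancel, mul_comm]

lemma integral_conv_mul {k : ℝ → ℝ} (hk : LocallyIntegrable k) (hf : IsCS f) (hg : IsCS g) :
    Integrable (fun t => k t * corr f g t) ∧ ∫ x, conv k f x * g x = ∫ t, k t * corr f g t := by
  obtain ⟨R, hR, hfR⟩ := hf.exists_support_bound
  obtain ⟨S, hS, hgS⟩ := hg.exists_support_bound
  obtain ⟨C, hC, hCf⟩ := hf.bounded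
  -- Only |t| ≤ R + S matters, by the supports of f and g. Cutting the kernel off there makes it
  -- integrable and justifies Fubini.
  set k' : ℝ → ℝ := (Icc (-(R + S)) (R + S)).indicator k with hk'
  have hk'i : Integrable k' :=
    (integrable_indicator_iff measurableSet_Icc).2 (hk.integrableOn_isCompact isCompact_Icc)
  have heq : ∀ x t, k' t * f (x - t) * g x = k t * f (x - t) * g x := by
    intro x t
    by_cases ht : t ∈ Icc (-(R + S)) (R + S)
    · rw [hk', indicator_of_mem ht]
    · by_cases hx : S < |x|
      · rw [hgS x hx, mul_zero, mul_zero]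
      · rw [hfR (x - t), mul_zero, mul_zero]
        by_contra! h
        refine ht (abs_le.1 ?_)
        have := abs_sub_abs_le_abs_sub t x
        rw [abs_sub_comm] at this
        linarith
  have hI : Integrable (Function.uncurry fun t x => k t * (f (x - t) * g x)) (volume.prod volume) := by
    have h1 := (hk'i.norm.const_mul C).mul_prod hg.integrable
    have h2 : (Function.uncurry fun t x => k t * (f (x - t) * g x))
        = fun p : ℝ × ℝ => k' p.1 * f (p.2 - p.1) * g p.2 := by
      ext ⟨t, x⟩
      rw [heq, mul_assoc]
      rfl
    rw [h2]
    refine h1.mono ?_ (.of_forall fun p => ?_)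
    · exact (hk'i.aestronglyMeasurable.comp_fst.mul
        (hf.continuous.comp (by fun_prop)).aestronglyMeasurable).mul hg.integrable.aestronglyMeasurable.comp_snd
    · rw [norm_mul, norm_mul, norm_mul, norm_mul, norm_norm, mul_comm ‖k' p.1‖, Real.norm_of_nonneg hC]
      gcongr
      exact hCf _
  have h1 : ∀ x, conv k f x * g x = ∫ t, k t * (f (x - t) * g x) := by
    intro x
    rw [conv, ← integral_mul_const]
    simp only [mul_assoc]
  have h2 : ∀ t, k t * corr f g t = ∫ x, k t * (f (x - t) * g x) := by
    intro t
    rw [corr, integral_const_mul]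
  simp only [h1, h2]
  exact ⟨hI.integral_prod_left, (integral_integral_swap hI).symm⟩

/-- Split at t = 0 and reflect the negative half-line: reflection exchanges the two functions in the
correlation, so the right-sided integral becomes a left-sided one with the roles swapped. -/
lemma integral_kernel_mul_corr (hβ : 0 < β)
    (hi : Integrable fun t => kernel β θ t * corr f g t) :
    Real.Gamma β * ∫ t, kernel β θ t * corr f g t
      = θ * (∫ t in Ioi (0 : ℝ), t ^ (β - 1) * corr f g t)
        + (1 - θ) * ∫ t in Ioi (0 : ℝ), t ^ (β - 1) * corr g f t := by
  have hΓ := (Real.Gamma_pos_of_pos hβ).ne'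
  rw [← intervalIntegral.integral_Iic_add_Ioi (b := (0 : ℝ)) hi.integrableOn hi.integrableOn]
  have h1 : ∫ t in Ioi (0 : ℝ), kernel β θ t * corr f g t
      = θ / Real.Gamma β * ∫ t in Ioi (0 : ℝ), t ^ (β - 1) * corr f g t := by
    rw [← integral_const_mul]
    refine setIntegral_congr_fun measurableSet_Ioi fun t ht => ?_
    simp only [kernel, if_pos (mem_Ioi.1 ht), abs_of_pos (mem_Ioi.1 ht)]
    ring
  have h2 : ∫ t in Iic (0 : ℝ), kernel β θ t * corr f g t
      = (1 - θ) / Real.Gamma β * ∫ t in Ioi (0 : ℝ), t ^ (β - 1) * corr g f t := by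
    have := integral_comp_neg_Ioi (0 : ℝ) fun t => kernel β θ t * corr f g t
    rw [neg_zero] at this
    rw [← this, ← integral_const_mul]
    refine setIntegral_congr_fun measurableSet_Ioi fun t ht => ?_
    have ht' := mem_Ioi.1 ht
    simp only [kernel, if_neg (show ¬ (0 : ℝ) < -t by linarith), abs_neg, abs_of_pos ht', corr_neg]
    ring
  rw [h1, h2]
  field_simp
  ring

/-- The Fourier representation of the bilinear form of the two-sided fractional derivative. -/
lemma integral_conv_kernel_mul (hβ : 0 < β) (hβ1 : β < 1) (hθ : 0 ≤ θ) (hθ' : θ ≤ 1)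
    (hu : IsCS u) (hv : IsCS v) :
    ∫ x, conv (kernel β θ) (deriv u) x * deriv v x = fracForm β θ u v := by
  have hΓ := (Real.Gamma_pos_of_pos hβ).ne'
  obtain ⟨hi, he⟩ := integral_conv_mul (locallyIntegrable_kernel hβ hβ1 hθ hθ') hu.deriv hv.deriv
  have hk := integral_kernel_mul_corr hβ hi
  have h1 := integral_rpow_mul_corr hβ hβ1 hu.deriv hv.deriv
  have h2 := integral_rpow_mul_corr hβ hβ1 hv.deriv hu.deriv
  have h3 : ∀ (a b : ℝ → ℝ) (ha : IsCS a) (hb : IsCS b) (ξ : ℝ),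
      hat (deriv a) ξ * conj (hat (deriv b) ξ) = (((2 * Real.pi * ξ) ^ 2 : ℝ) : ℂ) * (hat a ξ * conj (hat b ξ)) := by
    intro a b ha hb ξ
    rw [hat_deriv ha, hat_deriv hb]
    simp only [map_mul, Complex.conj_I, Complex.conj_ofReal, map_ofNat]
    push_cast
    linear_combination (-(4 * Real.pi ^ 2 * ξ ^ 2 * hat a ξ * conj (hat b ξ)) : ℂ) * Complex.I_sq
  set A : ℂ := ∫ ξ, fracSymbol β ξ * (hat (deriv u) ξ * conj (hat (deriv v) ξ)) with hA
  set B : ℂ := ∫ ξ, fracSymbol β ξ * (hat (deriv v) ξ * conj (hat (deriv u) ξ)) with hB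
  have hBc : conj B = ∫ ξ, conj (fracSymbol β ξ) * (hat (deriv u) ξ * conj (hat (deriv v) ξ)) := by
    rw [hB, ← integral_conj]
    refine integral_congr_ae (.of_forall fun ξ => ?_)
    simp only [map_mul, Complex.conj_conj]
    ring
  -- The left and right halves of the symbol are the cases θ = 1 and θ = 0, which yields their
  -- separate integrability.
  have i₁ := integrable_fracForm (θ := 1) hβ1 zero_le_one le_rfl hu hv
  have i₀ := integrable_fracForm (θ := 0) hβ1 le_rfl zero_le_one hu hv
  have hform : fracForm β θ u v = θ * A.re + (1 - θ) * B.re := by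
    have e : (∫ ξ, (((2 * Real.pi * ξ) ^ 2 : ℝ) : ℂ) * (twoSidedSymbol β θ ξ * (hat u ξ * conj (hat v ξ))))
        = θ * A + (1 - θ) * conj B := by
      rw [hBc, hA, ← integral_const_mul, ← integral_const_mul, ← integral_add]
      · refine integral_congr_ae (.of_forall fun ξ => ?_)
        simp only [h3 u v hu hv, twoSidedSymbol]
        ring
      · refine (i₁.const_mul (θ : ℂ)).congr (.of_forall fun ξ => ?_)
        simp only [h3 u v hu hv, twoSidedSymbol]
        push_cast; ring
      · refine (i₀.const_mul (1 - θ : ℂ)).congr (.of_forall fun ξ => ?_)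
        simp only [h3 u v hu hv, twoSidedSymbol]
        push_cast; ring
    rw [fracForm, e]
    simp
  have r1 := congrArg Complex.re h1
  have r2 := congrArg Complex.re h2
  rw [Complex.ofReal_re, Complex.re_ofReal_mul] at r1 r2
  rw [r1, r2] at hk
  rw [he, hform]
  refine mul_left_cancel₀ hΓ ?_
  rw [hk]
  ring

lemma leftInt_eq {x : ℝ} (hx : x ∈ Icc (0 : ℝ) 1) (w : ℝ → ℝ) :
    leftInt β w x = ∫ s in Ioo (0 : ℝ) x, kernel β 1 (x - s) * w s := by
  rw [leftInt, intervalIntegral.integral_of_le hx.1, integral_Ioc_eq_integral_Ioo, ← integral_const_mul]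
  refine setIntegral_congr_fun measurableSet_Ioo fun s hs => ?_
  have h : 0 < x - s := by linarith [hs.2]
  simp only [kernel, if_pos h, abs_of_pos h]
  rw [show β - 1 = -(1 - β) by ring, Real.rpow_neg h.le]
  ring

lemma rightInt_eq {x : ℝ} (hx : x ∈ Icc (0 : ℝ) 1) (w : ℝ → ℝ) :
    rightInt β w x = ∫ s in Ioo x (1 : ℝ), kernel β 0 (x - s) * w s := by
  rw [rightInt, intervalIntegral.integral_of_le hx.2, integral_Ioc_eq_integral_Ioo, ← integral_const_mul]
  refine setIntegral_congr_fun measurableSet_Ioo fun s hs => ?_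
  have h : 0 < s - x := by linarith [hs.1]
  have h' : ¬ 0 < x - s := by linarith
  simp only [kernel, if_neg h', abs_sub_comm x s, abs_of_pos h]
  rw [show β - 1 = -(1 - β) by ring, Real.rpow_neg h.le]
  ring

/-- Removing the null point s = x splits (0,1) into the ranges of the left and the right integral,
where the kernel carries the weights θ and 1-θ. -/
lemma twoSidedInt_eq {x : ℝ} (hx : x ∈ Icc (0 : ℝ) 1)
    (hw : IntegrableOn (fun s => kernel β θ (x - s) * w s) (Ioo 0 1)) :
    twoSidedInt β θ w x = ∫ s in Ioo (0 : ℝ) 1, kernel β θ (x - s) * w s := by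
  have hs : (Ioo (0 : ℝ) 1) =ᵐ[volume] (Ioo 0 x ∪ Ioo x 1 : Set ℝ) := by
    filter_upwards [compl_mem_ae_iff.2 (measure_singleton x)] with s hs
    refine propext ⟨fun h => ?_, ?_⟩
    · rcases lt_or_gt_of_ne hs with h' | h'
      · exact Or.inl ⟨h.1, h'⟩
      · exact Or.inr ⟨h', h.2⟩
    · rintro (h | h)
      · exact ⟨h.1, h.2.trans_le hx.2⟩
      · exact ⟨hx.1.trans_lt h.1, h.2⟩
  have hd : Disjoint (Ioo 0 x) (Ioo x 1) :=
    Set.disjoint_left.2 fun s h h' => by linarith [h.2, h'.1]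
  rw [setIntegral_congr_set hs, setIntegral_union hd measurableSet_Ioo
    (hw.mono_set (Ioo_subset_Ioo_right hx.2)) (hw.mono_set (Ioo_subset_Ioo_left hx.1)),
    twoSidedInt, leftInt_eq hx, rightInt_eq hx, ← integral_const_mul, ← integral_const_mul]
  congr 1
  · refine setIntegral_congr_fun measurableSet_Ioo fun s hs => ?_
    simp only [kernel, if_pos (show 0 < x - s by linarith [hs.2])]
    ring
  · refine setIntegral_congr_fun measurableSet_Ioo fun s hs => ?_
    simp only [kernel, if_neg (show ¬ 0 < x - s by linarith [hs.1])]
    ring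

lemma conv_eq_setIntegral (k : ℝ → ℝ) (hφ : IsTest φ) (x : ℝ) :
    conv k φ x = ∫ s in Ioo (0 : ℝ) 1, k (x - s) * φ s := by
  rw [hφ.mul_setIntegral_eq, conv, ← integral_sub_left_eq_self _ _ x]
  simp

lemma integrableOn_kernel_sub (hβ : 0 < β) (hβ1 : β < 1) (hθ : 0 ≤ θ) (hθ' : θ ≤ 1) (x : ℝ) :
    IntegrableOn (fun s => kernel β θ (x - s)) (Ioo 0 1) := by
  have h := (locallyIntegrable_kernel hβ hβ1 hθ hθ').integrableOn_isCompact (isCompact_Icc (a := x - 1) (b := x))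
  have h2 := ((integrable_indicator_iff measurableSet_Icc).2 h).comp_sub_left x
  refine (h2.integrableOn (s := Ioo 0 1)).congr_fun (fun s hs => ?_) measurableSet_Ioo
  have : x - s ∈ Icc (x - 1) x := ⟨by linarith [hs.2], by linarith [hs.1]⟩
  exact indicator_of_mem this _

lemma integrableOn_kernel_sub_mul (hβ : 0 < β) (hβ1 : β < 1) (hθ : 0 ≤ θ) (hθ' : θ ≤ 1) (x : ℝ) {C : ℝ}
    (hw : AEStronglyMeasurable w vol01) (hC : ∀ᵐ s ∂vol01, |w s| ≤ C) :
    IntegrableOn (fun s => kernel β θ (x - s) * w s) (Ioo 0 1) :=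
  (integrableOn_kernel_sub hβ hβ1 hθ hθ' x).mul_bdd hw hC

end Kernel

/-! ### Hilbert space operators with adjoints bounded below, and continuation of injectivity. -/

section Hilbert
open Filter Topology

variable {E F : Type*} [NormedAddCommGroup E] [InnerProductSpace ℝ E] [CompleteSpace E]
  [NormedAddCommGroup F] [InnerProductSpace ℝ F] [CompleteSpace F]

open scoped RealInnerProductSpace

/-- An operator whose adjoint is bounded below has a bounded right inverse. -/
lemma exists_preimage_norm_le (A : E →L[ℝ] F) {c : ℝ} (hc : 0 < c)
    (h : ∀ q, c * ‖q‖ ≤ ‖ContinuousLinearMap.adjoint A q‖) (y : F) :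
    ∃ x, A x = y ∧ c * ‖x‖ ≤ ‖y‖ := by
  set B := ContinuousLinearMap.adjoint A with hB
  have hin : ∀ q q', ⟪A (B q), q'⟫ = ⟪B q, B q'⟫ := fun q q' => by
    rw [hB, ContinuousLinearMap.adjoint_inner_right]
  -- With B the adjoint of A, the operator AB satisfies ⟨AB q, q⟩ = ‖B q‖², hence is bounded below
  -- by c². Its range is then closed, and a vector orthogonal to it is killed by B, so AB is onto.
  have hlow : ∀ q, (c * c) * ‖q‖ ≤ ‖A (B q)‖ := by
    intro q
    rcases eq_or_ne q 0 with rfl | hq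
    · simp
    have hq' : 0 < ‖q‖ := norm_pos_iff.2 hq
    have h1 : ‖B q‖ ^ 2 ≤ ‖A (B q)‖ * ‖q‖ := by
      rw [← real_inner_self_eq_norm_sq, ← hin]
      exact real_inner_le_norm _ _
    have h2 := h q
    have h3 : (c * ‖q‖) ^ 2 ≤ ‖B q‖ ^ 2 := by gcongr
    refine le_of_mul_le_mul_right ?_ hq'
    nlinarith
  have hclosed : IsClosed (LinearMap.range (A ∘L B).toLinearMap : Set F) := by
    have ha : AntilipschitzWith (⟨1 / (c * c), by positivity⟩ : ℝ≥0) (A ∘L B) := by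
      refine AddMonoidHomClass.antilipschitz_of_bound _ fun q => ?_
      change ‖q‖ ≤ 1 / (c * c) * ‖A (B q)‖
      rw [one_div, ← div_eq_inv_mul, le_div_iff₀ (by positivity), mul_comm]
      exact hlow q
    exact ha.isClosed_range (A ∘L B).uniformContinuous
  have htop : LinearMap.range (A ∘L B).toLinearMap = ⊤ := by
    have : CompleteSpace (LinearMap.range (A ∘L B).toLinearMap) := hclosed.completeSpace_coe
    rw [← Submodule.orthogonal_eq_bot_iff, Submodule.eq_bot_iff]
    intro q hq
    have h0 : ⟪A (B q), q⟫ = 0 := (Submodule.mem_orthogonal _ _).1 hq _ ⟨q, rfl⟩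
    rw [hin, real_inner_self_eq_norm_sq] at h0
    have h1 : ‖B q‖ = 0 := by simpa using h0
    have h2 := h q
    rw [h1] at h2
    exact norm_eq_zero.1 (le_antisymm (by nlinarith) (norm_nonneg _))
  obtain ⟨q, hq⟩ : y ∈ LinearMap.range (A ∘L B).toLinearMap := htop ▸ Submodule.mem_top
  have hq : A (B q) = y := hq
  refine ⟨B q, hq, ?_⟩
  rcases eq_or_ne (B q) 0 with h0 | h0
  · rw [h0]; simp
  have h0' : 0 < ‖B q‖ := norm_pos_iff.2 h0
  -- The preimage is B q: combining ‖B q‖² = ⟨y, q⟩ with c‖q‖ ≤ ‖B q‖ gives c‖B q‖ ≤ ‖y‖.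
  have h1 : ‖B q‖ ^ 2 ≤ ‖y‖ * ‖q‖ := by
    rw [← real_inner_self_eq_norm_sq, ← hin, hq]
    exact real_inner_le_norm _ _
  have h2 := h q
  refine le_of_mul_le_mul_right ?_ h0'
  nlinarith [norm_nonneg y]

/-- Injectivity propagates along a segment of operators with uniformly bounded below adjoints. -/
lemma bijective_of_segment (A B : E →L[ℝ] F) {c : ℝ} (hc : 0 < c)
    (h : ∀ t : ℝ, 0 ≤ t → t ≤ 1 → ∀ q, c * ‖q‖ ≤ ‖ContinuousLinearMap.adjoint (t • A + (1 - t) • B) q‖)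
    (hA : Function.Injective A) {t : ℝ} (ht : 0 ≤ t) (ht' : t ≤ 1) :
    Function.Bijective (t • A + (1 - t) • B) := by
  refine ⟨?_, fun y => ?_⟩
  swap
  · obtain ⟨x, hx, -⟩ := exists_preimage_norm_le _ hc (h t ht ht') y
    exact ⟨x, hx⟩
  -- If the operator is injective, the preimage of controlled norm is the only one, so the operator
  -- itself is bounded below with the same constant c.
  have hbelow : ∀ s : ℝ, 0 ≤ s → s ≤ 1 → Function.Injective (s • A + (1 - s) • B) →
      ∀ x, c * ‖x‖ ≤ ‖(s • A + (1 - s) • B) x‖ := by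
    intro s hs hs' hi x
    obtain ⟨x', hx', hle⟩ := exists_preimage_norm_le _ hc (h s hs hs') ((s • A + (1 - s) • B) x)
    rwa [hi hx'] at hle
  -- The step length depends only on c and ‖A - B‖. A kernel vector x at s' within δ of s would
  -- satisfy c‖x‖ ≤ δ‖A - B‖‖x‖, while δ‖A - B‖ < c.
  set δ : ℝ := c / (‖A - B‖ + 1) with hδ
  have hN : 0 < ‖A - B‖ + 1 := by positivity
  have hδ0 : 0 < δ := by positivity
  have hstep : ∀ s s' : ℝ, 0 ≤ s → s ≤ 1 → |s' - s| ≤ δ → Function.Injective (s • A + (1 - s) • B) →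
      Function.Injective (s' • A + (1 - s') • B) := by
    intro s s' hs hs' hd hi
    rw [injective_iff_map_eq_zero]
    intro x hx
    have h1 := hbelow s hs hs' hi x
    have h2 : (s • A + (1 - s) • B) x = (s - s') • (A - B) x := by
      have : (s • A + (1 - s) • B) x = (s • A + (1 - s) • B) x - (s' • A + (1 - s') • B) x := by
        rw [hx, sub_zero]
      rw [this]
      simp only [add_apply, smul_apply, sub_apply]
      module
    rw [h2, norm_smul, Real.norm_eq_abs, abs_sub_comm] at h1
    have h3 : |s' - s| * ‖(A - B) x‖ ≤ δ * (‖A - B‖ * ‖x‖) := by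
      gcongr
      exact (A - B).le_opNorm x
    have h4 : δ * (‖A - B‖ + 1) = c := by rw [hδ]; field_simp
    have h5 : δ * ‖x‖ ≤ 0 := by nlinarith
    exact norm_eq_zero.1 (le_antisymm (nonpos_of_mul_nonpos_right h5 hδ0) (norm_nonneg _))
  -- March down from s = 1; n steps cover the part of the segment with s ≥ 1 - nδ.
  have hind : ∀ n : ℕ, ∀ s : ℝ, 0 ≤ s → s ≤ 1 → 1 - n * δ ≤ s → Function.Injective (s • A + (1 - s) • B) := by
    intro n
    induction n with
    | zero =>
      intro s hs hs' h1
      have : s = 1 := by simp at h1; linarith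
      simpa [this] using hA
    | succ n ih =>
      intro s hs hs' h1
      push_cast at h1
      have hm : s ≤ min (s + δ) 1 := le_min (by linarith) hs'
      refine hstep (min (s + δ) 1) s (hs.trans hm) (min_le_right _ _) ?_
        (ih _ (hs.trans hm) (min_le_right _ _) (le_min (by linarith) ?_))
      · rw [abs_sub_comm, abs_of_nonneg (by linarith)]
        linarith [min_le_left (s + δ) 1]
      · have : 0 ≤ (n : ℝ) * δ := by positivity
        linarith
  obtain ⟨n, hn⟩ := exists_nat_gt (1 / δ)
  refine hind n t ht ht' ?_
  rw [div_lt_iff₀ hδ0] at hn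
  linarith

end Hilbert

/-! ### Mean-zero functions in L²(0,1) and derivatives of test functions. -/

section MeanZero
open Filter Topology

open scoped RealInnerProductSpace

variable {v φ ψ : ℝ → ℝ}

/-- The constant function `1` in `L²(0,1)`. -/
def oneL2 : L2I := (memLp_const (1 : ℝ)).toLp (fun _ => (1 : ℝ))

lemma coeFn_oneL2 : oneL2 =ᵐ[vol01] fun _ => (1 : ℝ) := MemLp.coeFn_toLp _

lemma inner_eq_integral (f g : L2I) : ⟪f, g⟫ = ∫ x in Ioo (0 : ℝ) 1, f x * g x := by
  rw [L2.inner_def]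
  refine integral_congr_ae (.of_forall fun x => ?_)
  simp [mul_comm]

lemma inner_toLp {f : ℝ → ℝ} (hf : MemLp f 2 vol01) (g : L2I) :
    ⟪hf.toLp f, g⟫ = ∫ x in Ioo (0 : ℝ) 1, f x * g x := by
  rw [inner_eq_integral]
  refine integral_congr_ae ?_
  filter_upwards [hf.coeFn_toLp] with x hx
  rw [hx]

lemma inner_oneL2 (f : L2I) : ⟪oneL2, f⟫ = ∫ x in Ioo (0 : ℝ) 1, f x := by
  rw [oneL2, inner_toLp]
  simp

lemma norm_oneL2 : ‖oneL2‖ = 1 := by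
  have h : ⟪oneL2, oneL2⟫ = 1 := by
    rw [inner_oneL2, integral_congr_ae coeFn_oneL2]
    simp
  rw [real_inner_self_eq_norm_sq] at h
  nlinarith [norm_nonneg oneL2]

/-- The functions of mean zero in `L²(0,1)`. -/
def meanZero : Submodule ℝ L2I := (Submodule.span ℝ {oneL2})ᗮ

lemma mem_meanZero {f : L2I} : f ∈ meanZero ↔ ∫ x in Ioo (0 : ℝ) 1, f x = 0 := by
  rw [meanZero, Submodule.mem_orthogonal_singleton_iff_inner_right, inner_oneL2]

instance : CompleteSpace meanZero := by unfold meanZero; infer_instance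

/-- The mean-free part of a function. -/
def meanFree : L2I →ₗ[ℝ] meanZero :=
  (LinearMap.id - (innerSL ℝ oneL2).toLinearMap.smulRight oneL2).codRestrict meanZero fun f => by
    rw [meanZero, Submodule.mem_orthogonal_singleton_iff_inner_right]
    simp [inner_sub_right, inner_smul_right, norm_oneL2]

lemma coe_meanFree (f : L2I) : (meanFree f : L2I) = f - (∫ x in Ioo (0 : ℝ) 1, f x) • oneL2 := by
  rw [← inner_oneL2]
  rfl

lemma meanFree_inner (f : L2I) (q : meanZero) : ⟪meanFree f, q⟫ = ⟪f, (q : L2I)⟫ := by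
  have h := (Submodule.mem_orthogonal_singleton_iff_inner_right).1 q.2
  rw [Submodule.coe_inner, coe_meanFree, inner_sub_left, inner_smul_left, h]
  simp

/-- The space of test functions on `(0,1)`. -/
def testSpace : Submodule ℝ (ℝ → ℝ) where
  carrier := {φ | IsTest φ}
  zero_mem' := isTest_zero
  add_mem' := fun h h' => h.add h'
  smul_mem' := fun c _ h => h.const_mul c

lemma isTest_coe (φ : testSpace) : IsTest (φ : ℝ → ℝ) := φ.2

lemma IsTest.memLp (hv : IsTest v) : MemLp v 2 vol01 := (hv.isCS.memLp 2).restrict _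

/-- The inclusion of the test functions into `L²(0,1)`. -/
def testToL2 : testSpace →ₗ[ℝ] L2I where
  toFun φ := (isTest_coe φ).memLp.toLp φ
  map_add' _ _ := rfl
  map_smul' _ _ := rfl

lemma coeFn_testToL2 (φ : testSpace) : testToL2 φ =ᵐ[vol01] φ := (isTest_coe φ).memLp.coeFn_toLp

lemma norm_testToL2_sq (φ : testSpace) : ‖testToL2 φ‖ ^ 2 = ∫ x, (φ : ℝ → ℝ) x ^ 2 := by
  rw [← real_inner_self_eq_norm_sq, inner_eq_integral, ← (isTest_coe φ).sq_setIntegral_eq]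
  refine integral_congr_ae ?_
  filter_upwards [coeFn_testToL2 φ] with x hx
  rw [hx, sq]

lemma IsTest.integral_deriv (hv : IsTest v) : ∫ x, _root_.deriv v x = 0 :=
  integral_eq_zero_of_hasDerivAt_of_integrable
    (fun x => (hv.isCS.differentiable x).hasDerivAt) hv.isCS.deriv.integrable hv.integrable

lemma toLp_deriv_mem_meanZero (φ : testSpace) : (isTest_coe φ).deriv.memLp.toLp (deriv (φ : ℝ → ℝ)) ∈ meanZero := by
  rw [mem_meanZero, integral_congr_ae (MemLp.coeFn_toLp _), (isTest_coe φ).deriv.setIntegral_eq, (isTest_coe φ).integral_deriv]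

/-- Differentiation of test functions, with values in the functions of mean zero. -/
def testDeriv : testSpace →ₗ[ℝ] meanZero where
  toFun φ := ⟨(isTest_coe φ).deriv.memLp.toLp (deriv (φ : ℝ → ℝ)), toLp_deriv_mem_meanZero φ⟩
  map_add' φ ψ := Subtype.ext <|
    (MemLp.toLp_congr (isTest_coe (φ + ψ)).deriv.memLp ((isTest_coe φ).deriv.memLp.add (isTest_coe ψ).deriv.memLp) (.of_forall fun x =>
      deriv_add ((isTest_coe φ).isCS.differentiable x) ((isTest_coe ψ).isCS.differentiable x))).trans
      (MemLp.toLp_add (isTest_coe φ).deriv.memLp (isTest_coe ψ).deriv.memLp)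
  map_smul' c φ := Subtype.ext <|
    (MemLp.toLp_congr (isTest_coe (c • φ)).deriv.memLp ((isTest_coe φ).deriv.memLp.const_smul c) (.of_forall fun x =>
      deriv_const_smul c ((isTest_coe φ).isCS.differentiable x))).trans
      (MemLp.toLp_const_smul c (isTest_coe φ).deriv.memLp)

lemma coeFn_testDeriv (φ : testSpace) : (testDeriv φ : L2I) =ᵐ[vol01] deriv (φ : ℝ → ℝ) := (isTest_coe φ).deriv.memLp.coeFn_toLp

lemma inner_testDeriv (f : L2I) (φ : testSpace) :
    ⟪f, (testDeriv φ : L2I)⟫ = ∫ x in Ioo (0 : ℝ) 1, f x * deriv (φ : ℝ → ℝ) x := by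
  rw [inner_eq_integral]
  refine integral_congr_ae ?_
  filter_upwards [coeFn_testDeriv φ] with x hx
  rw [hx]

lemma norm_testDeriv_sq (φ : testSpace) : ‖testDeriv φ‖ ^ 2 = ∫ x, deriv (φ : ℝ → ℝ) x ^ 2 := by
  rw [← Submodule.norm_coe, ← real_inner_self_eq_norm_sq, inner_eq_integral, ← (isTest_coe φ).deriv.sq_setIntegral_eq]
  refine integral_congr_ae ?_
  filter_upwards [coeFn_testDeriv φ] with x hx
  rw [hx, sq]

/-- A test function of mean zero has a primitive that is a test function. -/
lemma IsTest.exists_primitive (hψ : IsTest ψ) (h0 : ∫ x, ψ x = 0) : ∃ v, IsTest v ∧ _root_.deriv v = ψ := by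
  obtain ⟨δ, hδ, hm⟩ := hψ.exists_margin
  set v : ℝ → ℝ := fun x => ∫ t in (0 : ℝ)..x, ψ t with hv
  have hc := hψ.isCS.continuous
  have hd : ∀ x, HasDerivAt v (ψ x) x := fun x =>
    intervalIntegral.integral_hasDerivAt_right (hc.intervalIntegrable _ _)
      hc.stronglyMeasurable.stronglyMeasurableAtFilter hc.continuousAt
  have hdv : _root_.deriv v = ψ := funext fun x => (hd x).deriv
  have hsm : ContDiff ℝ ∞ v :=
    contDiff_infty_iff_deriv.2 ⟨fun x => (hd x).differentiableAt, hdv ▸ hψ.1⟩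
  have h01 : ∫ t in (0 : ℝ)..1, ψ t = 0 := by
    rw [intervalIntegral.integral_of_le zero_le_one, integral_Ioc_eq_integral_Ioo, hψ.setIntegral_eq, h0]
  -- To the right of 1 - δ the primitive equals the full integral, which is zero; this is the only
  -- use of the vanishing mean.
  have hz : ∀ x, x ∉ Icc δ (1 - δ) → v x = 0 := by
    intro x hx
    rw [mem_Icc, not_and_or, not_le, not_le] at hx
    rcases hx with hx | hx
    · refine intervalIntegral.integral_zero_ae (.of_forall fun t ht => hm t fun h => ?_)
      rcases Set.mem_uIoc.1 ht with h' | h' <;> linarith [h.1, h'.1, h'.2]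
    · have : v x = (∫ t in (0 : ℝ)..1, ψ t) + ∫ t in (1 : ℝ)..x, ψ t :=
        (intervalIntegral.integral_add_adjacent_intervals (hc.intervalIntegrable _ _)
          (hc.intervalIntegrable _ _)).symm
      rw [this, h01, zero_add]
      refine intervalIntegral.integral_zero_ae (.of_forall fun t ht => hm t fun h => ?_)
      rcases Set.mem_uIoc.1 ht with h' | h' <;> linarith [h.2, h'.1, h'.2]
  have hcs : IsCS v := ⟨hsm, HasCompactSupport.intro isCompact_Icc fun x hx => hz x hx⟩
  exact ⟨v, IsTest.of_eq_zero hcs hδ (by linarith) hz, hdv⟩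

lemma exists_isTest_integral_eq_one : ∃ η, IsTest η ∧ ∫ x, η x = 1 := by
  let b : ContDiffBump (1 / 2 : ℝ) := ⟨1 / 8, 1 / 4, by norm_num, by norm_num⟩
  refine ⟨b.normed volume, ⟨b.contDiff_normed, b.hasCompactSupport_normed, ?_⟩, b.integral_normed⟩
  rw [b.tsupport_normed_eq, Real.closedBall_eq_Icc]
  exact Icc_subset_Ioo (by norm_num) (by norm_num)

/-- The lemma of du Bois-Reymond. -/
lemma eq_const_of_integral_mul_deriv_eq_zero {f : ℝ → ℝ} (hf : IntegrableOn f (Ioo 0 1))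
    (h : ∀ v, IsTest v → ∫ x in Ioo (0 : ℝ) 1, f x * deriv v x = 0) : ∃ c : ℝ, ∀ᵐ x ∂vol01, f x = c := by
  obtain ⟨η, hη, hη1⟩ := exists_isTest_integral_eq_one
  have hmul : ∀ ψ, IsTest ψ → IntegrableOn (fun x => f x * ψ x) (Ioo 0 1) := fun ψ hψ => by
    obtain ⟨C, -, hC⟩ := hψ.isCS.bounded
    exact hf.mul_bdd hψ.isCS.continuous.aestronglyMeasurable (.of_forall hC)
  set c := ∫ x in Ioo (0 : ℝ) 1, f x * η x with hc
  refine ⟨c, ?_⟩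
  have key := isOpen_Ioo.ae_eq_zero_of_integral_contDiff_smul_eq_zero (μ := volume) (U := Ioo (0 : ℝ) 1)
    (f := fun x => f x - c) (hf.sub (integrable_const c)).locallyIntegrableOn ?_
  · refine (ae_restrict_iff' measurableSet_Ioo).2 ?_
    filter_upwards [key] with x hx hm
    linarith [hx hm]
  intro ψ h1 h2 h3
  have hψ : IsTest ψ := ⟨h1, h2, h3⟩
  -- Subtracting (∫ψ)η gives mean zero, so the difference is the derivative of a test function; the
  -- constant is therefore ∫ f η.
  obtain ⟨v, hv, hdv⟩ := (hψ.add (hη.const_mul (-∫ x, ψ x))).exists_primitive (by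
    rw [integral_add hψ.integrable (hη.const_mul _).integrable, integral_const_mul, hη1]; ring)
  have h4 := h v hv
  rw [hdv] at h4
  have h5 : ∫ x in Ioo (0 : ℝ) 1, f x * (ψ x + (-∫ x, ψ x) * η x)
      = (∫ x in Ioo (0 : ℝ) 1, f x * ψ x) - (∫ x, ψ x) * c := by
    rw [hc, ← integral_const_mul, ← integral_sub (hmul ψ hψ) ((hmul η hη).const_mul _)]
    refine integral_congr_ae (.of_forall fun x => ?_)
    dsimp only
    ring
  have h6 : ∫ x, ψ x • (f x - c) = (∫ x in Ioo (0 : ℝ) 1, f x * ψ x) - (∫ x, ψ x) * c := by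
    have : ∀ x, ψ x • (f x - c) = (f x - c) * ψ x := fun x => by rw [smul_eq_mul, mul_comm]
    simp only [this]
    rw [← hψ.mul_setIntegral_eq, ← hψ.setIntegral_eq, ← integral_mul_const,
      ← integral_sub (hmul ψ hψ) (hψ.integrable.integrableOn.mul_const _)]
    refine integral_congr_ae (.of_forall fun x => ?_)
    dsimp only
    ring
  rw [h6, ← h5, h4]

lemma L2I.integrable (f : L2I) : Integrable f vol01 := (Lp.memLp f).integrable (by norm_num)

/-- A function orthogonal to all these derivatives is constant, and a constant of mean zero
vanishes. -/
lemma denseRange_testDeriv : DenseRange testDeriv := by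
  have h : (LinearMap.range testDeriv).topologicalClosure = ⊤ := by
    refine Submodule.topologicalClosure_eq_top_iff.2 ((Submodule.eq_bot_iff _).2 ?_)
    intro q hq
    obtain ⟨c, hc⟩ := eq_const_of_integral_mul_deriv_eq_zero (f := (q : L2I)) (L2I.integrable q) fun v hv => by
      have := (Submodule.mem_orthogonal' _ _).1 hq _ ⟨⟨v, hv⟩, rfl⟩
      rwa [Submodule.coe_inner, inner_testDeriv] at this
    have h0 := mem_meanZero.1 q.2
    rw [integral_congr_ae hc] at h0
    have hc0 : c = 0 := by simpa using h0
    apply Subtype.ext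
    refine Lp.ext ?_
    filter_upwards [hc, Lp.coeFn_zero ℝ 2 vol01] with x hx h0
    rw [hx, hc0, Submodule.coe_zero, h0]
    rfl
  exact Submodule.dense_iff_topologicalClosure_eq_top.2 h

/-- Primitives depend continuously on the `L²` function. -/
lemma norm_integral_le_norm (q : L2I) {x : ℝ} (hx : x ∈ Icc (0 : ℝ) 1) : |∫ s in (0 : ℝ)..x, q s| ≤ ‖q‖ := by
  have hsub : Ioo 0 x ⊆ Ioo (0 : ℝ) 1 := Ioo_subset_Ioo_right hx.2
  have h1 : ∫ s in (0 : ℝ)..x, q s = ⟪indicatorConstLp 2 measurableSet_Ioo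
      (measure_ne_top vol01 (Ioo 0 x)) (1 : ℝ), q⟫ := by
    rw [L2.inner_indicatorConstLp_one, intervalIntegral.integral_of_le hx.1, integral_Ioc_eq_integral_Ioo,
      Measure.restrict_restrict measurableSet_Ioo, inter_eq_self_of_subset_left hsub]
  rw [h1]
  refine (abs_real_inner_le_norm _ _).trans (mul_le_of_le_one_left (norm_nonneg _) ?_)
  rw [norm_indicatorConstLp (by norm_num) (by norm_num), norm_one, one_mul]
  refine Real.rpow_le_one measureReal_nonneg ?_ (by norm_num)
  refine (measureReal_mono (subset_univ _)).trans (le_of_eq ?_)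
  simp [measureReal_def]

end MeanZero

/-! ### The space H^μ_0(0,1) as a Hilbert space under its seminorm. -/

section Energy
open Filter Topology

open scoped RealInnerProductSpace

variable {μ : ℝ≥0} {φ w w' : ℝ → ℝ}

/-- The weighted Fourier transform whose `L²` norm is the `H^μ` seminorm. -/
def energyFun (μ : ℝ≥0) (φ : ℝ → ℝ) (ξ : ℝ) : ℂ := ((|2 * Real.pi * ξ| ^ (μ : ℝ) : ℝ) : ℂ) * hat φ ξ

lemma norm_energyFun_sq (μ : ℝ≥0) (φ : ℝ → ℝ) (ξ : ℝ) :
    ‖energyFun μ φ ξ‖ ^ 2 = |2 * Real.pi * ξ| ^ (2 * (μ : ℝ)) * ‖hat φ ξ‖ ^ 2 := by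
  rw [energyFun, norm_mul, mul_pow, Complex.norm_real, Real.norm_of_nonneg (by positivity),
    ← Real.rpow_natCast (|_| ^ _), ← Real.rpow_mul (abs_nonneg _), mul_comm (μ : ℝ)]
  rfl

lemma continuous_energyFun (hw : Integrable w) : Continuous (energyFun μ w) :=
  (Complex.continuous_ofReal.comp (Continuous.rpow_const (by fun_prop) fun _ => Or.inr μ.2)).mul
    (continuous_hat hw)

lemma IsCS.memLp_energyFun (hφ : IsCS φ) : MemLp (energyFun μ φ) 2 volume := by
  rw [memLp_two_iff_integrable_sq_norm (continuous_energyFun hφ.integrable).aestronglyMeasurable]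
  simp only [norm_energyFun_sq]
  exact integrable_seminormSq hφ μ.2

/-- Test functions as elements of `L²(ℝ, ℂ)` with the `H^μ` seminorm as norm. -/
def energyMap (μ : ℝ≥0) : testSpace →ₗ[ℝ] Lp ℂ 2 (volume : Measure ℝ) where
  toFun φ := (isTest_coe φ).isCS.memLp_energyFun.toLp (energyFun μ φ)
  map_add' φ ψ :=
    (MemLp.toLp_congr (isTest_coe (φ + ψ)).isCS.memLp_energyFun
      ((isTest_coe φ).isCS.memLp_energyFun.add (isTest_coe ψ).isCS.memLp_energyFun) (.of_forall fun ξ => by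
        have := hat_add (isTest_coe φ).integrable (isTest_coe ψ).integrable ξ
        simp only [energyFun, Pi.add_apply, ← mul_add, ← this]
        rfl)).trans
      (MemLp.toLp_add (isTest_coe φ).isCS.memLp_energyFun (isTest_coe ψ).isCS.memLp_energyFun)
  map_smul' c φ :=
    (MemLp.toLp_congr (isTest_coe (c • φ)).isCS.memLp_energyFun
      ((isTest_coe φ).isCS.memLp_energyFun.const_smul c) (.of_forall fun ξ => by
        have := hat_const_mul c φ ξ
        simp only [energyFun, Pi.smul_apply, Complex.real_smul, mul_left_comm (c : ℂ), ← this]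
        rfl)).trans
      (MemLp.toLp_const_smul c (isTest_coe φ).isCS.memLp_energyFun)

lemma enorm_energyMap (φ : testSpace) : ‖energyMap μ φ‖ₑ = hSeminorm μ φ :=
  Lp.enorm_toLp (isTest_coe φ).isCS.memLp_energyFun

lemma norm_energyMap_sq (φ : testSpace) : ‖energyMap μ φ‖ ^ 2 = seminormSq μ φ := by
  rw [← real_inner_self_eq_norm_sq, L2.inner_def, seminormSq]
  refine integral_congr_ae ?_
  filter_upwards [(isTest_coe φ).isCS.memLp_energyFun.coeFn_toLp (f := energyFun μ φ)] with ξ hξ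
  rw [← norm_energyFun_sq, ← hξ, real_inner_self_eq_norm_sq]
  rfl

/-- The Hilbert space of functions vanishing outside `(0,1)` with the `H^μ` seminorm as norm. -/
def energySpace (μ : ℝ≥0) : Submodule ℝ (Lp ℂ 2 (volume : Measure ℝ)) :=
  (LinearMap.range (energyMap μ)).topologicalClosure

instance : CompleteSpace (energySpace μ) := by unfold energySpace; infer_instance

/-- The inclusion of the test functions into the energy space. -/
def energyIncl (μ : ℝ≥0) : testSpace →ₗ[ℝ] energySpace μ :=
  (energyMap μ).codRestrict _ fun φ => Submodule.le_topologicalClosure _ ⟨φ, rfl⟩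

lemma denseRange_energyIncl : DenseRange (energyIncl μ) := by
  rw [DenseRange, Subtype.dense_iff]
  intro x hx
  have h : ((↑) '' range (energyIncl μ) : Set (Lp ℂ 2 (volume : Measure ℝ))) = range (energyMap μ) := by
    rw [← range_comp]; rfl
  have hx' : x ∈ closure (range (energyMap μ)) := hx
  rw [← h] at hx'
  exact hx'

lemma norm_energyIncl_sq (φ : testSpace) : ‖energyIncl μ φ‖ ^ 2 = seminormSq μ φ := norm_energyMap_sq φ

lemma enorm_energyIncl (φ : testSpace) : ‖energyIncl μ φ‖ₑ = hSeminorm μ φ := enorm_energyMap φ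

lemma exists_norm_testToL2_le (hμ : 0 < μ) : ∃ C, ∀ φ, ‖testToL2 φ‖ ≤ C * ‖energyIncl μ φ‖ := by
  obtain ⟨C, hC, h⟩ := exists_poincare (μ := μ) hμ
  refine ⟨√C, fun φ => ?_⟩
  rw [← Real.sqrt_sq (norm_nonneg (testToL2 φ)), norm_testToL2_sq, ← Real.sqrt_sq (norm_nonneg (energyIncl μ φ)),
    norm_energyIncl_sq, ← Real.sqrt_mul hC.le]
  exact Real.sqrt_le_sqrt (h _ (isTest_coe φ))

/-- The realisation of the energy space as a space of functions in `L²(0,1)`. -/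
def energyToL2 (μ : ℝ≥0) : energySpace μ →L[ℝ] L2I := testToL2.extendOfNorm (energyIncl μ)

/-- The Poincaré inequality makes the inclusion into L² continuous for the seminorm, so that the
extension from the dense subspace really extends it. -/
lemma energyToL2_incl (hμ : 0 < μ) (φ : testSpace) : energyToL2 μ (energyIncl μ φ) = testToL2 φ :=
  LinearMap.extendOfNorm_eq denseRange_energyIncl (exists_norm_testToL2_le hμ) φ

lemma exists_seq_tendsto_energy (hμ : 0 < μ) (e : energySpace μ) : ∃ φ : ℕ → testSpace,
    Tendsto (fun n => energyIncl μ (φ n)) atTop (𝓝 e) ∧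
    Tendsto (fun n => testToL2 (φ n)) atTop (𝓝 (energyToL2 μ e)) ∧
    ∀ᵐ x ∂vol01, Tendsto (fun n => (φ n : ℝ → ℝ) x) atTop (𝓝 (energyToL2 μ e x)) := by
  obtain ⟨s, hs, hse⟩ := mem_closure_iff_seq_limit.1 (denseRange_energyIncl (μ := μ) e)
  choose φ hφ using hs
  have h1 : Tendsto (fun n => energyIncl μ (φ n)) atTop (𝓝 e) := by simpa only [hφ] using hse
  have h2 : Tendsto (fun n => testToL2 (φ n)) atTop (𝓝 (energyToL2 μ e)) := by
    simpa only [Function.comp_def, energyToL2_incl hμ] using ((energyToL2 μ).continuous.tendsto e).comp h1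
  obtain ⟨ns, hns, hae⟩ := (tendstoInMeasure_of_tendsto_Lp h2).exists_seq_tendsto_ae
  refine ⟨φ ∘ ns, h1.comp hns.tendsto_atTop, h2.comp hns.tendsto_atTop, ?_⟩
  filter_upwards [hae, ae_all_iff.2 fun n => coeFn_testToL2 (φ n)] with x hx hx'
  simpa only [Function.comp_apply, hx'] using hx

/-- Uniform control by the energy norm. -/
lemma exists_ae_abs_sub_le (hμ : 1 / 2 < (μ : ℝ)) : ∃ C, 0 ≤ C ∧ ∀ (φ : testSpace) (e : energySpace μ),
    ∀ᵐ x ∂vol01, |(φ : ℝ → ℝ) x - energyToL2 μ e x| ≤ C * ‖energyIncl μ φ - e‖ := by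
  have hμ0 : 0 < μ := by
    have : (0 : ℝ) < μ := by linarith
    exact_mod_cast this
  obtain ⟨C, hC, h⟩ := exists_sup_bound hμ
  refine ⟨√C, Real.sqrt_nonneg _, fun φ e => ?_⟩
  obtain ⟨ψ, h1, -, h2⟩ := exists_seq_tendsto_energy hμ0 e
  filter_upwards [h2] with x hx
  have hle : ∀ n, |(φ : ℝ → ℝ) x - (ψ n : ℝ → ℝ) x| ≤ √C * ‖energyIncl μ φ - energyIncl μ (ψ n)‖ := by
    intro n
    rw [← map_sub, ← Real.sqrt_sq (norm_nonneg (energyIncl μ _)), norm_energyIncl_sq, ← Real.sqrt_mul hC.le,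
      ← Real.sqrt_sq_eq_abs]
    exact Real.sqrt_le_sqrt (h _ (isTest_coe (φ - ψ n)) x)
  exact le_of_tendsto_of_tendsto' (tendsto_const_nhds.sub hx).abs
    ((tendsto_const_nhds.sub h1).norm.const_mul _) hle

lemma abs_ae_le_of_energy (hμ : 1 / 2 < (μ : ℝ)) (e : energySpace μ) :
    ∃ C, ∀ᵐ x ∂vol01, |energyToL2 μ e x| ≤ C := by
  obtain ⟨C, -, h⟩ := exists_ae_abs_sub_le hμ
  refine ⟨C * ‖energyIncl μ 0 - e‖, ?_⟩
  filter_upwards [h 0 e] with x hx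
  simpa using hx

lemma hSeminorm_congr (μ : ℝ) (h : w =ᵐ[volume] w') : hSeminorm μ w = hSeminorm μ w' := by
  have : hat w = hat w' := hat_congr h
  exact congrArg (fun F : ℝ → ℂ => eLpNorm (fun ξ : ℝ => ((|2 * Real.pi * ξ| ^ μ : ℝ) : ℂ) * F ξ) 2 volume) this

lemma hSeminorm_le_hNorm (μ : ℝ) (w : ℝ → ℝ) : hSeminorm μ w ≤ hNorm μ w := by
  rw [hNorm]
  calc hSeminorm μ w = (hSeminorm μ w ^ 2) ^ (1 / 2 : ℝ) := by
        rw [← ENNReal.rpow_two, ← ENNReal.rpow_mul]; norm_num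
    _ ≤ _ := by gcongr; exact le_add_self

lemma eLpNorm_le_hNorm (μ : ℝ) (w : ℝ → ℝ) : eLpNorm w 2 volume ≤ hNorm μ w := by
  rw [hNorm]
  calc eLpNorm w 2 volume = (eLpNorm w 2 volume ^ 2) ^ (1 / 2 : ℝ) := by
        rw [← ENNReal.rpow_two, ← ENNReal.rpow_mul]; norm_num
    _ ≤ _ := by gcongr; exact le_self_add

lemma hNorm_le_add (μ : ℝ) (w : ℝ → ℝ) : hNorm μ w ≤ eLpNorm w 2 volume + hSeminorm μ w := by
  rw [hNorm]
  calc (eLpNorm w 2 volume ^ 2 + hSeminorm μ w ^ 2) ^ (1 / 2 : ℝ)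
      ≤ ((eLpNorm w 2 volume + hSeminorm μ w) ^ 2) ^ (1 / 2 : ℝ) := by
        gcongr
        rw [add_sq, add_right_comm]
        exact le_self_add
    _ = _ := by rw [← ENNReal.rpow_two, ← ENNReal.rpow_mul]; norm_num

lemma zext_sub_ae (u : L2I) (φ : testSpace) :
    (fun x => zext u x - (φ : ℝ → ℝ) x) =ᵐ[volume] zext (u - testToL2 φ) := by
  have h := (ae_restrict_iff' measurableSet_Ioo).1 ((Lp.coeFn_sub u (testToL2 φ)).and (coeFn_testToL2 φ))
  filter_upwards [h] with x hx
  by_cases hm : x ∈ Ioo (0 : ℝ) 1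
  · simp only [zext, indicator_of_mem hm]
    rw [(hx hm).1, Pi.sub_apply, (hx hm).2]
  · simp [zext, indicator_of_notMem hm, (isTest_coe φ).eq_zero_of_notMem hm]

lemma eLpNorm_zext (u : L2I) : eLpNorm (zext u) 2 volume = ‖u‖ₑ := by
  rw [zext, eLpNorm_indicator_eq_eLpNorm_restrict measurableSet_Ioo, Lp.enorm_def]

lemma norm_hat_zext_le (u : L2I) (ξ : ℝ) : ‖hat (zext u) ξ‖ ≤ ‖u‖ := by
  refine (norm_hat_le _ ξ).trans ?_
  have h : ∫ x, |zext u x| = ⟪oneL2, |u|⟫ := by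
    rw [inner_oneL2, ← integral_indicator measurableSet_Ioo]
    have := (ae_restrict_iff' measurableSet_Ioo).1 (Lp.coeFn_abs u)
    refine integral_congr_ae ?_
    filter_upwards [this] with x hx
    by_cases hm : x ∈ Ioo (0 : ℝ) 1
    · simp only [zext, indicator_of_mem hm]
      rw [hx hm]
    · simp [zext, indicator_of_notMem hm]
  rw [h]
  refine (real_inner_le_norm _ _).trans ?_
  rw [norm_oneL2, one_mul, norm_abs_eq_norm]

lemma hat_zext_testToL2 (φ : testSpace) (ξ : ℝ) : hat (zext (testToL2 φ)) ξ = hat φ ξ := by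
  refine congrFun (hat_congr ?_) ξ
  filter_upwards [(ae_restrict_iff' measurableSet_Ioo).1 (coeFn_testToL2 φ)] with x hx
  by_cases hm : x ∈ Ioo (0 : ℝ) 1
  · rw [zext, indicator_of_mem hm, hx hm]
  · rw [zext, indicator_of_notMem hm, (isTest_coe φ).eq_zero_of_notMem hm]

lemma hat_zext_sub (u u' : L2I) (ξ : ℝ) : hat (zext (u - u')) ξ = hat (zext u) ξ - hat (zext u') ξ := by
  rw [← hat_sub (zext_integrable u) (zext_integrable u')]
  refine congrFun (hat_congr ?_) ξ
  filter_upwards [(ae_restrict_iff' measurableSet_Ioo).1 (Lp.coeFn_sub u u')] with x hx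
  by_cases hm : x ∈ Ioo (0 : ℝ) 1
  · simp only [zext, indicator_of_mem hm]
    rw [hx hm, Pi.sub_apply]
  · simp [zext, indicator_of_notMem hm]

/-- Convergence in L²(0,1) forces pointwise convergence of the transforms, since these are bounded
by the L² norm; then Fatou applies to the weighted transforms. -/
lemma hSeminorm_zext_le (hμ : 0 < μ) (e : energySpace μ) : hSeminorm μ (zext (energyToL2 μ e)) ≤ ‖e‖ₑ := by
  obtain ⟨φ, h1, h2, -⟩ := exists_seq_tendsto_energy hμ e
  have hpt : ∀ ξ, Tendsto (fun n => energyFun μ (φ n) ξ) atTop (𝓝 (energyFun μ (zext (energyToL2 μ e)) ξ)) := by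
    intro ξ
    refine Tendsto.const_mul _ (tendsto_iff_norm_sub_tendsto_zero.2 ?_)
    refine squeeze_zero (fun n => norm_nonneg _) (fun n => ?_) (tendsto_iff_norm_sub_tendsto_zero.1 h2)
    rw [← hat_zext_testToL2, ← hat_zext_sub]
    exact norm_hat_zext_le _ ξ
  have h3 := Lp.eLpNorm_lim_le_liminf_eLpNorm (p := 2) (μ := (volume : Measure ℝ))
    (fun n => (isTest_coe (φ n)).isCS.memLp_energyFun.aestronglyMeasurable) _ (.of_forall hpt)
  refine h3.trans (le_of_eq ?_)
  have h4 : ∀ n, eLpNorm (energyFun μ (φ n)) 2 volume = ‖energyIncl μ (φ n)‖ₑ :=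
    fun n => (enorm_energyIncl (φ n)).symm
  simp only [h4]
  exact ((continuous_enorm.tendsto e).comp h1).liminf_eq

/-- If e is realised as 0 and φ_n tends to e, the realisation of φ_n - e is φ_n. Its seminorm is at
most ‖φ_n - e‖, so φ_n also tends to 0. -/
lemma energyToL2_injective (hμ : 0 < μ) : Function.Injective (energyToL2 μ) := by
  rw [injective_iff_map_eq_zero]
  intro e he
  obtain ⟨φ, h1, -, -⟩ := exists_seq_tendsto_energy hμ e
  have hle : ∀ n, ‖energyIncl μ (φ n)‖ₑ ≤ ‖energyIncl μ (φ n) - e‖ₑ := by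
    intro n
    have h := hSeminorm_zext_le hμ (energyIncl μ (φ n) - e)
    rw [map_sub, he, sub_zero, energyToL2_incl hμ] at h
    refine le_trans (le_of_eq ?_) h
    rw [enorm_energyIncl]
    refine congrArg (fun F : ℝ → ℂ => eLpNorm (fun ξ : ℝ => ((|2 * Real.pi * ξ| ^ (μ : ℝ) : ℝ) : ℂ) * F ξ) 2 volume)
      (funext fun ξ => (hat_zext_testToL2 (φ n) ξ).symm)
  have h2 : Tendsto (fun n => energyIncl μ (φ n)) atTop (𝓝 0) := by
    rw [tendsto_zero_iff_norm_tendsto_zero]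
    refine squeeze_zero (fun n => norm_nonneg _) (fun n => ?_) (tendsto_iff_norm_sub_tendsto_zero.1 h1)
    exact enorm_le_iff_norm_le.1 (hle n)
  exact tendsto_nhds_unique h1 h2

lemma energyToL2_mem_H0 (hμ : 0 < μ) (e : energySpace μ) : energyToL2 μ e ∈ H0 μ := by
  intro ε hε
  obtain ⟨φ, h1, h2, -⟩ := exists_seq_tendsto_energy hμ e
  have hlim : Tendsto (fun n => ‖energyToL2 μ e - testToL2 (φ n)‖ₑ + ‖e - energyIncl μ (φ n)‖ₑ) atTop (𝓝 0) := by
    have h3 := (continuous_enorm.tendsto (energyToL2 μ e - energyToL2 μ e)).comp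
      (tendsto_const_nhds (x := energyToL2 μ e) |>.sub h2)
    have h4 : Tendsto (fun n => ‖e - energyIncl μ (φ n)‖ₑ) atTop (𝓝 0) := by
      rw [show (0 : ℝ≥0∞) = ‖e - e‖ₑ by rw [sub_self]; exact enorm_zero.symm]
      exact (continuous_enorm.tendsto (e - e)).comp (tendsto_const_nhds (x := e) |>.sub h1)
    rw [sub_self, enorm_zero] at h3
    simpa only [add_zero, Function.comp_def] using h3.add h4
  obtain ⟨n, hn⟩ := (hlim.eventually (gt_mem_nhds hε)).exists
  refine ⟨φ n, isTest_coe _, lt_of_le_of_lt ?_ hn⟩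
  rw [hNorm_congr _ (zext_sub_ae _ (φ n))]
  refine (hNorm_le_add _ _).trans ?_
  rw [eLpNorm_zext]
  gcongr
  rw [← energyToL2_incl hμ, ← map_sub]
  exact hSeminorm_zext_le hμ _

/-- Approximants in the full norm are Cauchy for the seminorm, and their limit is realised by the
same L² limit. Together with `energyToL2_mem_H0` this identifies `H0 μ` with the image of the
Hilbert space. -/
lemma exists_energyToL2_eq (hμ : 0 < μ) {u : L2I} (hu : u ∈ H0 μ) : ∃ e, energyToL2 μ e = u := by
  have hpos : ∀ n : ℕ, (0 : ℝ≥0∞) < (((n : ℝ≥0∞) + 1))⁻¹ := fun n =>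
    ENNReal.inv_pos.2 (by simp)
  have hu' : ∀ n : ℕ, ∃ φ : testSpace, hNorm μ (zext (u - testToL2 φ)) < ((n : ℝ≥0∞) + 1)⁻¹ := by
    intro n
    obtain ⟨φ, hφ, h⟩ := hu _ (hpos n)
    exact ⟨⟨φ, hφ⟩, by rwa [← hNorm_congr _ (zext_sub_ae u ⟨φ, hφ⟩)]⟩
  choose φ hφ using hu'
  have h0 : Tendsto (fun n : ℕ => ((n : ℝ≥0∞) + 1)⁻¹) atTop (𝓝 0) := by
    have := (tendsto_add_atTop_iff_nat 1).2 ENNReal.tendsto_inv_nat_nhds_zero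
    simpa using this
  have h2 : Tendsto (fun n => testToL2 (φ n)) atTop (𝓝 u) := by
    rw [tendsto_iff_edist_tendsto_0]
    refine tendsto_of_tendsto_of_tendsto_of_le_of_le tendsto_const_nhds h0 (fun n => zero_le) fun n => ?_
    rw [edist_comm, edist_eq_enorm_sub, ← eLpNorm_zext]
    exact (eLpNorm_le_hNorm _ _).trans (hφ n).le
  have hdist : ∀ m n, edist (energyIncl μ (φ m)) (energyIncl μ (φ n)) ≤ ((n : ℝ≥0∞) + 1)⁻¹ + ((m : ℝ≥0∞) + 1)⁻¹ := by
    intro m n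
    rw [edist_eq_enorm_sub, ← map_sub, enorm_energyIncl]
    have e1 : (fun x => zext (u - testToL2 (φ n)) x + (-1) * zext (u - testToL2 (φ m)) x)
        =ᵐ[volume] ((φ m - φ n : testSpace) : ℝ → ℝ) := by
      filter_upwards [zext_sub_ae u (φ n), zext_sub_ae u (φ m)] with x hx hx'
      rw [← hx, ← hx']
      simp only [Submodule.coe_sub, Pi.sub_apply]
      ring
    rw [← hSeminorm_congr _ e1]
    refine (hSeminorm_le_hNorm _ _).trans ((hNorm_add_le _ μ.2 (zext_integrable _)
      ((zext_integrable _).const_mul _)).trans ?_)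
    rw [hNorm_smul]
    have : ‖(-1 : ℝ)‖ₑ = 1 := by simp
    rw [this, one_mul]
    exact add_le_add (hφ n).le (hφ m).le
  have hc : CauchySeq fun n => energyIncl μ (φ n) := by
    rw [EMetric.cauchySeq_iff_le_tendsto_0]
    refine ⟨fun N => ((N : ℝ≥0∞) + 1)⁻¹ + ((N : ℝ≥0∞) + 1)⁻¹, fun m n N hm hn => ?_, ?_⟩
    · refine (hdist m n).trans ?_
      have : ∀ k : ℕ, N ≤ k → ((k : ℝ≥0∞) + 1)⁻¹ ≤ ((N : ℝ≥0∞) + 1)⁻¹ := fun k hk =>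
        ENNReal.inv_le_inv.2 (by gcongr)
      exact add_le_add (this n hn) (this m hm)
    · simpa using h0.add h0
  obtain ⟨e, he⟩ := cauchySeq_tendsto_of_complete hc
  refine ⟨e, tendsto_nhds_unique ?_ h2⟩
  simpa only [Function.comp_def, energyToL2_incl hμ] using ((energyToL2 μ).continuous.tendsto e).comp he

end Energy

/-! ### The mean-free derivative of I^β_θ as a bounded operator, and its adjoint. -/

section Operator
open Filter Topology

open scoped RealInnerProductSpace

variable {β θ : ℝ} {μ : ℝ≥0} {φ v w : ℝ → ℝ}

lemma integrable_mul_comp_sub (hk : LocallyIntegrable w) (hφ : IsCS φ) (x : ℝ) :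
    Integrable fun t => w t * φ (x - t) :=
  hφ.compact.convolutionExists_right (ContinuousLinearMap.mul ℝ ℝ) hk hφ.continuous x

lemma conv_add_right (hk : LocallyIntegrable w) (hφ : IsCS φ) (hv : IsCS v) (x : ℝ) :
    conv w (fun x => φ x + v x) x = conv w φ x + conv w v x := by
  simp only [conv, mul_add]
  exact integral_add (integrable_mul_comp_sub hk hφ x) (integrable_mul_comp_sub hk hv x)

lemma conv_const_mul_right (w φ : ℝ → ℝ) (c x : ℝ) :
    conv w (fun x => c * φ x) x = c * conv w φ x := by
  simp only [conv, mul_left_comm _ c]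
  exact integral_const_mul _ _

lemma kernel_eq (β θ t : ℝ) : kernel β θ t = θ * kernel β 1 t + (1 - θ) * kernel β 0 t := by
  unfold kernel
  split_ifs <;> ring

lemma conv_kernel_eq (hβ : 0 < β) (hβ1 : β < 1) (hφ : IsCS φ) (θ x : ℝ) :
    conv (kernel β θ) φ x = θ * conv (kernel β 1) φ x + (1 - θ) * conv (kernel β 0) φ x := by
  have i₁ := (integrable_mul_comp_sub (locallyIntegrable_kernel hβ hβ1 zero_le_one le_rfl) hφ x).const_mul θ
  have i₀ := (integrable_mul_comp_sub (locallyIntegrable_kernel hβ hβ1 le_rfl zero_le_one) hφ x).const_mul (1 - θ)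
  simp only [conv]
  rw [← integral_const_mul, ← integral_const_mul, ← integral_add i₁ i₀]
  refine integral_congr_ae (.of_forall fun t => ?_)
  dsimp only
  rw [kernel_eq]
  ring

lemma memLp_of_continuous {g : ℝ → ℝ} (hg : Continuous g) : MemLp g 2 vol01 := by
  obtain ⟨C, hC⟩ := (isCompact_Icc (a := (0 : ℝ)) (b := 1)).exists_bound_of_continuousOn hg.continuousOn
  refine MemLp.of_bound hg.aestronglyMeasurable C ?_
  filter_upwards [ae_restrict_mem measurableSet_Ioo] with x hx
  exact hC x (Ioo_subset_Icc_self hx)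

/-- The derivative of the convolution with a locally integrable kernel, restricted to `(0,1)`. -/
def convDeriv {w : ℝ → ℝ} (hk : LocallyIntegrable w) : testSpace →ₗ[ℝ] L2I where
  toFun φ := (memLp_of_continuous (continuous_conv hk (isTest_coe φ).deriv.isCS)).toLp (conv w (deriv φ))
  map_add' φ ψ :=
    have hφ := (isTest_coe φ).isCS
    have hψ := (isTest_coe ψ).isCS
    have mφ := memLp_of_continuous (continuous_conv hk hφ.deriv)
    have mψ := memLp_of_continuous (continuous_conv hk hψ.deriv)
    (MemLp.toLp_congr (memLp_of_continuous (continuous_conv hk (isTest_coe (φ + ψ)).deriv.isCS)) (mφ.add mψ)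
      (.of_forall fun x => by
        have h : deriv ((φ + ψ : testSpace) : ℝ → ℝ)
            = fun x => deriv (φ : ℝ → ℝ) x + deriv (ψ : ℝ → ℝ) x :=
          funext fun x => deriv_add (hφ.differentiable x) (hψ.differentiable x)
        rw [h, conv_add_right hk hφ.deriv hψ.deriv]
        rfl)).trans (MemLp.toLp_add mφ mψ)
  map_smul' c φ :=
    have hφ := (isTest_coe φ).isCS
    have mφ := memLp_of_continuous (continuous_conv hk hφ.deriv)
    (MemLp.toLp_congr (memLp_of_continuous (continuous_conv hk (isTest_coe (c • φ)).deriv.isCS)) (mφ.const_smul c)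
      (.of_forall fun x => by
        have h : deriv ((c • φ : testSpace) : ℝ → ℝ) = fun x => c * deriv (φ : ℝ → ℝ) x :=
          funext fun x => deriv_const_smul c (hφ.differentiable x)
        rw [h, conv_const_mul_right]
        rfl)).trans (MemLp.toLp_const_smul c mφ)

lemma coeFn_convDeriv (hk : LocallyIntegrable w) (φ : testSpace) :
    convDeriv hk φ =ᵐ[vol01] conv w (deriv φ) :=
  (memLp_of_continuous (continuous_conv hk (isTest_coe φ).deriv.isCS)).coeFn_toLp

lemma inner_meanFree_convDeriv (hk : LocallyIntegrable w) (φ v : testSpace) :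
    ⟪meanFree (convDeriv hk φ), testDeriv v⟫ = ∫ x, conv w (deriv φ) x * deriv v x := by
  rw [meanFree_inner, inner_testDeriv, ← (isTest_coe v).deriv.mul_setIntegral_eq]
  refine integral_congr_ae ?_
  filter_upwards [coeFn_convDeriv hk φ] with x hx
  rw [hx]

/-- The derivative of the convolution falls on φ; the mean removed from it is the slope of the
affine interpolant of the boundary values. -/
lemma conv_eq_affine_add_integral (hk : LocallyIntegrable w) (φ : testSpace) {x : ℝ} (hx : x ∈ Icc (0 : ℝ) 1) :
    conv w φ x = conv w φ 0 * (1 - x) + conv w φ 1 * x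
      + ∫ s in (0 : ℝ)..x, (meanFree (convDeriv hk φ) : L2I) s := by
  have hφ := (isTest_coe φ).isCS
  have hprim : ∀ y : ℝ, ∫ s in (0 : ℝ)..y, conv w (deriv φ) s = conv w φ y - conv w φ 0 := fun y =>
    intervalIntegral.integral_eq_sub_of_hasDerivAt (fun s _ => hasDerivAt_conv hk hφ s)
      ((continuous_conv hk hφ.deriv).intervalIntegrable _ _)
  have hmean : ∫ s in Ioo (0 : ℝ) 1, convDeriv hk φ s = conv w φ 1 - conv w φ 0 := by
    rw [← hprim 1, intervalIntegral.integral_of_le zero_le_one, integral_Ioc_eq_integral_Ioo]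
    exact integral_congr_ae (coeFn_convDeriv hk φ)
  have hae : ∀ᵐ s ∂vol01, (meanFree (convDeriv hk φ) : L2I) s
      = conv w (deriv φ) s - (conv w φ 1 - conv w φ 0) := by
    rw [coe_meanFree, hmean]
    filter_upwards [Lp.coeFn_sub (convDeriv hk φ) ((conv w φ 1 - conv w φ 0) • oneL2),
      Lp.coeFn_smul (conv w φ 1 - conv w φ 0) oneL2, coeFn_oneL2, coeFn_convDeriv hk φ] with s h1 h2 h3 h4
    rw [h1, Pi.sub_apply, h2, Pi.smul_apply, h3, h4, smul_eq_mul, mul_one]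
  have hint : ∫ s in (0 : ℝ)..x, (meanFree (convDeriv hk φ) : L2I) s
      = ∫ s in (0 : ℝ)..x, (conv w (deriv φ) s - (conv w φ 1 - conv w φ 0)) := by
    rw [intervalIntegral.integral_of_le hx.1, intervalIntegral.integral_of_le hx.1,
      integral_Ioc_eq_integral_Ioo, integral_Ioc_eq_integral_Ioo]
    exact integral_congr_ae (ae_restrict_of_ae_restrict_of_subset (Ioo_subset_Ioo_right hx.2) hae)
  rw [hint, intervalIntegral.integral_sub ((continuous_conv hk hφ.deriv).intervalIntegrable _ _)
    intervalIntegrable_const, hprim, intervalIntegral.integral_const, smul_eq_mul]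
  ring

/-- By duality: the norm is tested against the dense set of derivatives of test functions, where the
pairing is the Fourier form and is bounded on H^{1-β} × H¹ with constant 1. -/
lemma norm_meanFree_convDeriv_le (hβ : 0 < β) (hβ1 : β < 1) (hθ : 0 ≤ θ) (hθ' : θ ≤ 1) (hμ : (μ : ℝ) = 1 - β)
    (φ : testSpace) :
    ‖meanFree (convDeriv (locallyIntegrable_kernel hβ hβ1 hθ hθ') φ)‖ ≤ 1 * ‖energyIncl μ φ‖ := by
  set g := meanFree (convDeriv (locallyIntegrable_kernel hβ hβ1 hθ hθ') φ) with hg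
  have h : ∀ q, ⟪g, q⟫ ≤ ‖energyIncl μ φ‖ * ‖q‖ := by
    intro q
    refine denseRange_testDeriv.induction_on (p := fun q => ⟪g, q⟫ ≤ ‖energyIncl μ φ‖ * ‖q‖) q
      (isClosed_le (by fun_prop) (by fun_prop)) fun v => ?_
    rw [hg, inner_meanFree_convDeriv, integral_conv_kernel_mul hβ hβ1 hθ hθ' (isTest_coe φ).isCS (isTest_coe v).isCS]
    have h1 := fracForm_sq_le hβ hβ1 hθ hθ' (isTest_coe φ).isCS (isTest_coe v).isCS
    rw [← hμ, ← norm_energyIncl_sq, ← norm_testDeriv_sq, ← mul_pow] at h1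
    exact le_of_abs_le (abs_le_of_sq_le_sq h1 (by positivity))
  have h2 := h g
  rw [real_inner_self_eq_norm_mul_norm] at h2
  rw [one_mul]
  rcases eq_or_ne ‖g‖ 0 with h0 | h0
  · rw [h0]; exact norm_nonneg _
  · exact le_of_mul_le_mul_right h2 (lt_of_le_of_ne (norm_nonneg _) h0.symm)

/-- The operator `u ↦ (I^β_θ u)'`, modulo constants. -/
def fracDeriv (μ : ℝ≥0) (hβ : 0 < β) (hβ1 : β < 1) (hθ : 0 ≤ θ) (hθ' : θ ≤ 1) :
    energySpace μ →L[ℝ] meanZero :=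
  (meanFree ∘ₗ convDeriv (locallyIntegrable_kernel hβ hβ1 hθ hθ')).extendOfNorm (energyIncl μ)

lemma fracDeriv_incl (hβ : 0 < β) (hβ1 : β < 1) (hθ : 0 ≤ θ) (hθ' : θ ≤ 1) (hμ : (μ : ℝ) = 1 - β)
    (φ : testSpace) : fracDeriv μ hβ hβ1 hθ hθ' (energyIncl μ φ)
      = meanFree (convDeriv (locallyIntegrable_kernel hβ hβ1 hθ hθ') φ) :=
  LinearMap.extendOfNorm_eq denseRange_energyIncl ⟨1, norm_meanFree_convDeriv_le hβ hβ1 hθ hθ' hμ⟩ φ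

lemma inner_fracDeriv (hβ : 0 < β) (hβ1 : β < 1) (hθ : 0 ≤ θ) (hθ' : θ ≤ 1) (hμ : (μ : ℝ) = 1 - β)
    (φ v : testSpace) :
    ⟪fracDeriv μ hβ hβ1 hθ hθ' (energyIncl μ φ), testDeriv v⟫ = fracForm β θ φ v := by
  rw [fracDeriv_incl hβ hβ1 hθ hθ' hμ, inner_meanFree_convDeriv,
    integral_conv_kernel_mul hβ hβ1 hθ hθ' (isTest_coe φ).isCS (isTest_coe v).isCS]

lemma fracDeriv_eq (hβ : 0 < β) (hβ1 : β < 1) (hθ : 0 ≤ θ) (hθ' : θ ≤ 1) (hμ : (μ : ℝ) = 1 - β) :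
    fracDeriv μ hβ hβ1 hθ hθ' = θ • fracDeriv μ hβ hβ1 zero_le_one le_rfl
      + (1 - θ) • fracDeriv μ hβ hβ1 le_rfl zero_le_one := by
  have k₁ := locallyIntegrable_kernel hβ hβ1 zero_le_one le_rfl
  have k₀ := locallyIntegrable_kernel hβ hβ1 le_rfl zero_le_one
  ext1 e
  refine denseRange_energyIncl.induction_on (p := fun e => fracDeriv μ hβ hβ1 hθ hθ' e
    = (θ • fracDeriv μ hβ hβ1 zero_le_one le_rfl + (1 - θ) • fracDeriv μ hβ hβ1 le_rfl zero_le_one) e) e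
    (isClosed_eq (by fun_prop) (by fun_prop)) fun φ => ?_
  simp only [add_apply, smul_apply, fracDeriv_incl hβ hβ1 _ _ hμ]
  rw [← map_smul meanFree, ← map_smul meanFree, ← map_add meanFree]
  congr 1
  refine Lp.ext ?_
  filter_upwards [coeFn_convDeriv (locallyIntegrable_kernel hβ hβ1 hθ hθ') φ, coeFn_convDeriv k₁ φ,
    coeFn_convDeriv k₀ φ, Lp.coeFn_add (θ • convDeriv k₁ φ) ((1 - θ) • convDeriv k₀ φ),
    Lp.coeFn_smul θ (convDeriv k₁ φ), Lp.coeFn_smul (1 - θ) (convDeriv k₀ φ)] with x h1 h2 h3 h4 h5 h6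
  rw [h1, h4, Pi.add_apply, h5, h6, Pi.smul_apply, Pi.smul_apply, h2, h3,
    conv_kernel_eq hβ hβ1 (isTest_coe φ).deriv.isCS]
  rfl

lemma aestronglyMeasurable_coe (u : L2I) : AEStronglyMeasurable u vol01 := (Lp.memLp u).1

lemma twoSidedInt_energy (hβ : 0 < β) (hβ1 : β < 1) (hθ : 0 ≤ θ) (hθ' : θ ≤ 1) (hμ2 : 1 / 2 < (μ : ℝ))
    (e : energySpace μ) {x : ℝ} (hx : x ∈ Icc (0 : ℝ) 1) :
    twoSidedInt β θ (energyToL2 μ e) x = ∫ s in Ioo (0 : ℝ) 1, kernel β θ (x - s) * energyToL2 μ e s := by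
  obtain ⟨C, hC⟩ := abs_ae_le_of_energy hμ2 e
  exact twoSidedInt_eq hx (integrableOn_kernel_sub_mul hβ hβ1 hθ hθ' x (aestronglyMeasurable_coe _) hC)

/-- Convergence in the energy norm is uniform on (0,1) because μ > 1/2, and the kernel is
integrable; so I^β_θ passes to the limit at each point, endpoints included. -/
lemma exists_abs_conv_sub_twoSidedInt_le (hβ : 0 < β) (hβ1 : β < 1) (hθ : 0 ≤ θ) (hθ' : θ ≤ 1)
    (hμ2 : 1 / 2 < (μ : ℝ)) {x : ℝ} (hx : x ∈ Icc (0 : ℝ) 1) :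
    ∃ C, ∀ (φ : testSpace) (e : energySpace μ),
      |conv (kernel β θ) φ x - twoSidedInt β θ (energyToL2 μ e) x| ≤ C * ‖energyIncl μ φ - e‖ := by
  obtain ⟨C, hC0, hC⟩ := exists_ae_abs_sub_le hμ2
  have hk := integrableOn_kernel_sub hβ hβ1 hθ hθ' x
  refine ⟨(∫ s in Ioo (0 : ℝ) 1, |kernel β θ (x - s)|) * C, fun φ e => ?_⟩
  obtain ⟨M, hM⟩ := abs_ae_le_of_energy hμ2 e
  obtain ⟨M', -, hM'⟩ := (isTest_coe φ).isCS.bounded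
  rw [twoSidedInt_energy hβ hβ1 hθ hθ' hμ2 e hx, conv_eq_setIntegral _ (isTest_coe φ), ← integral_sub
    (integrableOn_kernel_sub_mul hβ hβ1 hθ hθ' x (isTest_coe φ).isCS.continuous.aestronglyMeasurable
      (.of_forall hM'))
    (integrableOn_kernel_sub_mul hβ hβ1 hθ hθ' x (aestronglyMeasurable_coe _) hM), mul_assoc, ← integral_mul_const,
    ← Real.norm_eq_abs]
  refine norm_integral_le_of_norm_le (hk.abs.mul_const _) ?_
  filter_upwards [hC φ e] with s hs
  rw [← mul_sub, norm_mul]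
  exact mul_le_mul_of_nonneg_left hs (abs_nonneg _)

/-- The two-sided fractional integral of an element of the energy space. -/
lemma twoSidedInt_eq_affine_add_integral (hβ : 0 < β) (hβ1 : β < 1) (hθ : 0 ≤ θ) (hθ' : θ ≤ 1)
    (hμ : (μ : ℝ) = 1 - β) (hμ2 : 1 / 2 < (μ : ℝ)) (e : energySpace μ) {x : ℝ} (hx : x ∈ Icc (0 : ℝ) 1) :
    twoSidedInt β θ (energyToL2 μ e) x = twoSidedInt β θ (energyToL2 μ e) 0 * (1 - x)
      + twoSidedInt β θ (energyToL2 μ e) 1 * x + ∫ s in (0 : ℝ)..x, (fracDeriv μ hβ hβ1 hθ hθ' e : L2I) s := by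
  have hμ0 : 0 < μ := by
    have : (0 : ℝ) < μ := by linarith
    exact_mod_cast this
  obtain ⟨φ, h1, -, -⟩ := exists_seq_tendsto_energy hμ0 e
  have h1' := tendsto_iff_norm_sub_tendsto_zero.1 h1
  -- The identity holds for test functions; it is passed to the limit using pointwise convergence at
  -- 0, 1 and x and continuity of the primitive in L².
  have hlim : ∀ y ∈ Icc (0 : ℝ) 1, Tendsto (fun n => conv (kernel β θ) (φ n) y) atTop
      (𝓝 (twoSidedInt β θ (energyToL2 μ e) y)) := by
    intro y hy
    obtain ⟨C, hC⟩ := exists_abs_conv_sub_twoSidedInt_le hβ hβ1 hθ hθ' hμ2 hy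
    rw [tendsto_iff_norm_sub_tendsto_zero]
    refine squeeze_zero (fun n => norm_nonneg _) (fun n => hC (φ n) e) ?_
    simpa using h1'.const_mul C
  have hint : Tendsto (fun n => ∫ s in (0 : ℝ)..x, (fracDeriv μ hβ hβ1 hθ hθ' (energyIncl μ (φ n)) : L2I) s) atTop
      (𝓝 (∫ s in (0 : ℝ)..x, (fracDeriv μ hβ hβ1 hθ hθ' e : L2I) s)) := by
    rw [tendsto_iff_norm_sub_tendsto_zero]
    have hA := tendsto_iff_norm_sub_tendsto_zero.1 (((fracDeriv μ hβ hβ1 hθ hθ').continuous.tendsto e).comp h1)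
    refine squeeze_zero (fun n => norm_nonneg _) (fun n => ?_) hA
    set a : L2I := ((fracDeriv μ hβ hβ1 hθ hθ' (energyIncl μ (φ n)) : meanZero) : L2I) with ha
    set b : L2I := ((fracDeriv μ hβ hβ1 hθ hθ' e : meanZero) : L2I) with hb
    have hii : ∀ q : L2I, IntervalIntegrable q volume 0 x := fun q => by
      rw [intervalIntegrable_iff_integrableOn_Ioo_of_le hx.1]
      exact (show IntegrableOn q (Ioo 0 1) volume from L2I.integrable q).mono_set (Ioo_subset_Ioo_right hx.2)
    have hsub : (∫ s in (0 : ℝ)..x, a s) - ∫ s in (0 : ℝ)..x, b s = ∫ s in (0 : ℝ)..x, (a - b) s := by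
      rw [← intervalIntegral.integral_sub (hii a) (hii b), intervalIntegral.integral_of_le hx.1,
        intervalIntegral.integral_of_le hx.1, integral_Ioc_eq_integral_Ioo, integral_Ioc_eq_integral_Ioo]
      refine integral_congr_ae (ae_restrict_of_ae_restrict_of_subset (Ioo_subset_Ioo_right hx.2) ?_)
      exact (Lp.coeFn_sub a b).symm
    rw [hsub]
    exact norm_integral_le_norm (a - b) hx
  have hL := hlim x hx
  have hR := (((hlim 0 (by simp)).mul_const (1 - x)).add ((hlim 1 (by simp)).mul_const x)).add hint
  refine tendsto_nhds_unique hL (hR.congr fun n => ?_)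
  rw [fracDeriv_incl hβ hβ1 hθ hθ' hμ]
  exact (conv_eq_affine_add_integral (locallyIntegrable_kernel hβ hβ1 hθ hθ') (φ n) hx).symm

lemma exists_seminormSq_le (hβ : 0 < β) (hβ1 : β < 1) :
    ∃ Q, 0 ≤ Q ∧ ∀ v, IsCS v → seminormSq (1 - β) v ≤ seminormSq 1 v + Q * ∫ x, v x ^ 2 := by
  obtain ⟨Q, hQ, h⟩ := exists_rpow_le_mul_sq_add (p := 2 * (1 - β)) (by linarith) (by linarith) one_pos
  refine ⟨Q, hQ, fun v hv => ?_⟩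
  have i₁ := integrable_seminormSq hv zero_le_one
  have i₂ := (integrable_norm_hat_sq hv).const_mul Q
  rw [← integral_norm_hat_sq hv, seminormSq, seminormSq, ← integral_const_mul, ← integral_add i₁ i₂]
  refine integral_mono (integrable_seminormSq hv (by linarith)) (i₁.add i₂) fun ξ => ?_
  have := h |2 * Real.pi * ξ| (abs_nonneg _)
  rw [one_mul] at this
  simp only [mul_one, Real.rpow_two]
  rw [← add_mul]
  exact mul_le_mul_of_nonneg_right this (sq_nonneg _)

/-- The adjoints of the operators are bounded below, uniformly in `θ`. -/
lemma exists_adjoint_fracDeriv_lower_bound (hβ : 0 < β) (hβ1 : β < 1) (hβ2 : β < 1 / 2) (hμ : (μ : ℝ) = 1 - β) :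
    ∃ c, 0 < c ∧ ∀ θ (hθ : 0 ≤ θ) (hθ' : θ ≤ 1) (q : meanZero),
      c * ‖q‖ ≤ ‖ContinuousLinearMap.adjoint (fracDeriv μ hβ hβ1 hθ hθ') q‖ := by
  obtain ⟨c, C, hc, hC, h₁⟩ := exists_test_fracForm_lower_bound hβ hβ2
  obtain ⟨d, hd, h₂⟩ := exists_fracForm_self_lower_bound hβ hβ1
  obtain ⟨P, hP, h₃⟩ := exists_poincare (μ := 1) one_pos
  obtain ⟨Q, hQ, h₄⟩ := exists_seminormSq_le hβ hβ1
  set D₁ := √(C * (1 + P)) with hD₁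
  set D₂ := √(1 + Q * P) with hD₂
  have hD₂0 : 0 < D₂ := Real.sqrt_pos.2 (by positivity)
  have hD₁0 : 0 ≤ D₁ := Real.sqrt_nonneg _
  have hDpos : 0 < D₁ + C * D₂ / d + 1 := by positivity
  refine ⟨c / (D₁ + C * D₂ / d + 1), by positivity, fun θ hθ hθ' q => ?_⟩
  refine denseRange_testDeriv.induction_on (p := fun q => c / (D₁ + C * D₂ / d + 1) * ‖q‖
    ≤ ‖ContinuousLinearMap.adjoint (fracDeriv μ hβ hβ1 hθ hθ') q‖) q (isClosed_le (by fun_prop) (by fun_prop))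
    fun v => ?_
  have hv := isTest_coe v
  set B := ContinuousLinearMap.adjoint (fracDeriv μ hβ hβ1 hθ hθ') with hB
  set a := ‖B (testDeriv v)‖ with ha
  set N := ‖testDeriv v‖ with hN
  have hN0 : 0 ≤ N := norm_nonneg _
  have ha0 : 0 ≤ a := norm_nonneg _
  -- The form is ⟨φ, A* v'⟩, so every test function φ gives a lower bound for the norm a of A* v'.
  have hform : ∀ φ : testSpace, fracForm β θ φ v ≤ a * ‖energyIncl μ φ‖ := by
    intro φ
    rw [← inner_fracDeriv hβ hβ1 hθ hθ' hμ, ← ContinuousLinearMap.adjoint_inner_right, mul_comm]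
    exact real_inner_le_norm _ _
  have hN2 : N ^ 2 = ∫ x, deriv (v : ℝ → ℝ) x ^ 2 := norm_testDeriv_sq v
  set m := ∫ x, (v : ℝ → ℝ) x ^ 2 with hm
  have hm0 : 0 ≤ m := integral_nonneg fun x => sq_nonneg _
  have hmP : m ≤ P * N ^ 2 := by
    have := h₃ v hv
    rwa [seminormSq_one hv.isCS, ← hN2] at this
  obtain ⟨u, hu, hu1, hu2⟩ := h₁ θ hθ hθ' v hv
  rw [← hN2, ← hm] at hu1 hu2
  have hju : ‖energyIncl μ ⟨u, hu⟩‖ ≤ D₁ * N := by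
    rw [← Real.sqrt_sq (norm_nonneg (energyIncl μ _)), norm_energyIncl_sq, ← Real.sqrt_sq hN0, hD₁,
      ← Real.sqrt_mul (by positivity)]
    refine Real.sqrt_le_sqrt ?_
    have e : seminormSq μ u = ∫ ξ, |2 * Real.pi * ξ| ^ (2 - 2 * β) * ‖hat u ξ‖ ^ 2 := by
      rw [seminormSq, hμ, show 2 * (1 - β) = 2 - 2 * β by ring]
    change seminormSq μ u ≤ _
    rw [e]
    refine hu1.trans ?_
    nlinarith
  have hjv : ‖energyIncl μ v‖ ≤ D₂ * N := by
    rw [← Real.sqrt_sq (norm_nonneg (energyIncl μ _)), norm_energyIncl_sq, ← Real.sqrt_sq hN0, hD₂,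
      ← Real.sqrt_mul (by positivity)]
    refine Real.sqrt_le_sqrt ?_
    have e := h₄ v hv.isCS
    rw [← hμ, ← hm] at e
    refine e.trans ?_
    rw [seminormSq_one hv.isCS, ← hN2]
    nlinarith
  -- Pairing with the localized inverse controls ‖v'‖² up to ‖v‖², and pairing with v itself
  -- controls ‖v‖². Both right-hand sides are multiples of aN, so substituting and dividing by N
  -- suffices, with no compactness argument.
  have h5 : c * N ^ 2 - C * m ≤ a * (D₁ * N) :=
    hu2.trans ((hform ⟨u, hu⟩).trans (mul_le_mul_of_nonneg_left hju ha0))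
  have h6 : d * m ≤ a * (D₂ * N) :=
    (h₂ θ hθ hθ' v hv).trans ((hform v).trans (mul_le_mul_of_nonneg_left hjv ha0))
  have h7 : m ≤ a * (D₂ * N) / d := by rw [le_div_iff₀ hd]; linarith
  have h8 : c * N ^ 2 ≤ (D₁ + C * D₂ / d + 1) * a * N := by
    have h9 : C * m ≤ C * (a * (D₂ * N) / d) := mul_le_mul_of_nonneg_left h7 hC
    have h10 : (D₁ + C * D₂ / d + 1) * a * N = a * (D₁ * N) + C * (a * (D₂ * N) / d) + a * N := by ring
    have h11 : 0 ≤ a * N := by positivity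
    linarith
  rw [div_mul_eq_mul_div, div_le_iff₀ hDpos]
  rcases eq_or_lt_of_le hN0 with h0 | h0
  · rw [← h0, mul_zero]; positivity
  · refine le_of_mul_le_mul_right (le_of_eq_of_le ?_ (h8.trans_eq ?_)) h0
    · rw [mul_assoc, sq]
    · rw [mul_comm a]

end Operator

/-! ### Abel inversion of the left fractional integral. -/

section Abel
open Filter Topology

variable {β : ℝ} {μ : ℝ≥0} {w : ℝ → ℝ}

lemma intervalIntegrable_beta (hβ : 0 < β) (hβ1 : β < 1) :
    IntervalIntegrable (fun r : ℝ => (1 - r) ^ (-β) * r ^ (β - 1)) volume 0 1 := by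
  have h := (Complex.betaIntegral_convergent (u := β) (v := ((1 - β : ℝ) : ℂ)) (by simpa) (by simpa)).norm
  rw [intervalIntegrable_iff_integrableOn_Ioo_of_le zero_le_one] at h ⊢
  refine h.congr_fun (fun r hr => ?_) measurableSet_Ioo
  dsimp only
  rw [norm_mul, show (1 : ℂ) - (r : ℂ) = ((1 - r : ℝ) : ℂ) by push_cast; ring,
    Complex.norm_cpow_eq_rpow_re_of_pos hr.1, Complex.norm_cpow_eq_rpow_re_of_pos (by linarith [hr.2]), mul_comm]
  simp

/-- The value of the Beta integral at `(β, 1 - β)`. -/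
def betaConst (β : ℝ) : ℝ := ∫ r in (0 : ℝ)..1, (1 - r) ^ (-β) * r ^ (β - 1)

lemma betaConst_pos (hβ : 0 < β) (hβ1 : β < 1) : 0 < betaConst β :=
  intervalIntegral.intervalIntegral_pos_of_pos_on (intervalIntegrable_beta hβ hβ1)
    (fun r hr => mul_pos (Real.rpow_pos_of_pos (by linarith [hr.2]) _) (Real.rpow_pos_of_pos hr.1 _)) one_pos

/-- The exponents -β and β-1 add up to -1, so the integral is scale invariant; this is what makes
the composed kernel constant. -/
lemma integral_rpow_mul_rpow {s y : ℝ} (hsy : s < y) (β : ℝ) :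
    ∫ x in s..y, (y - x) ^ (-β) * (x - s) ^ (β - 1) = betaConst β := by
  have hd : 0 < y - s := by linarith
  have h := intervalIntegral.integral_comp_mul_add (a := 0) (b := 1)
    (fun x => (y - x) ^ (-β) * (x - s) ^ (β - 1)) hd.ne' s
  rw [mul_zero, zero_add, mul_one, sub_add_cancel, smul_eq_mul] at h
  have h2 : ∫ r in (0 : ℝ)..1, (y - ((y - s) * r + s)) ^ (-β) * ((y - s) * r + s - s) ^ (β - 1)
      = (y - s)⁻¹ * betaConst β := by
    rw [betaConst, ← intervalIntegral.integral_const_mul]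
    refine intervalIntegral.integral_congr_ae (.of_forall fun r hr => ?_)
    rw [uIoc_of_le zero_le_one] at hr
    rw [show y - ((y - s) * r + s) = (y - s) * (1 - r) by ring, add_sub_cancel_right,
      Real.mul_rpow hd.le (by linarith [hr.2]), Real.mul_rpow hd.le hr.1.le, mul_mul_mul_comm, ← Real.rpow_add hd,
      show -β + (β - 1) = -1 by ring, Real.rpow_neg_one]
  rw [h2] at h
  exact (mul_left_cancel₀ (inv_ne_zero hd.ne') h).symm

lemma integral_rpow_mul_self {y : ℝ} (hy : 0 < y) (β : ℝ) :
    ∫ x in (0 : ℝ)..y, (y - x) ^ (-β) * x = y ^ (2 - β) * ∫ r in (0 : ℝ)..1, (1 - r) ^ (-β) * r := by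
  have h := intervalIntegral.integral_comp_mul_left (a := 0) (b := 1) (fun x => (y - x) ^ (-β) * x) hy.ne'
  rw [mul_zero, mul_one, smul_eq_mul] at h
  have h2 : ∫ r in (0 : ℝ)..1, (y - y * r) ^ (-β) * (y * r)
      = y ^ (1 - β) * ∫ r in (0 : ℝ)..1, (1 - r) ^ (-β) * r := by
    rw [← intervalIntegral.integral_const_mul]
    refine intervalIntegral.integral_congr_ae (.of_forall fun r hr => ?_)
    rw [uIoc_of_le zero_le_one] at hr
    rw [show y - y * r = y * (1 - r) by ring, Real.mul_rpow hy.le (by linarith [hr.2]),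
      show 1 - β = -β + 1 by ring, Real.rpow_add_one hy.ne']
    ring
  rw [h2] at h
  rw [show 2 - β = (1 - β) + 1 by ring, Real.rpow_add_one hy.ne', mul_right_comm, h, mul_right_comm,
    inv_mul_cancel₀ hy.ne', one_mul]

/-- Inversion of the left fractional integral, in integrated form. -/
lemma integral_rpow_mul_leftInt (hβ : 0 < β) (hβ1 : β < 1) {C : ℝ} (hw : AEStronglyMeasurable w vol01)
    (hC : ∀ᵐ s ∂vol01, |w s| ≤ C) {y : ℝ} (hy : y ∈ Ioc (0 : ℝ) 1) :
    ∫ x in (0 : ℝ)..y, (y - x) ^ (-β) * leftInt β w x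
      = 1 / Real.Gamma β * (betaConst β * ∫ s in (0 : ℝ)..y, w s) := by
  set a : ℝ → ℝ := (Ioo 0 y).indicator fun x => (y - x) ^ (-β) with ha
  -- The kernel is written in the variable s - x to match a convolution integrand, and cut off at
  -- length 1 for integrability; only points of (0,1) at distance less than 1 occur.
  set k : ℝ → ℝ := (Ioo (-1 : ℝ) 0).indicator fun t => (-t) ^ (β - 1) with hk
  set u : ℝ → ℝ := (Ioo (0 : ℝ) 1).indicator w with hu
  have hai : Integrable a := by
    rw [ha, integrable_indicator_iff measurableSet_Ioo, ← intervalIntegrable_iff_integrableOn_Ioo_of_le hy.1.le]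
    have := (intervalIntegral.intervalIntegrable_rpow' (a := y) (b := 0) (show -1 < -β by linarith)).comp_sub_left y
    simpa using this
  have hki : Integrable k := by
    rw [hk, integrable_indicator_iff measurableSet_Ioo,
      ← intervalIntegrable_iff_integrableOn_Ioo_of_le (by norm_num)]
    have := (intervalIntegral.intervalIntegrable_rpow' (a := 1) (b := 0) (show -1 < β - 1 by linarith)).comp_sub_left 0
    simpa using this
  have hui : AEStronglyMeasurable u volume := (aestronglyMeasurable_indicator_iff measurableSet_Ioo).2 hw
  have hC' : ∀ᵐ s, |u s| ≤ max C 0 := by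
    filter_upwards [(ae_restrict_iff' measurableSet_Ioo).1 hC] with s hs
    by_cases hm : s ∈ Ioo (0 : ℝ) 1
    · rw [hu, indicator_of_mem hm]; exact (hs hm).trans (le_max_left _ _)
    · rw [hu, indicator_of_notMem hm, abs_zero]; exact le_max_right _ _
  have hI : Integrable (Function.uncurry fun s x => u s * (a x * k (s - x))) (volume.prod volume) := by
    have h1 := hai.convolution_integrand (ContinuousLinearMap.mul ℝ ℝ) hki
    exact h1.bdd_mul hui.comp_fst (Measure.quasiMeasurePreserving_fst.ae hC')
  have hswap := integral_integral_swap hI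
  have hL : ∀ s, ∫ x, u s * (a x * k (s - x)) = (Ioo 0 y).indicator (fun s => betaConst β * w s) s := by
    intro s
    rw [integral_const_mul]
    by_cases hs : s ∈ Ioo 0 y
    · have hs1 : s ∈ Ioo (0 : ℝ) 1 := ⟨hs.1, hs.2.trans_le hy.2⟩
      rw [indicator_of_mem hs, hu, indicator_of_mem hs1, mul_comm (betaConst β),
        ← integral_rpow_mul_rpow hs.2 β, intervalIntegral.integral_of_le hs.2.le, integral_Ioc_eq_integral_Ioo,
        ← integral_indicator measurableSet_Ioo]
      congr 1
      refine integral_congr_ae (.of_forall fun x => ?_)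
      dsimp only
      by_cases hx : x ∈ Ioo s y
      · have h1 : x ∈ Ioo 0 y := ⟨hs.1.trans hx.1, hx.2⟩
        have h2 : s - x ∈ Ioo (-1 : ℝ) 0 := ⟨by linarith [hs.1, hx.2, hy.2], by linarith [hx.1]⟩
        rw [indicator_of_mem hx, ha, hk, indicator_of_mem h1, indicator_of_mem h2, neg_sub]
      · rw [indicator_of_notMem hx, ha, hk]
        by_cases h1 : x ∈ Ioo 0 y
        · have h2 : s - x ∉ Ioo (-1 : ℝ) 0 := fun h => hx ⟨by linarith [h.2], h1.2⟩
          rw [indicator_of_notMem h2, mul_zero]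
        · rw [indicator_of_notMem h1, zero_mul]
    · rw [indicator_of_notMem hs]
      by_cases h0 : s ∈ Ioo (0 : ℝ) 1
      · have hys : y ≤ s := by
          by_contra! h
          exact hs ⟨h0.1, h⟩
        rw [integral_eq_zero_of_ae, mul_zero]
        refine .of_forall fun x => ?_
        by_cases h1 : x ∈ Ioo 0 y
        · have h2 : s - x ∉ Ioo (-1 : ℝ) 0 := fun h => by linarith [h.2, h1.2]
          simp [hk, indicator_of_notMem h2]
        · simp [ha, indicator_of_notMem h1]
      · rw [hu, indicator_of_notMem h0, zero_mul]
  have hR : ∀ x, ∫ s, u s * (a x * k (s - x))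
      = (Ioo 0 y).indicator (fun x => Real.Gamma β * ((y - x) ^ (-β) * leftInt β w x)) x := by
    intro x
    by_cases hx : x ∈ Ioo 0 y
    · rw [indicator_of_mem hx, leftInt, intervalIntegral.integral_of_le hx.1.le, integral_Ioc_eq_integral_Ioo]
      have hΓ := (Real.Gamma_pos_of_pos hβ).ne'
      have h1 : ∫ s, u s * (a x * k (s - x)) = a x * ∫ s in Ioo 0 x, w s / (x - s) ^ (1 - β) := by
        rw [← integral_const_mul, ← integral_indicator measurableSet_Ioo]
        refine integral_congr_ae (.of_forall fun s => ?_)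
        dsimp only
        by_cases hs : s ∈ Ioo 0 x
        · have h2 : s - x ∈ Ioo (-1 : ℝ) 0 := ⟨by linarith [hs.1, hx.2, hy.2], by linarith [hs.2]⟩
          have h3 : s ∈ Ioo (0 : ℝ) 1 := ⟨hs.1, by linarith [hs.2, hx.2, hy.2]⟩
          rw [indicator_of_mem hs, hu, hk, indicator_of_mem h2, indicator_of_mem h3, neg_sub,
            show β - 1 = -(1 - β) by ring, Real.rpow_neg (by linarith [hs.2])]
          ring
        · rw [indicator_of_notMem hs]
          by_cases h3 : s ∈ Ioo (0 : ℝ) 1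
          · have h2 : s - x ∉ Ioo (-1 : ℝ) 0 := fun h => hs ⟨h3.1, by linarith [h.2]⟩
            rw [hk, indicator_of_notMem h2, mul_zero, mul_zero]
          · rw [hu, indicator_of_notMem h3, zero_mul]
      rw [h1, ha, indicator_of_mem hx]
      field_simp
    · rw [indicator_of_notMem hx, ha, indicator_of_notMem hx]
      simp
  simp only [hL, hR] at hswap
  rw [integral_indicator measurableSet_Ioo, integral_indicator measurableSet_Ioo, integral_const_mul,
    integral_const_mul] at hswap
  rw [intervalIntegral.integral_of_le hy.1.le, intervalIntegral.integral_of_le hy.1.le,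
    integral_Ioc_eq_integral_Ioo, integral_Ioc_eq_integral_Ioo, hswap]
  have hΓ := (Real.Gamma_pos_of_pos hβ).ne'
  field_simp

/-- Bounded functions with linear left fractional integral are multiples of a power. -/
lemma exists_ae_eq_rpow (hβ : 0 < β) (hβ1 : β < 1) {C b : ℝ} (hw : AEStronglyMeasurable w vol01)
    (hC : ∀ᵐ s ∂vol01, |w s| ≤ C) (h : ∀ x ∈ Icc (0 : ℝ) 1, leftInt β w x = b * x) :
    ∃ c, ∀ᵐ x ∂vol01, w x = c * x ^ (1 - β) := by
  have hΓ := (Real.Gamma_pos_of_pos hβ).ne'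
  have hB := (betaConst_pos hβ hβ1).ne'
  -- Inversion yields the primitive of w as c y^{2-β}; Lebesgue differentiation then gives w, with
  -- the constant multiplied by 2 - β.
  set c := Real.Gamma β / betaConst β * (b * ∫ r in (0 : ℝ)..1, (1 - r) ^ (-β) * r) with hc
  have hint : ∀ y ∈ Ioc (0 : ℝ) 1, ∫ s in (0 : ℝ)..y, w s = c * y ^ (2 - β) := by
    intro y hy
    have h1 := integral_rpow_mul_leftInt hβ hβ1 hw hC hy
    have h2 : ∫ x in (0 : ℝ)..y, (y - x) ^ (-β) * leftInt β w x
        = b * ∫ x in (0 : ℝ)..y, (y - x) ^ (-β) * x := by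
      rw [← intervalIntegral.integral_const_mul]
      refine intervalIntegral.integral_congr fun x hx => ?_
      rw [uIcc_of_le hy.1.le] at hx
      rw [h x ⟨hx.1, hx.2.trans hy.2⟩]
      ring
    rw [h2, integral_rpow_mul_self hy.1] at h1
    rw [hc]
    field_simp at h1 ⊢
    linarith
  set u : ℝ → ℝ := (Ioo (0 : ℝ) 1).indicator w with hu
  have hui : Integrable u := (integrable_indicator_iff measurableSet_Ioo).2
    ((integrable_const C).mono' hw hC)
  refine ⟨c * (2 - β), (ae_restrict_iff' measurableSet_Ioo).2 ?_⟩
  filter_upwards [_root_.LocallyIntegrable.ae_hasDerivAt_integral hui.locallyIntegrable] with x hx hm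
  have h1 := hx 0
  have h2 : HasDerivAt (fun y => c * y ^ (2 - β)) (c * ((2 - β) * x ^ (2 - β - 1))) x :=
    (Real.hasDerivAt_rpow_const (Or.inl hm.1.ne')).const_mul c
  have h3 : (fun y => ∫ t in (0 : ℝ)..y, u t) =ᶠ[𝓝 x] fun y => c * y ^ (2 - β) := by
    filter_upwards [isOpen_Ioo.mem_nhds hm] with y hy
    rw [← hint y ⟨hy.1, hy.2.le⟩, intervalIntegral.integral_of_le hy.1.le, intervalIntegral.integral_of_le hy.1.le,
      integral_Ioc_eq_integral_Ioo, integral_Ioc_eq_integral_Ioo]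
    refine setIntegral_congr_fun measurableSet_Ioo fun s hs => ?_
    have hs1 : s ∈ Ioo (0 : ℝ) 1 := ⟨hs.1, hs.2.trans hy.2⟩
    exact indicator_of_mem hs1 _
  have h4 := h1.unique (h2.congr_of_eventuallyEq h3)
  rw [hu, indicator_of_mem hm] at h4
  rw [h4, show 2 - β - 1 = 1 - β by ring]
  ring

end Abel

/-! ### Bijectivity of the mean-free fractional derivative and the solution operator. -/

section Bijective
open Filter Topology

variable {β θ : ℝ} {μ : ℝ≥0}

lemma L2I.eq_zero_of_ae {u : L2I} (h : ∀ᵐ x ∂vol01, u x = 0) : u = 0 := by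
  refine Lp.ext ?_
  filter_upwards [h, Lp.coeFn_zero ℝ 2 vol01] with x hx h0
  rw [hx, h0]
  rfl

/-- A nonzero multiple of a power is not a uniform limit of functions vanishing near `1`. -/
lemma energyToL2_eq_zero_of_ae_eq_rpow (hβ : 0 < β) (hβ1 : β < 1) (hμ2 : 1 / 2 < (μ : ℝ)) (e : energySpace μ) {c : ℝ}
    (h : ∀ᵐ x ∂vol01, energyToL2 μ e x = c * x ^ (1 - β)) : energyToL2 μ e = 0 := by
  have hμ0 : 0 < μ := by
    have : (0 : ℝ) < μ := by linarith
    exact_mod_cast this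
  obtain ⟨C, hC0, hC⟩ := exists_ae_abs_sub_le hμ2
  obtain ⟨φ, h1, -, -⟩ := exists_seq_tendsto_energy hμ0 e
  -- At points x > 1/2 close enough to 1, φ_n vanishes while x^{1-β} ≥ x > 1/2, so the uniform
  -- distance to φ_n is at least |c|/2.
  have hle : ∀ n, |c| ≤ 2 * (C * ‖energyIncl μ (φ n) - e‖) := by
    intro n
    obtain ⟨δ, hδ, hm⟩ := (isTest_coe (φ n)).exists_margin
    have hlt : max (1 / 2) (1 - δ) < 1 := max_lt (by norm_num) (by linarith)
    have hsub : Ioo (max (1 / 2) (1 - δ)) 1 ⊆ Ioo (0 : ℝ) 1 :=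
      Ioo_subset_Ioo_left (le_trans (by norm_num) (le_max_left _ _))
    have hae := ae_restrict_of_ae_restrict_of_subset hsub (h.and (hC (φ n) e))
    have hne : (ae (volume.restrict (Ioo (max (1 / 2) (1 - δ)) 1))).NeBot := by
      rw [ae_restrict_neBot, Real.volume_Ioo]
      simpa using hlt
    obtain ⟨x, ⟨hx1, hx2⟩, hx3⟩ := (hae.and (ae_restrict_mem measurableSet_Ioo)).exists
    have hx4 : 1 / 2 < x := (le_max_left _ _).trans_lt hx3.1
    have hx5 : (φ n : ℝ → ℝ) x = 0 := hm x fun hx => by linarith [hx.2, (le_max_right (1 / 2) (1 - δ)).trans_lt hx3.1]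
    have hx6 : x ≤ x ^ (1 - β) := by
      conv_lhs => rw [← Real.rpow_one x]
      exact Real.rpow_le_rpow_of_exponent_ge (by linarith) hx3.2.le (by linarith)
    rw [hx1, hx5, zero_sub, abs_neg, abs_mul, abs_of_pos (by linarith : 0 < x ^ (1 - β))] at hx2
    nlinarith [abs_nonneg c]
  have hlim : Tendsto (fun n => 2 * (C * ‖energyIncl μ (φ n) - e‖)) atTop (𝓝 0) := by
    simpa using ((tendsto_iff_norm_sub_tendsto_zero.1 h1).const_mul C).const_mul 2
  have hc : c = 0 := abs_eq_zero.1 (le_antisymm (ge_of_tendsto' hlim hle) (abs_nonneg c))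
  refine L2I.eq_zero_of_ae ?_
  filter_upwards [h] with x hx
  rw [hx, hc, zero_mul]

lemma twoSidedInt_zero_right (β θ : ℝ) (w : ℝ → ℝ) : twoSidedInt β θ w 0 = (1 - θ) * rightInt β w 0 := by
  simp [twoSidedInt, leftInt]

lemma twoSidedInt_one_right (β θ : ℝ) (w : ℝ → ℝ) : twoSidedInt β θ w 1 = θ * leftInt β w 1 := by
  simp [twoSidedInt, rightInt]

/-- The left integral vanishes at 0, so a vanishing mean-free derivative leaves a linear function
through the origin, and Abel inversion applies. -/
lemma fracDeriv_left_injective (hβ : 0 < β) (hβ1 : β < 1) (hμ : (μ : ℝ) = 1 - β) (hμ2 : 1 / 2 < (μ : ℝ)) :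
    Function.Injective (fracDeriv μ hβ hβ1 zero_le_one le_rfl) := by
  have hμ0 : 0 < μ := by
    have : (0 : ℝ) < μ := by linarith
    exact_mod_cast this
  rw [injective_iff_map_eq_zero]
  intro e he
  refine energyToL2_injective hμ0 ?_
  rw [map_zero]
  obtain ⟨C, hC⟩ := abs_ae_le_of_energy hμ2 e
  have hI : ∀ x ∈ Icc (0 : ℝ) 1,
      leftInt β (energyToL2 μ e) x = twoSidedInt β 1 (energyToL2 μ e) 1 * x := by
    intro x hx
    have h1 := twoSidedInt_eq_affine_add_integral hβ hβ1 zero_le_one le_rfl hμ hμ2 e hx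
    have h2 : ∫ s in (0 : ℝ)..x, (fracDeriv μ hβ hβ1 zero_le_one le_rfl e : L2I) s = 0 := by
      have := norm_integral_le_norm (fracDeriv μ hβ hβ1 zero_le_one le_rfl e : L2I) hx
      rw [he] at this ⊢
      simpa using this
    rw [h2, twoSidedInt_zero_right] at h1
    have h3 : twoSidedInt β 1 (energyToL2 μ e) x = leftInt β (energyToL2 μ e) x := by simp [twoSidedInt]
    rw [← h3, h1]
    ring
  obtain ⟨c, hc⟩ := exists_ae_eq_rpow hβ hβ1 (aestronglyMeasurable_coe _) hC hI
  exact energyToL2_eq_zero_of_ae_eq_rpow hβ hβ1 hμ2 e hc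

/-- The two-sided fractional derivative is an isomorphism modulo constants. -/
lemma fracDeriv_bijective (hβ : 0 < β) (hβ1 : β < 1) (hβ2 : β < 1 / 2) (hθ : 0 ≤ θ) (hθ' : θ ≤ 1)
    (hμ : (μ : ℝ) = 1 - β) : Function.Bijective (fracDeriv μ hβ hβ1 hθ hθ') := by
  obtain ⟨c, hc, h⟩ := exists_adjoint_fracDeriv_lower_bound hβ hβ1 hβ2 hμ
  rw [fracDeriv_eq hβ hβ1 hθ hθ' hμ]
  refine bijective_of_segment _ _ hc (fun t ht ht' q => ?_)
    (fracDeriv_left_injective hβ hβ1 hμ (by rw [hμ]; linarith)) hθ hθ'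
  rw [← fracDeriv_eq hβ hβ1 ht ht' hμ]
  exact h t ht ht' q

/-- Every mean-free `L²` function is, modulo constants, the derivative of the two-sided fractional integral of a unique
function. -/
lemma exists_solution_operator (hβ : 0 < β) (hβ2 : β < 1 / 2) (hθ : 0 ≤ θ) (hθ' : θ ≤ 1) :
    ∃ (R : meanZero →ₗ[ℝ] L2I) (m : ℝ → meanZero →ₗ[ℝ] ℝ), (∀ u, u ∈ H0 (1 - β).toNNReal ↔ ∃ q, R q = u) ∧
      ∀ q, ∀ x ∈ Icc (0 : ℝ) 1, twoSidedInt β θ (R q) x = m x q ∧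
        m x q = m 0 q * (1 - x) + m 1 q * x + ∫ s in (0 : ℝ)..x, (q : L2I) s := by
  have hβ1 : β < 1 := by linarith
  set μ := (1 - β).toNNReal with hμd
  have hμ : (μ : ℝ) = 1 - β := Real.coe_toNNReal _ (by linarith)
  have hμ2 : 1 / 2 < (μ : ℝ) := by rw [hμ]; linarith
  have hμ0 : 0 < μ := by
    have : (0 : ℝ) < μ := by linarith
    exact_mod_cast this
  let S : energySpace μ ≃ₗ[ℝ] meanZero :=
    LinearEquiv.ofBijective (fracDeriv μ hβ hβ1 hθ hθ').toLinearMap (fracDeriv_bijective hβ hβ1 hβ2 hθ hθ' hμ)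
  let R : meanZero →ₗ[ℝ] L2I := (energyToL2 μ).toLinearMap ∘ₗ S.symm.toLinearMap
  have hS : ∀ q, fracDeriv μ hβ hβ1 hθ hθ' (S.symm q) = q := fun q => S.apply_symm_apply q
  have hRi : ∀ q x, IntegrableOn (fun s => kernel β θ (x - s) * R q s) (Ioo 0 1) := by
    intro q x
    obtain ⟨C, hC⟩ := abs_ae_le_of_energy hμ2 (S.symm q)
    exact integrableOn_kernel_sub_mul hβ hβ1 hθ hθ' x (aestronglyMeasurable_coe _) hC
  -- The integral over (0,1) is linear in q for every x; on [0,1] it is the value of the two-sided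
  -- integral, so boundary values become linear functionals.
  let m : ℝ → meanZero →ₗ[ℝ] ℝ := fun x =>
    { toFun := fun q => ∫ s in Ioo (0 : ℝ) 1, kernel β θ (x - s) * R q s
      map_add' := fun q q' => by
        rw [← integral_add (hRi q x) (hRi q' x)]
        refine integral_congr_ae ?_
        rw [map_add]
        filter_upwards [Lp.coeFn_add (R q) (R q')] with s hs
        rw [hs, Pi.add_apply, mul_add]
      map_smul' := fun c q => by
        rw [RingHom.id_apply, smul_eq_mul, ← integral_const_mul]
        refine integral_congr_ae ?_
        rw [map_smul]
        filter_upwards [Lp.coeFn_smul c (R q)] with s hs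
        rw [hs, Pi.smul_apply, smul_eq_mul]
        ring }
  have hm : ∀ q, ∀ x ∈ Icc (0 : ℝ) 1, twoSidedInt β θ (R q) x = m x q := fun q x hx => twoSidedInt_eq hx (hRi q x)
  refine ⟨R, m, fun u => ⟨fun hu => ?_, ?_⟩, fun q x hx => ⟨hm q x hx, ?_⟩⟩
  · obtain ⟨e, he⟩ := exists_energyToL2_eq hμ0 hu
    exact ⟨S e, by rw [← he]; exact congrArg (energyToL2 μ) (S.symm_apply_apply e)⟩
  · rintro ⟨q, rfl⟩
    exact energyToL2_mem_H0 hμ0 _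
  · rw [← hm q x hx, ← hm q 0 (by simp), ← hm q 1 (by simp)]
    have := twoSidedInt_eq_affine_add_integral hβ hβ1 hθ hθ' hμ hμ2 (S.symm q) hx
    rwa [hS] at this

end Bijective

/-! ### Weak derivatives and primitives on (0,1). -/

section WeakDeriv
open Filter Topology

open scoped RealInnerProductSpace

variable {F : ℝ → ℝ} {G G' q : L2I}

lemma HasWeakDeriv.unique (h : HasWeakDeriv F G) (h' : HasWeakDeriv F G') : G = G' := by
  have key := isOpen_Ioo.ae_eq_zero_of_integral_contDiff_smul_eq_zero (μ := volume) (U := Ioo (0 : ℝ) 1)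
    (f := (G - G' : L2I)) (IntegrableOn.locallyIntegrableOn (L2I.integrable (G - G'))) ?_
  · refine sub_eq_zero.1 (L2I.eq_zero_of_ae ((ae_restrict_iff' measurableSet_Ioo).2 key))
  intro v h1 h2 h3
  have hv : IsTest v := ⟨h1, h2, h3⟩
  have e1 := inner_toLp hv.memLp (G - G')
  rw [inner_sub_right, inner_toLp, inner_toLp] at e1
  have e2 := h.2 v hv
  have e3 := h'.2 v hv
  have e4 : ∫ x, v x • (G - G' : L2I) x = ∫ x in Ioo (0 : ℝ) 1, v x * (G - G' : L2I) x :=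
    (setIntegral_eq_integral_of_forall_compl_eq_zero fun x hx => by
      rw [hv.eq_zero_of_notMem hx, zero_smul]).symm
  rw [e4, ← e1]
  simp only [mul_comm (v _)]
  linarith

lemma continuous_integral_zext (q : L2I) : Continuous fun x => ∫ s in (0 : ℝ)..x, zext q s :=
  intervalIntegral.continuous_primitive (fun _ _ => (zext_integrable q).intervalIntegrable) 0

lemma integral_zext_eq (q : L2I) {x : ℝ} (hx : x ∈ Icc (0 : ℝ) 1) :
    ∫ s in (0 : ℝ)..x, zext q s = ∫ s in (0 : ℝ)..x, q s := by
  rw [intervalIntegral.integral_of_le hx.1, intervalIntegral.integral_of_le hx.1, integral_Ioc_eq_integral_Ioo,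
    integral_Ioc_eq_integral_Ioo]
  refine setIntegral_congr_fun measurableSet_Ioo fun s hs => ?_
  have hs1 : s ∈ Ioo (0 : ℝ) 1 := ⟨hs.1, hs.2.trans_le hx.2⟩
  exact indicator_of_mem hs1 _

/-- Primitives of `L²` functions are weakly differentiable. -/
lemma hasWeakDeriv_of_eq_integral {a : ℝ} (h : ∀ x ∈ Icc (0 : ℝ) 1, F x = a + ∫ s in (0 : ℝ)..x, q s) :
    HasWeakDeriv F q := by
  set P : ℝ → ℝ := fun x => ∫ s in (0 : ℝ)..x, zext q s with hP
  have hFP : ∀ x ∈ Ioo (0 : ℝ) 1, F x = a + P x := fun x hx => by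
    rw [h x (Ioo_subset_Icc_self hx), hP]
    dsimp only
    rw [integral_zext_eq q (Ioo_subset_Icc_self hx)]
  have hPc : Continuous P := continuous_integral_zext q
  refine ⟨?_, fun v hv => ?_⟩
  · refine (memLp_of_continuous (continuous_const.add hPc) (g := fun x => a + P x)).ae_eq ?_
    filter_upwards [ae_restrict_mem measurableSet_Ioo] with x hx
    exact (hFP x hx).symm
  -- A primitive of an L² function is absolutely continuous, so integration by parts holds; the
  -- boundary terms vanish with v.
  have hac : AbsolutelyContinuousOnInterval P 0 1 :=
    ((zext_integrable q).intervalIntegrable).absolutelyContinuousOnInterval_intervalIntegral (by simp)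
  have hvac : AbsolutelyContinuousOnInterval v 0 1 :=
    ((hv.1.of_le (by simp)).contDiffOn).absolutelyContinuousOnInterval
  have hparts := hac.integral_mul_deriv_eq_deriv_mul hvac
  rw [hv.eq_zero_of_notMem (x := 0) (by simp), hv.eq_zero_of_notMem (x := 1) (by simp),
    intervalIntegral.integral_of_le zero_le_one, intervalIntegral.integral_of_le zero_le_one,
    integral_Ioc_eq_integral_Ioo, integral_Ioc_eq_integral_Ioo] at hparts
  have hd : ∀ᵐ x ∂vol01, deriv P x = q x := by
    refine (ae_restrict_iff' measurableSet_Ioo).2 ?_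
    filter_upwards [_root_.LocallyIntegrable.ae_hasDerivAt_integral (zext_integrable q).locallyIntegrable] with x hx hm
    rw [(hx 0).deriv, zext, indicator_of_mem hm]
  have e1 : ∫ x in Ioo (0 : ℝ) 1, deriv P x * v x = ∫ x in Ioo (0 : ℝ) 1, q x * v x := by
    refine integral_congr_ae ?_
    filter_upwards [hd] with x hx
    rw [hx]
  have i₁ : IntegrableOn (fun x => a * deriv v x) (Ioo 0 1) := (hv.deriv.integrable.const_mul a).integrableOn
  have i₂ : IntegrableOn (fun x => P x * deriv v x) (Ioo 0 1) :=
    ((hPc.mul hv.deriv.1.continuous).continuousOn.integrableOn_compact isCompact_Icc).mono_set Ioo_subset_Icc_self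
  have e2 : ∫ x in Ioo (0 : ℝ) 1, F x * deriv v x
      = ∫ x in Ioo (0 : ℝ) 1, (a * deriv v x + P x * deriv v x) :=
    setIntegral_congr_fun measurableSet_Ioo fun x hx => by
      rw [hFP x hx, add_mul]
  rw [e2, integral_add i₁ i₂, integral_const_mul, hv.deriv.setIntegral_eq, hv.integral_deriv, hparts, e1]
  ring

/-- Continuous weakly differentiable functions are primitives. -/
lemma HasWeakDeriv.eq_add_integral (h : HasWeakDeriv F G) (hF : ContinuousOn F (Icc 0 1)) {x : ℝ}
    (hx : x ∈ Icc (0 : ℝ) 1) : F x = F 0 + ∫ s in (0 : ℝ)..x, G s := by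
  set P : ℝ → ℝ := fun x => ∫ s in (0 : ℝ)..x, zext G s with hP
  have hPc : Continuous P := continuous_integral_zext G
  have hPw : HasWeakDeriv P G := hasWeakDeriv_of_eq_integral (a := 0) fun x hx => by
    rw [zero_add, ← integral_zext_eq G hx]
  have hFi := h.1.integrable (by norm_num)
  have hPi := hPw.1.integrable (by norm_num)
  obtain ⟨c, hc⟩ := eq_const_of_integral_mul_deriv_eq_zero (hFi.sub hPi) fun v hv => by
    obtain ⟨C, -, hC⟩ := hv.deriv.isCS.bounded
    have hb : ∀ {g : ℝ → ℝ}, Integrable g vol01 → Integrable (fun x => g x * deriv v x) vol01 := fun hg =>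
      hg.mul_bdd hv.deriv.1.continuous.aestronglyMeasurable (.of_forall hC)
    simp only [Pi.sub_apply, sub_mul]
    rw [integral_sub (hb hFi) (hb hPi), h.2 v hv, hPw.2 v hv, sub_self]
  -- Equality almost everywhere becomes equality on the closed interval by continuity, which makes
  -- the boundary values of F meaningful.
  have heq : EqOn F (fun x => P x + c) (Icc 0 1) := by
    refine Measure.eqOn_Icc_of_ae_eq volume zero_ne_one ?_ hF (hPc.add continuous_const).continuousOn
    rw [restrict_Ioo_eq_restrict_Icc.symm]
    filter_upwards [hc] with x hx
    simp only [Pi.sub_apply] at hx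
    linarith
  have h0 := heq (left_mem_Icc.2 zero_le_one)
  have hx' := heq hx
  have hP0 : P 0 = 0 := intervalIntegral.integral_same
  simp only [hP0] at h0
  rw [hx', h0, ← integral_zext_eq G hx]
  simp only [hP]
  ring

lemma eq_of_integral_eq (h : ∀ x ∈ Icc (0 : ℝ) 1, ∫ s in (0 : ℝ)..x, G s = ∫ s in (0 : ℝ)..x, G' s) : G = G' := by
  have h1 : HasWeakDeriv (fun x => ∫ s in (0 : ℝ)..x, G s) G :=
    hasWeakDeriv_of_eq_integral (a := 0) fun x _ => (zero_add _).symm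
  have h2 : HasWeakDeriv (fun x => ∫ s in (0 : ℝ)..x, G s) G' :=
    hasWeakDeriv_of_eq_integral (a := 0) fun x hx => by rw [h x hx, zero_add]
  exact h1.unique h2

lemma L2I.intervalIntegrable (q : L2I) {x : ℝ} (hx : x ∈ Icc (0 : ℝ) 1) : IntervalIntegrable q volume 0 x := by
  rw [intervalIntegrable_iff_integrableOn_Ioo_of_le hx.1]
  exact (show IntegrableOn q (Ioo 0 1) volume from L2I.integrable q).mono_set (Ioo_subset_Ioo_right hx.2)

lemma integral_add_smul_oneL2 (q : L2I) (c : ℝ) {x : ℝ} (hx : x ∈ Icc (0 : ℝ) 1) :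
    ∫ s in (0 : ℝ)..x, (q + c • oneL2 : L2I) s = (∫ s in (0 : ℝ)..x, q s) + c * x := by
  have h : ∫ s in (0 : ℝ)..x, (q + c • oneL2 : L2I) s = ∫ s in (0 : ℝ)..x, (q s + c) := by
    rw [intervalIntegral.integral_of_le hx.1, intervalIntegral.integral_of_le hx.1, integral_Ioc_eq_integral_Ioo,
      integral_Ioc_eq_integral_Ioo]
    refine integral_congr_ae (ae_restrict_of_ae_restrict_of_subset (Ioo_subset_Ioo_right hx.2) ?_)
    filter_upwards [Lp.coeFn_add q (c • oneL2), Lp.coeFn_smul c oneL2, coeFn_oneL2] with s h1 h2 h3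
    rw [h1, Pi.add_apply, h2, Pi.smul_apply, h3, smul_eq_mul, mul_one]
  rw [h, intervalIntegral.integral_add (q.intervalIntegrable hx) intervalIntegrable_const,
    intervalIntegral.integral_const, smul_eq_mul, sub_zero, mul_comm x]

end WeakDeriv

/-! ### H¹_0(0,1) and the Riesz representation of H^{-1}(0,1). -/

section HOne
open Filter Topology

open scoped RealInnerProductSpace

lemma norm_testDeriv_eq (φ : testSpace) : ‖testDeriv φ‖ = ‖energyIncl 1 φ‖ := by
  rw [← Real.sqrt_sq (norm_nonneg (testDeriv φ)), ← Real.sqrt_sq (norm_nonneg (energyIncl 1 φ)), norm_testDeriv_sq,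
    norm_energyIncl_sq, NNReal.coe_one, seminormSq_one (isTest_coe φ).isCS]

/-- The weak derivative on `H¹_0(0,1)`. -/
def energyDeriv : energySpace 1 →L[ℝ] meanZero := testDeriv.extendOfNorm (energyIncl 1)

lemma energyDeriv_incl (φ : testSpace) : energyDeriv (energyIncl 1 φ) = testDeriv φ :=
  LinearMap.extendOfNorm_eq denseRange_energyIncl ⟨1, fun φ => by rw [one_mul, norm_testDeriv_eq]⟩ φ

lemma norm_energyDeriv (e : energySpace 1) : ‖energyDeriv e‖ = ‖e‖ := by
  refine denseRange_energyIncl.induction_on (p := fun e => ‖energyDeriv e‖ = ‖e‖) e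
    (isClosed_eq (by fun_prop) (by fun_prop)) fun φ => ?_
  rw [energyDeriv_incl, norm_testDeriv_eq]

/-- An isometry has closed range, and this range contains the dense set of derivatives of test
functions. -/
lemma energyDeriv_bijective : Function.Bijective energyDeriv := by
  have hiso : Isometry energyDeriv := AddMonoidHomClass.isometry_of_norm _ norm_energyDeriv
  refine ⟨hiso.injective, ?_⟩
  have hd : Dense (range energyDeriv) := denseRange_testDeriv.mono (by
    rintro _ ⟨φ, rfl⟩
    exact ⟨_, energyDeriv_incl φ⟩)
  rw [← range_eq_univ, ← hiso.isClosedEmbedding.isClosed_range.closure_eq]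
  exact hd.closure_eq

lemma hasWeakDeriv_energyToL2 (e : energySpace 1) : HasWeakDeriv (energyToL2 1 e) (energyDeriv e) := by
  refine ⟨Lp.memLp _, fun v hv => ?_⟩
  have h := inner_testDeriv (energyToL2 1 e) ⟨v, hv⟩
  have h' : ⟪(energyDeriv e : L2I), testToL2 ⟨v, hv⟩⟫ = ∫ x in Ioo (0 : ℝ) 1, (energyDeriv e : L2I) x * v x := by
    rw [real_inner_comm, testToL2]
    change ⟪hv.memLp.toLp v, _⟫ = _
    rw [inner_toLp]
    simp only [mul_comm]
  rw [← h, ← h']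
  refine denseRange_energyIncl.induction_on (p := fun e => ⟪energyToL2 1 e, (testDeriv ⟨v, hv⟩ : L2I)⟫
    = -⟪(energyDeriv e : L2I), testToL2 ⟨v, hv⟩⟫) e (isClosed_eq (by fun_prop) (by fun_prop)) fun φ => ?_
  rw [energyToL2_incl one_pos, energyDeriv_incl, inner_testDeriv, real_inner_comm, inner_testDeriv]
  have e1 : ∫ x in Ioo (0 : ℝ) 1, testToL2 φ x * deriv v x = ∫ x, (φ : ℝ → ℝ) x * deriv v x := by
    rw [← hv.deriv.mul_setIntegral_eq]
    refine integral_congr_ae ?_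
    filter_upwards [coeFn_testToL2 φ] with x hx
    rw [hx]
  have e2 : ∫ x in Ioo (0 : ℝ) 1, testToL2 ⟨v, hv⟩ x * deriv (φ : ℝ → ℝ) x = ∫ x, deriv (φ : ℝ → ℝ) x * v x := by
    rw [← hv.mul_setIntegral_eq]
    refine integral_congr_ae ?_
    filter_upwards [coeFn_testToL2 ⟨v, hv⟩] with x hx
    rw [hx, mul_comm]
  change ∫ x in Ioo (0 : ℝ) 1, testToL2 φ x * deriv v x = _
  rw [e1, e2]
  have hφ := (isTest_coe φ).isCS
  exact integral_mul_deriv_eq_deriv_mul_of_integrable (fun x _ => (hφ.differentiable x).hasDerivAt)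
    (fun x _ => (hv.isCS.differentiable x).hasDerivAt) (hφ.integrable_mul hv.deriv.isCS)
    (hφ.deriv.integrable_mul hv.isCS) (hφ.integrable_mul hv.isCS)

lemma exists_hNorm_le : ∃ C : ℝ≥0, ∀ e : energySpace 1, hNorm 1 (zext (energyToL2 1 e)) ≤ C * ‖energyDeriv e‖ₑ := by
  refine ⟨‖energyToL2 1‖₊ + 1, fun e => (hNorm_le_add _ _).trans ?_⟩
  have h1 : ‖energyToL2 1 e‖ₑ ≤ ‖energyToL2 1‖₊ * ‖e‖ₑ := (energyToL2 1).le_opENorm e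
  have h2 : hSeminorm 1 (zext (energyToL2 1 e)) ≤ ‖e‖ₑ := by
    have := hSeminorm_zext_le one_pos e
    rwa [NNReal.coe_one] at this
  have h3 : ‖energyDeriv e‖ₑ = ‖e‖ₑ := by
    rw [← ofReal_norm, ← ofReal_norm, norm_energyDeriv]
  rw [eLpNorm_zext, h3, ENNReal.coe_add, ENNReal.coe_one, add_mul, one_mul]
  exact add_le_add h1 h2

/-- The Riesz representation of elements of `H^{-1}(0,1)`. -/
lemma exists_riesz (f : H01 →ₗ[ℝ] ℝ) (hf : IsHNegOne f) :
    ∃ g : meanZero, (∀ (v : H01) (e : energySpace 1), energyToL2 1 e = v → f v = ⟪g, energyDeriv e⟫) := by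
  obtain ⟨C, hC⟩ := hf
  obtain ⟨D, hD⟩ := exists_hNorm_le
  let S : energySpace 1 ≃ₗ[ℝ] meanZero := LinearEquiv.ofBijective energyDeriv.toLinearMap energyDeriv_bijective
  -- The functional is transported to mean-zero functions by sending q to the element of H¹_0 with
  -- derivative q; there its bound in the H¹ norm becomes a bound in L².
  let ℓ : meanZero →ₗ[ℝ] ℝ := f ∘ₗ ((energyToL2 1).toLinearMap.codRestrict (H0 1) (energyToL2_mem_H0 one_pos))
    ∘ₗ S.symm.toLinearMap
  have hS : ∀ q, energyDeriv (S.symm q) = q := fun q => S.apply_symm_apply q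
  have hℓ : ∀ q, ‖ℓ q‖ ≤ (C * D : ℝ≥0) * ‖q‖ := by
    intro q
    have h1 := (hC ⟨energyToL2 1 (S.symm q), energyToL2_mem_H0 one_pos _⟩).trans
      (mul_le_mul_right (hD (S.symm q)) _)
    rw [hS, ← mul_assoc, ← ENNReal.coe_mul, ← enorm_norm q] at h1
    have h2 : ‖ℓ q‖ₑ ≤ ((C * D : ℝ≥0) : ℝ≥0∞) * ‖(‖q‖)‖ₑ := h1
    have h3 := ENNReal.toReal_mono (by finiteness) h2
    simpa using h3
  refine ⟨(InnerProductSpace.toDual ℝ meanZero).symm (ℓ.mkContinuous _ hℓ), fun v e he => ?_⟩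
  rw [InnerProductSpace.toDual_symm_apply]
  change f v = f ⟨energyToL2 1 (S.symm (S e)), _⟩
  refine congrArg f (Subtype.ext ?_)
  exact he.symm.trans (congrArg (energyToL2 1) (S.symm_apply_apply e).symm)

end HOne

/-! ### The diffusion equation in terms of flux and derivative. -/

section Diffusion
open Filter Topology

open scoped RealInnerProductSpace

variable {K : ℝ → ℝ} {K_m K_M : ℝ}

/-- The weak form of `-D(K DF) = f` in terms of the flux. -/
lemma isWeakDiffusion_iff_flux (hK : AEMeasurable K vol01) {M : ℝ} (hKb : ∀ᵐ x ∂vol01, |K x| ≤ M)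
    (f : H01 →ₗ[ℝ] ℝ) {g : meanZero}
    (hg : ∀ (v : H01) (e : energySpace 1), energyToL2 1 e = v → f v = ⟪g, energyDeriv e⟫) (F : ℝ → ℝ) :
    IsWeakDiffusion K F f ↔ ∃ G : L2I, HasWeakDeriv F G ∧ ∃ c : ℝ, ∀ᵐ x ∂vol01, K x * G x = (g : L2I) x + c := by
  constructor
  · rintro ⟨G, hG, h⟩
    refine ⟨G, hG, ?_⟩
    have hKG : Integrable (fun x => K x * G x) vol01 :=
      (L2I.integrable G).bdd_mul hK.aestronglyMeasurable hKb
    have hsub : Integrable (fun x => K x * G x - (g : L2I) x) vol01 := hKG.sub (L2I.integrable _)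
    obtain ⟨c, hc⟩ := eq_const_of_integral_mul_deriv_eq_zero hsub fun v hv => by
      set e := energyIncl 1 ⟨v, hv⟩ with he
      obtain ⟨dv, hdv, hi⟩ := h ⟨energyToL2 1 e, energyToL2_mem_H0 one_pos e⟩
      -- The derivative supplied by the weak formulation is the one of the energy space, by
      -- uniqueness of weak derivatives.
      rw [hdv.unique (hasWeakDeriv_energyToL2 e), hg _ e rfl, Submodule.coe_inner, he, energyDeriv_incl,
        inner_testDeriv] at hi
      obtain ⟨C, -, hC⟩ := hv.deriv.isCS.bounded
      have hb : ∀ {g : ℝ → ℝ}, Integrable g vol01 → Integrable (fun x => g x * deriv v x) vol01 := fun hg =>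
        hg.mul_bdd hv.deriv.1.continuous.aestronglyMeasurable (.of_forall hC)
      have e1 : ∫ x in Ioo (0 : ℝ) 1, K x * G x * (testDeriv ⟨v, hv⟩ : L2I) x
          = ∫ x in Ioo (0 : ℝ) 1, K x * G x * deriv v x := by
        refine integral_congr_ae ?_
        filter_upwards [coeFn_testDeriv ⟨v, hv⟩] with x hx
        rw [hx]
      rw [e1] at hi
      simp only [sub_mul]
      rw [integral_sub (hb hKG) (hb (L2I.integrable _)), hi, sub_self]
    exact ⟨c, by filter_upwards [hc] with x hx; linarith⟩
  · rintro ⟨G, hG, c, hc⟩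
    refine ⟨G, hG, fun v => ?_⟩
    obtain ⟨e, he⟩ := exists_energyToL2_eq one_pos v.2
    refine ⟨energyDeriv e, he ▸ hasWeakDeriv_energyToL2 e, ?_⟩
    -- The constant c drops out because derivatives of H¹_0 functions have mean zero.
    rw [hg v e he, Submodule.coe_inner, inner_eq_integral]
    have e1 : ∫ x in Ioo (0 : ℝ) 1, K x * G x * (energyDeriv e : L2I) x
        = ∫ x in Ioo (0 : ℝ) 1, ((g : L2I) x * (energyDeriv e : L2I) x + c * (energyDeriv e : L2I) x) := by
      refine integral_congr_ae ?_
      filter_upwards [hc] with x hx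
      rw [hx, add_mul]
    have i₁ : Integrable (fun x => (g : L2I) x * (energyDeriv e : L2I) x) vol01 := by
      have := L2.integrable_inner (𝕜 := ℝ) (g : L2I) (energyDeriv e : L2I)
      refine this.congr (.of_forall fun x => ?_)
      simp [mul_comm]
    rw [e1, integral_add i₁ ((L2I.integrable _).const_mul c), integral_const_mul, mem_meanZero.1 (energyDeriv e).2,
      mul_zero, add_zero]

/-- The weak form of `-D(K DF) = f` in terms of the derivative of `F`. -/
lemma exists_isWeakDiffusion_iff (hK : AEMeasurable K vol01) (hKm : 0 < K_m)
    (hKb : ∀ᵐ x ∂vol01, K_m ≤ K x ∧ K x ≤ K_M) :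
    ∃ k : L2I, 0 < (∫ x in Ioo (0 : ℝ) 1, k x) ∧ ∀ f : H01 →ₗ[ℝ] ℝ, IsHNegOne f →
      ∃ h : L2I, (f = 0 → h = 0) ∧ ∀ F, IsWeakDiffusion K F f ↔ ∃ c : ℝ, HasWeakDeriv F (h + c • k) := by
  have hdiv : ∀ g : L2I, MemLp (fun x => g x / K x) 2 vol01 := by
    intro g
    refine (Lp.memLp g).of_le_mul (c := 1 / K_m)
      ((aestronglyMeasurable_coe g).aemeasurable.div hK).aestronglyMeasurable ?_
    filter_upwards [hKb] with x hx
    have hx0 : 0 < K x := hKm.trans_le hx.1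
    rw [norm_div, Real.norm_of_nonneg hx0.le, div_eq_inv_mul, one_div]
    gcongr
    exact hx.1
  set k : L2I := (hdiv oneL2).toLp _ with hk
  have hkc : ∀ᵐ x ∂vol01, k x = 1 / K x := by
    filter_upwards [(hdiv oneL2).coeFn_toLp, coeFn_oneL2] with x h1 h2
    rw [hk, h1, h2]
  refine ⟨k, ?_, fun f hf => ?_⟩
  · rw [integral_pos_iff_support_of_nonneg_ae ?_ (L2I.integrable k)]
    · have : Function.support k =ᵐ[vol01] (univ : Set ℝ) := by
        filter_upwards [hkc, hKb] with x h1 h2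
        have hx0 : 0 < K x := hKm.trans_le h2.1
        refine propext ⟨fun _ => trivial, fun _ => ?_⟩
        change k x ≠ 0
        rw [h1]
        positivity
      rw [measure_congr this]
      simp
    · filter_upwards [hkc, hKb] with x h1 h2
      have hx0 : 0 < K x := hKm.trans_le h2.1
      rw [h1]
      change 0 ≤ 1 / K x
      positivity
  · have hKabs : ∀ᵐ x ∂vol01, |K x| ≤ K_M := by
      filter_upwards [hKb] with x hx
      rw [abs_of_pos (hKm.trans_le hx.1)]
      exact hx.2
    obtain ⟨g, hg⟩ := exists_riesz f hf
    -- With k = 1/K, the flux equation K F' = g + c reads F' = g/K + c k, so h = g/K.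
    refine ⟨(hdiv g).toLp _, fun h0 => ?_, fun F => ?_⟩
    · have hg0 : g = 0 := by
        obtain ⟨e, he⟩ := energyDeriv_bijective.2 g
        have := hg ⟨energyToL2 1 e, energyToL2_mem_H0 one_pos e⟩ e rfl
        rw [h0, he, LinearMap.zero_apply] at this
        exact inner_self_eq_zero.1 this.symm
      refine L2I.eq_zero_of_ae ?_
      filter_upwards [(hdiv g).coeFn_toLp, Lp.coeFn_zero ℝ 2 vol01] with x h1 h2
      rw [h1, hg0, Submodule.coe_zero, h2]
      simp
    · rw [isWeakDiffusion_iff_flux hK hKabs f hg]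
      have hae : ∀ c : ℝ, ∀ᵐ x ∂vol01, ((hdiv g).toLp _ + c • k : L2I) x = ((g : L2I) x + c) / K x := by
        intro c
        filter_upwards [Lp.coeFn_add ((hdiv g).toLp _) (c • k), Lp.coeFn_smul c k, hkc, (hdiv g).coeFn_toLp]
          with x h1 h2 h3 h4
        rw [h1, Pi.add_apply, h2, Pi.smul_apply, h3, h4, smul_eq_mul]
        ring
      constructor
      · rintro ⟨G, hG, c, hc⟩
        refine ⟨c, ?_⟩
        convert hG using 1
        refine Lp.ext ?_
        filter_upwards [hae c, hc, hKb] with x h1 h2 h3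
        have hx0 : 0 < K x := hKm.trans_le h3.1
        rw [h1, ← h2]
        field_simp
      · rintro ⟨c, hc⟩
        refine ⟨_, hc, c, ?_⟩
        filter_upwards [hae c, hKb] with x h1 h3
        have hx0 : 0 < K x := hKm.trans_le h3.1
        rw [h1]
        field_simp

end Diffusion

/-! ### Solutions and the left profile in terms of mean-free data. -/

section Solutions
open Filter Topology

variable {β θ : ℝ} {K : ℝ → ℝ}

/-- The weak derivative of the two-sided fractional integral of a solution. -/
lemma hasWeakDeriv_twoSidedInt_iff {R : meanZero →ₗ[ℝ] L2I} {m : ℝ → meanZero →ₗ[ℝ] ℝ}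
    (h : ∀ q, ∀ x ∈ Icc (0 : ℝ) 1, twoSidedInt β θ (R q) x = m x q ∧
        m x q = m 0 q * (1 - x) + m 1 q * x + ∫ s in (0 : ℝ)..x, (q : L2I) s) (q : meanZero) (G : L2I) :
    HasWeakDeriv (twoSidedInt β θ (R q)) G ↔ G = q + (m 1 q - m 0 q) • oneL2 := by
  have hw : HasWeakDeriv (twoSidedInt β θ (R q)) ((q : L2I) + (m 1 q - m 0 q) • oneL2) := by
    refine hasWeakDeriv_of_eq_integral (a := m 0 q) fun x hx => ?_
    rw [(h q x hx).1, (h q x hx).2, integral_add_smul_oneL2 _ _ hx]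
    ring
  exact ⟨fun hG => hG.unique hw, fun hG => hG ▸ hw⟩

lemma integral_oneL2 : ∫ x in Ioo (0 : ℝ) 1, oneL2 x = 1 := by
  rw [integral_congr_ae coeFn_oneL2]
  simp

/-- The integral over `(0,1)` as a linear functional. -/
def meanL2 : L2I →ₗ[ℝ] ℝ := (innerSL ℝ oneL2).toLinearMap

lemma meanL2_apply (q : L2I) : meanL2 q = ∫ x in Ioo (0 : ℝ) 1, q x := inner_oneL2 q

lemma meanL2_oneL2 : meanL2 oneL2 = 1 := by rw [meanL2_apply, integral_oneL2]

lemma meanL2_coe (q : meanZero) : meanL2 q = 0 := by rw [meanL2_apply]; exact mem_meanZero.1 q.2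

lemma coe_meanFree_eq (q : L2I) : (meanFree q : L2I) = q - meanL2 q • oneL2 := by
  rw [coe_meanFree, meanL2_apply]

/-- The left profile, up to normalisation of the coefficient `k = 1/K`. -/
lemma isLeftProfile_iff {k : L2I} (hk : 0 < meanL2 k)
    (hk0 : ∀ F, IsWeakDiffusion K F 0 ↔ ∃ c : ℝ, HasWeakDeriv F (c • k)) (w : ℝ → ℝ) :
    IsLeftProfile K w ↔ ContinuousOn w (Icc 0 1) ∧
      ∀ x ∈ Icc (0 : ℝ) 1, w x - (1 - x) = ∫ s in (0 : ℝ)..x, (oneL2 - (meanL2 k)⁻¹ • k : L2I) s := by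
  have hprim : ∀ x ∈ Icc (0 : ℝ) 1, ∫ s in (0 : ℝ)..x, (-(meanL2 k)⁻¹ • k : L2I) s
      = (∫ s in (0 : ℝ)..x, (oneL2 - (meanL2 k)⁻¹ • k : L2I) s) - x := by
    intro x hx
    have := integral_add_smul_oneL2 (-(meanL2 k)⁻¹ • k) 1 hx
    rw [show -(meanL2 k)⁻¹ • k + (1 : ℝ) • oneL2 = oneL2 - (meanL2 k)⁻¹ • k by module] at this
    rw [this]
    ring
  have hone : ∀ q : L2I, ∫ s in (0 : ℝ)..1, q s = meanL2 q := fun q => by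
    rw [meanL2_apply, intervalIntegral.integral_of_le zero_le_one, integral_Ioc_eq_integral_Ioo]
  constructor
  · rintro ⟨hc, h0, h1, hd⟩
    refine ⟨hc, fun x hx => ?_⟩
    obtain ⟨c, hcw⟩ := (hk0 w).1 hd
    have hc1 := hcw.eq_add_integral hc (right_mem_Icc.2 zero_le_one)
    rw [h0, h1, hone, map_smul, smul_eq_mul] at hc1
    -- The boundary values 1 and 0 force 0 = 1 + c∫k.
    have hcv : c = -(meanL2 k)⁻¹ := by field_simp; linarith
    have := hcw.eq_add_integral hc hx
    rw [hcv, hprim x hx, h0] at this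
    rw [this]
    ring
  · rintro ⟨hc, h⟩
    refine ⟨hc, ?_, ?_, (hk0 w).2 ⟨-(meanL2 k)⁻¹, ?_⟩⟩
    · have := h 0 (by simp)
      simp only [intervalIntegral.integral_same, sub_zero] at this
      linarith
    · have := h 1 (by simp)
      rw [hone, map_sub, map_smul, meanL2_oneL2, smul_eq_mul, inv_mul_cancel₀ hk.ne'] at this
      linarith
    · refine hasWeakDeriv_of_eq_integral (a := 1) fun x hx => ?_
      rw [hprim x hx, ← h x hx]
      ring

end Solutions

end FracDiffusion

end

/-! ### Reduction to one scalar equation and the role of (V). -/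

theorem theorem6p3 (β θ K_m K_M : ℝ) (hβ : 0 < β) (hβ' : β < 1 / 2) (hθ : 0 ≤ θ) (hθ' : θ ≤ 1)
    (K : ℝ → ℝ) (hK : AEMeasurable K vol01) (hKm : 0 < K_m)
    (hKb : ∀ᵐ x ∂vol01, K_m ≤ K x ∧ K x ≤ K_M) :
    (∃! ul : L2I, IsAuxiliary K β θ ul) ∧
    ∀ ul : L2I, IsAuxiliary K β θ ul → ∀ f : H01 →ₗ[ℝ] ℝ, IsHNegOne f →
      (SolvCondition β θ ul → ∃ u : L2I, IsPGSolution K β θ f u) ∧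
      ((∃! u : L2I, IsPGSolution K β θ f u) ↔ SolvCondition β θ ul) := by
  obtain ⟨R, m, hR, hm⟩ := exists_solution_operator hβ hβ' hθ hθ'
  obtain ⟨k, hk, hdiff⟩ := exists_isWeakDiffusion_iff hK hKm hKb
  rw [← meanL2_apply] at hk
  have hRinj : Function.Injective R := by
    rw [injective_iff_map_eq_zero]
    intro q hq
    refine Subtype.ext (eq_of_integral_eq fun x hx => ?_)
    have hz : ∀ y ∈ Icc (0 : ℝ) 1, m y q = 0 := fun y hy => by
      rw [← (hm q y hy).1, hq, ← map_zero R, (hm 0 y hy).1, map_zero]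
    have h1 := (hm q x hx).2
    have h2 := (hm 0 x hx).2
    simp only [map_zero] at h2
    rw [hz x hx, hz 0 (by simp), hz 1 (by simp)] at h1
    linarith
  -- This is the derivative of w_l - (1-x): since w_l' = -k/∫k, it equals 1 - k/∫k.
  set p : meanZero := meanFree (-(meanL2 k)⁻¹ • k) with hp
  have hpc : (p : L2I) = oneL2 - (meanL2 k)⁻¹ • k := by
    rw [hp, coe_meanFree_eq, map_smul, smul_eq_mul, neg_mul, inv_mul_cancel₀ hk.ne']
    module
  -- For zero data the particular term vanishes, so the weak derivatives that occur are exactly the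
  -- multiples of k.
  have hprofile := isLeftProfile_iff (K := K) hk fun F => by
    obtain ⟨h, h0, hF⟩ := hdiff 0 ⟨0, fun v => by simp⟩
    simpa [h0 rfl] using hF F
  have haux : ∀ u, IsAuxiliary K β θ u ↔ u = R p := by
    -- The subtracted terms are the boundary values of I^β_θ R q at 0 and 1, so only the primitive
    -- of q remains; the auxiliary equation then says q = p.
    have key : ∀ q : meanZero, ∀ x ∈ Icc (0 : ℝ) 1, twoSidedInt β θ (R q) x
        - (1 - θ) * rightInt β (R q) 0 * (1 - x) - θ * leftInt β (R q) 1 * x = ∫ s in (0 : ℝ)..x, (q : L2I) s := by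
      intro q x hx
      rw [← twoSidedInt_zero_right, ← twoSidedInt_one_right, (hm q x hx).1, (hm q 0 (by simp)).1,
        (hm q 1 (by simp)).1, (hm q x hx).2]
      ring
    intro u
    constructor
    · rintro ⟨hu, w, hw, h⟩
      obtain ⟨q, rfl⟩ := (hR u).1 hu
      refine congrArg R (Subtype.ext (eq_of_integral_eq fun x hx => ?_))
      rw [← key q x hx, h x hx, hpc, ((hprofile w).1 hw).2 x hx]
    · rintro rfl
      refine ⟨(hR _).2 ⟨p, rfl⟩, fun x => (1 - x) + ∫ s in (0 : ℝ)..x, zext p s, (hprofile _).2 ⟨?_, fun x hx => ?_⟩,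
        fun x hx => ?_⟩
      · exact ((continuous_const.sub continuous_id).add (continuous_integral_zext _)).continuousOn
      · rw [integral_zext_eq _ hx, hpc]
        ring
      · rw [key p x hx, ← integral_zext_eq _ hx]
        ring
  refine ⟨⟨R p, (haux _).2 rfl, fun u hu => (haux u).1 hu⟩, fun ul hul f hf => ?_⟩
  rw [(haux ul).1 hul]
  obtain ⟨h, -, hF⟩ := hdiff f hf
  set κ : meanZero →ₗ[ℝ] ℝ := m 1 - m 0 with hκ
  have hsolv : SolvCondition β θ (R p) ↔ 1 + κ p ≠ 0 := by
    rw [SolvCondition, ← twoSidedInt_zero_right, ← twoSidedInt_one_right, (hm p 0 (by simp)).1,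
      (hm p 1 (by simp)).1, hκ, LinearMap.sub_apply, add_sub_assoc]
  -- From q + κ(q) = h + c k, the unknown t is -c∫k: mean-free parts determine q as a function of t,
  -- and equating means gives the scalar equation for t.
  have hsol : ∀ u, IsPGSolution K β θ f u ↔
      ∃ t : ℝ, u = R (meanFree h + t • p) ∧ t * (1 + κ p) = meanL2 h - κ (meanFree h) := by
    intro u
    constructor
    · rintro ⟨hu, hw⟩
      obtain ⟨q, rfl⟩ := (hR u).1 hu
      obtain ⟨c, hc⟩ := (hF _).1 hw
      rw [hasWeakDeriv_twoSidedInt_iff hm] at hc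
      have hmean := congrArg meanL2 hc
      simp only [map_add, map_smul, meanL2_coe, meanL2_oneL2, smul_eq_mul] at hmean
      have hq : q = meanFree h + (-(c * meanL2 k)) • p := by
        apply Subtype.ext
        rw [Submodule.coe_add, Submodule.coe_smul, hpc, coe_meanFree_eq]
        have e1 : (q : L2I) = h + c • k - (m 1 q - m 0 q) • oneL2 := by rw [hc]; abel
        have e2 : m 1 q - m 0 q = meanL2 h + c * meanL2 k := by linarith
        rw [e1, e2, smul_sub, smul_smul, neg_mul, mul_assoc, mul_inv_cancel₀ hk.ne', mul_one]
        module
      refine ⟨-(c * meanL2 k), by rw [← hq], ?_⟩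
      have hκq : κ q = κ (meanFree h) + (-(c * meanL2 k)) * κ p := by
        conv_lhs => rw [hq]
        rw [map_add, map_smul, smul_eq_mul]
      have e2 : κ q = meanL2 h + c * meanL2 k := by rw [hκ, LinearMap.sub_apply]; linarith
      linarith
    · rintro ⟨t, rfl, ht⟩
      refine ⟨(hR _).2 ⟨_, rfl⟩, (hF _).2 ⟨-(t * (meanL2 k)⁻¹), ?_⟩⟩
      rw [hasWeakDeriv_twoSidedInt_iff hm]
      have e : m 1 (meanFree h + t • p) - m 0 (meanFree h + t • p) = meanL2 h - t := by
        rw [← LinearMap.sub_apply, ← hκ, map_add, map_smul, smul_eq_mul]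
        linarith
      rw [e, Submodule.coe_add, Submodule.coe_smul, hpc, coe_meanFree_eq]
      module
  have hex : 1 + κ p ≠ 0 → IsPGSolution K β θ f
      (R (meanFree h + ((meanL2 h - κ (meanFree h)) / (1 + κ p)) • p)) := fun h0 =>
    (hsol _).2 ⟨_, rfl, div_mul_cancel₀ _ h0⟩
  refine ⟨fun hV => ⟨_, hex (hsolv.1 hV)⟩, fun hu => hsolv.2 fun h0 => ?_, fun hV => ⟨_, hex (hsolv.1 hV), ?_⟩⟩
  · obtain ⟨u, hu, huniq⟩ := hu
    obtain ⟨t, rfl, ht⟩ := (hsol u).1 hu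
    -- When 1 + κ(p) = 0 the scalar equation does not involve t, so t + 1 works as well. Uniqueness
    -- would give p = 0, hence κ(p) = 0, contradicting κ(p) = -1.
    have h1 := huniq _ ((hsol _).2 ⟨t + 1, rfl, by rw [h0, mul_zero] at ht ⊢; exact ht⟩)
    have h2 := hRinj h1
    have h3 : p = 0 := by
      have := sub_eq_zero.2 h2
      rw [add_sub_add_left_eq_sub, add_smul, one_smul, add_sub_cancel_left] at this
      exact this
    rw [h3, map_zero] at h0
    norm_num at h0
  · intro u hu
    obtain ⟨t, rfl, ht⟩ := (hsol u).1 hu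
    rw [← ht, mul_div_cancel_right₀ _ (hsolv.1 hV)]
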